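/- **Setting.** Let $T$ be a finite set of targets and $d_1\ne d_2$ two depots; put $V_i=T\cup\{d_i\}$ and let $E_i$ be the set of all edges joining two distinct vertices of $V_i$ ($i=1,2$). Let $cost^i_e\ge 0$ ($e\in E_i$) be edge costs that satisfy the triangle inequality for each $i$, with $cost^1_e\le cost^2_e$ for every edge $e$ joining two targets. The two-depot heterogeneous travelling salesman problem (2DHTSP) asks for a tour from $d_1$ and a tour from $d_2$ (a closed sequence $d_i,t_1,\dots,t_k,d_i$ of cost $cost^i_{d_it_1}+\dots+cost^i_{t_kd_i}$, or $0$ if $k=0$) such that each target is visited exactly once by exactly one of them, of minimum total cost $OPT$. For $S\subseteq T$ let $\delta_i(S)\subseteq E_i$ be the edges with exactly one end in $S$. The LP relaxation is to minimize $\sum_{e\in E_1}cost^1_ex_e+\sum_{e\in E_2}cost^2_ey_e$ over $x,y,z\ge0$ ($z$ indexed by the subsets of $T$) such that $\sum_{e\in\delta_1(S)}x_e+2\sum_{S\subseteq U\subseteq T}z_U\ge2$ and $\sum_{e\in\delta_2(S)}y_e\ge2\sum_{S\subseteq U\subseteq T}z_U$ for all $\emptyset\ne S\subseteq T$. Its dual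 is to maximize $2\sum_SY_1(S)$ over $Y_1,Y_2\ge0$ indexed by the nonempty $S\subseteq T$ such that $\sum_{S:e\in\delta_i(S)}Y_i(S)\le cost^i_e$ for $e\in E_i$, $i=1,2$, and $\sum_{S\subseteq U}Y_1(S)\le\sum_{S\subseteq U}Y_2(S)$ for all $U\subseteq T$. **Algorithm.** Maintain forests $F_1,F_2$ on $V_1,V_2$, initially without edges, and $Y_1=Y_2=0$. A component of $F_i$ is active or inactive; initially it is inactive iff it contains $d_i$. A component $C_2$ of $F_2$ is a child of a component $C_1$ of $F_1$ if $d_2\notin C_2\subseteq C_1$. While $F_1$ has an active component, increase $Y_i(C)$ uniformly, by the same amount, for all active components $C$ of $F_i$, $i=1,2$, until (1) the dual constraint of an edge of $E_1$ joining two components of $F_1$, at least one of them active, becomes tight, or (2) the same happens for $E_2$ and $F_2$, or (3) $\sum_{S\subseteq\overline C}Y_1(S)=\sum_{S\subseteq\overline C}Y_2(S)$ for an active component $\overline C$ of $F_1$ without children. Resolve ties between the cases in the order (1), (2), (3), and ties within a case arbitrarily. In cases (1) and (2) add one such edge to $F_i$; the merged component is inactive if it contains $d_i$ and active otherwise; in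 case (1), if it contains $d_1$, all its children become inactive too. In case (3) deactivate $\overline C$ and mark its unmarked vertices with the label $\overline C$. *Pruning*: obtain $F_1'$ from $F_1$ by removing as many edges as possible such that all unmarked vertices of $V_1$ are connected to $d_1$ and, whenever a vertex with label $C$ is connected to $d_1$, so is every vertex with a label $C'\supseteq C$. Obtain $F_2'$ from $F_2$ by removing as many edges as possible such that every target not connected to $d_1$ by $F_1'$ is connected to $d_2$ by $F_2'$. *Tours*: double the edges of $F_1'$ and of $F_2'$, follow a closed walk from $d_i$ that uses each doubled edge once per copy, and shortcut repeated visits. **Theorem.** The main loop never gets stuck and stops after at most $3|T|+2$ iterations, and pruning is possible. Every feasible pair of tours gives a feasible point of the LP of the same cost. However ties are resolved, $F_1'$ and $F_2'$ form a heterogeneous spanning forest: $F_1'$ is a tree containing $d_1$, $F_2'$ is a tree containing $d_2$, and each target lies in exactly one of them. The final $Y_1,Y_2$ are feasible for the dual, and $$\sum_{e\in F'_1}cost^1_e+\sum_{e\in F'_2}cost^2_e\;\le\;2\sum_{S}Y_1(S)\;\le\;OPT,$$ where $2\sum_SY_1(S)$ is also at most the cost of every feasible point of the LP. Tours as described exist,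 and any such tours are a feasible solution of the 2DHTSP of cost at most $2\,OPT$. The complete procedure (with some rule for ties) can be carried out by one program, the same for all inputs, in a number of steps polynomial in $|T|$, where a step is an elementary operation on references, lists and counters, or an addition, subtraction, halving or comparison of real numbers. Hence it is a polynomial-time 2-approximation algorithm for this variant of the 2DHTSP. -/

import Mathlib

noncomputable section

namespace TwoDepot

open Finset

/-- Vertices of either vehicle: `some t` is the target `t`, `none` is the depot of that vehicle
(`d₁` for the first vehicle, `d₂` for the second). -/
abbrev Vertex (T : Type*) := Option T

/-- Undirected edges (loops, which are not edges of the problem, are the diagonal elements). -/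
abbrev Edge (T : Type*) := Sym2 (Vertex T)

/-- A two-depot heterogeneous instance: edge costs for each vehicle, nonnegative and satisfying the
triangle inequality, with the first vehicle at most as expensive as the second between targets.
The value of a cost function at a loop is irrelevant. -/
structure Instance (T : Type*) where
  cost₁ : Edge T → ℝ
  cost₂ : Edge T → ℝ
  nonneg₁ : ∀ u v, u ≠ v → 0 ≤ cost₁ s(u, v)
  nonneg₂ : ∀ u v, u ≠ v → 0 ≤ cost₂ s(u, v)
  triangle₁ : ∀ u v w, u ≠ v → v ≠ w → u ≠ w → cost₁ s(u, w) ≤ cost₁ s(u, v) + cost₁ s(v, w)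
  triangle₂ : ∀ u v w, u ≠ v → v ≠ w → u ≠ w → cost₂ s(u, w) ≤ cost₂ s(u, v) + cost₂ s(v, w)
  cheaper : ∀ a b : T, a ≠ b → cost₁ s(some a, some b) ≤ cost₂ s(some a, some b)

/-! ### Tours -/

section Tours

variable {T : Type*}

/-- Cost of going from the target `t` through the listed targets and back to the depot. -/
def returnCost (c : Edge T → ℝ) : T → List T → ℝ
  | t, [] => c s(some t, none)
  | t, t' :: l => c s(some t, some t') + returnCost c t' l

/-- Cost of the closed tour that leaves the depot, visits the listed targets in order and returns
to the depot (`0` for a vehicle that does not leave its depot). -/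
def tourCost (c : Edge T → ℝ) : List T → ℝ
  | [] => 0
  | t :: l => c s(none, some t) + returnCost c t l

/-- Feasible pairs of tours: every target is visited exactly once, by exactly one vehicle. -/
def IsTourPair (l₁ l₂ : List T) : Prop :=
  (l₁ ++ l₂).Nodup ∧ ∀ t : T, t ∈ l₁ ++ l₂

/-- Total cost of a pair of tours. -/
def Instance.pairCost (I : Instance T) (l₁ l₂ : List T) : ℝ :=
  tourCost I.cost₁ l₁ + tourCost I.cost₂ l₂

/-- The set of costs of feasible pairs of tours; its least element is the optimal cost. -/
def Instance.tourCosts (I : Instance T) : Set ℝ :=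
  {r | ∃ l₁ l₂ : List T, IsTourPair l₁ l₂ ∧ r = I.pairCost l₁ l₂}

end Tours

/-! ### The linear programming relaxation and its dual -/

section LP

variable {T : Type*} [Fintype T] [DecidableEq T]

/-- All edges joining two distinct vertices of a vehicle. -/
def edges (T : Type*) [Fintype T] [DecidableEq T] : Finset (Edge T) :=
  univ.filter fun e => ¬ e.IsDiag

/-- The cut `δ(S)` of a set `S` of targets. -/
def cut (S : Finset T) : Finset (Edge T) :=
  univ.filter fun e => ∃ a ∈ S, ∃ v : Vertex T, v ∉ S.map Function.Embedding.some ∧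
    e = s(some a, v)

/-- Feasible points of the linear programming relaxation. -/
structure LPFeasible (x y : Edge T → ℝ) (z : Finset T → ℝ) : Prop where
  cover : ∀ S : Finset T, S.Nonempty →
    2 ≤ ∑ e ∈ cut S, x e + 2 * ∑ U : Finset T with S ⊆ U, z U
  second : ∀ S : Finset T, S.Nonempty →
    2 * ∑ U : Finset T with S ⊆ U, z U ≤ ∑ e ∈ cut S, y e
  x_nonneg : ∀ e ∈ edges T, 0 ≤ x e
  y_nonneg : ∀ e ∈ edges T, 0 ≤ y e
  z_nonneg : ∀ U, 0 ≤ z U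

/-- Objective function of the linear programming relaxation. -/
def Instance.lpCost (I : Instance T) (x y : Edge T → ℝ) : ℝ :=
  ∑ e ∈ edges T, I.cost₁ e * x e + ∑ e ∈ edges T, I.cost₂ e * y e

/-- Feasible points of the dual program (variables indexed by the nonempty sets of targets). -/
structure Instance.DualFeasible (I : Instance T) (Y₁ Y₂ : Finset T → ℝ) : Prop where
  edge₁ : ∀ e ∈ edges T, ∑ S : Finset T with e ∈ cut S, Y₁ S ≤ I.cost₁ e
  edge₂ : ∀ e ∈ edges T, ∑ S : Finset T with e ∈ cut S, Y₂ S ≤ I.cost₂ e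
  bound : ∀ U : Finset T, ∑ S : Finset T with S.Nonempty ∧ S ⊆ U, Y₁ S ≤
    ∑ S : Finset T with S.Nonempty ∧ S ⊆ U, Y₂ S
  nonneg₁ : ∀ S : Finset T, S.Nonempty → 0 ≤ Y₁ S
  nonneg₂ : ∀ S : Finset T, S.Nonempty → 0 ≤ Y₂ S

/-- Objective function of the dual program. -/
def dualValue (Y₁ : Finset T → ℝ) : ℝ :=
  2 * ∑ S : Finset T with S.Nonempty, Y₁ S

end LP

/-! ### The primal-dual algorithm: main loop -/

/-- State of the main loop. Components are finite sets of vertices; the entries of the tables at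
sets that are not current components are never read. `Y₁`, `Y₂` are the dual variables. -/
structure State (T : Type*) where
  F₁ : Finset (Edge T)
  F₂ : Finset (Edge T)
  C₁ : Finset (Finset (Vertex T))
  C₂ : Finset (Finset (Vertex T))
  active₁ : Finset (Vertex T) → ℕ
  active₂ : Finset (Vertex T) → ℕ
  p₁ : Vertex T → ℝ
  p₂ : Vertex T → ℝ
  w : Finset (Vertex T) → ℝ
  bound : Finset (Vertex T) → ℝ
  children : Finset (Vertex T) → Finset (Finset (Vertex T))
  parent : Finset (Vertex T) → Finset (Vertex T)
  /-- `none` means unmarked -/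
  label : Vertex T → Option (Finset (Vertex T))
  Y₁ : Finset T → ℝ
  Y₂ : Finset T → ℝ

section Algorithm

variable {T : Type*} [Fintype T] [DecidableEq T]

/-- Initialization: every vertex is its own component, active unless it is a depot. -/
def State.start (T : Type*) [Fintype T] [DecidableEq T] : State T where
  F₁ := ∅
  F₂ := ∅
  C₁ := univ.image fun v => {v}
  C₂ := univ.image fun v => {v}
  active₁ := fun C => if none ∈ C then 0 else 1
  active₂ := fun C => if none ∈ C then 0 else 1
  p₁ := fun _ => 0
  p₂ := fun _ => 0
  w := fun _ => 0
  bound := fun _ => 0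
  children := fun C => if none ∈ C then ∅ else {C}
  parent := fun C => if none ∈ C then ∅ else C
  label := fun _ => none
  Y₁ := fun _ => 0
  Y₂ := fun _ => 0

/-- The loop condition: some component of the first vehicle is active. -/
def State.Running (s : State T) : Prop := ∃ C ∈ s.C₁, s.active₁ C = 1

/-- Increase the dual variable of every active component by `ε`, and update the tables. -/
def State.grow (s : State T) (ε : ℝ) : State T :=
  { s with
    w := fun C => if C ∈ s.C₁ ∧ s.active₁ C = 1 then s.w C + ε else s.w C
    p₁ := fun v => if ∃ C ∈ s.C₁, s.active₁ C = 1 ∧ v ∈ C then s.p₁ v + ε else s.p₁ v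
    bound := fun C => if C ∈ s.C₁ ∧ s.active₁ C = 1 then
      s.bound C + ε * ((s.children C).card : ℝ) else s.bound C
    p₂ := fun v => if ∃ C ∈ s.C₂, s.active₂ C = 1 ∧ v ∈ C then s.p₂ v + ε else s.p₂ v
    Y₁ := fun S => if S.map Function.Embedding.some ∈ s.C₁ ∧
      s.active₁ (S.map Function.Embedding.some) = 1 then s.Y₁ S + ε else s.Y₁ S
    Y₂ := fun S => if S.map Function.Embedding.some ∈ s.C₂ ∧
      s.active₂ (S.map Function.Embedding.some) = 1 then s.Y₂ S + ε else s.Y₂ S }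

/-- Add the edge `e` to `F₁` and merge the components `Cx`, `Cy` that it joins. -/
def State.merge₁ (s : State T) (e : Edge T) (Cx Cy : Finset (Vertex T)) : State T :=
  { s with
    F₁ := insert e s.F₁
    C₁ := insert (Cx ∪ Cy) ((s.C₁.erase Cx).erase Cy)
    w := Function.update s.w (Cx ∪ Cy) (s.w Cx + s.w Cy)
    children := Function.update s.children (Cx ∪ Cy) (s.children Cx ∪ s.children Cy)
    parent := fun C => if C ∈ s.children Cx ∪ s.children Cy then Cx ∪ Cy else s.parent C
    bound := Function.update s.bound (Cx ∪ Cy) (s.bound Cx + s.bound Cy)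
    active₁ := Function.update s.active₁ (Cx ∪ Cy) (if none ∈ Cx ∪ Cy then 0 else 1)
    active₂ := fun C =>
      if none ∈ Cx ∪ Cy ∧ C ∈ s.children Cx ∪ s.children Cy then 0 else s.active₂ C }

/-- Add the edge `e` to `F₂` and merge the components `Cx`, `Cy` that it joins. -/
def State.merge₂ (s : State T) (e : Edge T) (Cx Cy : Finset (Vertex T)) : State T :=
  if none ∈ Cx ∪ Cy then
    let C := if none ∈ Cx then Cy else Cx
    { s with
      F₂ := insert e s.F₂
      C₂ := insert (Cx ∪ Cy) ((s.C₂.erase Cx).erase Cy)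
      active₂ := Function.update s.active₂ (Cx ∪ Cy) 0
      parent := Function.update s.parent (Cx ∪ Cy) ∅
      children := Function.update s.children (s.parent C) ((s.children (s.parent C)).erase C) }
  else
    { s with
      F₂ := insert e s.F₂
      C₂ := insert (Cx ∪ Cy) ((s.C₂.erase Cx).erase Cy)
      active₂ := Function.update s.active₂ (Cx ∪ Cy) 1
      parent := Function.update s.parent (Cx ∪ Cy) (s.parent Cx)
      children := Function.update s.children (s.parent Cx)
        (insert (Cx ∪ Cy) (((s.children (s.parent Cx)).erase Cx).erase Cy)) }

/-- Deactivate the component `C` of the first vehicle and mark its unmarked vertices. -/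
def State.deactivate (s : State T) (C : Finset (Vertex T)) : State T :=
  { s with
    active₁ := Function.update s.active₁ C 0
    label := fun v => if v ∈ C ∧ s.label v = none then some C else s.label v }

/-- The edge `s(i, j)` joins the distinct components `Cx ∋ i` and `Cy ∋ j`, at least one of them
active, and its dual constraint becomes tight when the dual variables are increased by `ε`. -/
structure IsLink (cost : Edge T → ℝ) (comps : Finset (Finset (Vertex T)))
    (active : Finset (Vertex T) → ℕ) (p : Vertex T → ℝ) (ε : ℝ)
    (Cx Cy : Finset (Vertex T)) (i j : Vertex T) : Prop where
  memx : Cx ∈ comps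
  memy : Cy ∈ comps
  ne : Cx ≠ Cy
  hi : i ∈ Cx
  hj : j ∈ Cy
  pos : 0 < active Cx + active Cy
  eq : ε = (cost s(i, j) - p i - p j) / ((active Cx + active Cy : ℕ) : ℝ)

namespace Instance

variable (I : Instance T) (s : State T) (ε : ℝ)

/-- `ε` is the value of an edge competing for `ε₁`. -/
def Cand₁ : Prop := ∃ Cx Cy i j, IsLink I.cost₁ s.C₁ s.active₁ s.p₁ ε Cx Cy i j

/-- `ε` is the value of an edge competing for `ε₂`. -/
def Cand₂ : Prop := ∃ Cx Cy i j, IsLink I.cost₂ s.C₂ s.active₂ s.p₂ ε Cx Cy i j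

/-- The active, childless component `C` of the first vehicle becomes tight at `ε`. -/
def IsTight (C : Finset (Vertex T)) : Prop :=
  C ∈ s.C₁ ∧ s.active₁ C = 1 ∧ s.children C = ∅ ∧ ε = s.bound C - s.w C

/-- `ε` is the minimum of `ε₁`, `ε₂`, `ε₃` (a minimum over no candidates being infinite). -/
def IsIncrement : Prop :=
  IsLeast {δ : ℝ | Cand₁ I s δ ∨ Cand₂ I s δ ∨ ∃ C, IsTight s δ C} ε

/-- One iteration of the main loop. Ties between the three cases are resolved in the order
`ε₁`, `ε₂`, `ε₃`; ties inside a case are resolved arbitrarily. -/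
inductive Step (I : Instance T) : State T → State T → Prop
  | case₁ (s : State T) (ε : ℝ) (Cx Cy : Finset (Vertex T)) (i j : Vertex T) :
      s.Running → IsIncrement I s ε →
      IsLink I.cost₁ s.C₁ s.active₁ s.p₁ ε Cx Cy i j →
      Step I s ((s.grow ε).merge₁ s(i, j) Cx Cy)
  | case₂ (s : State T) (ε : ℝ) (Cx Cy : Finset (Vertex T)) (i j : Vertex T) :
      s.Running → IsIncrement I s ε → ¬ Cand₁ I s ε →
      IsLink I.cost₂ s.C₂ s.active₂ s.p₂ ε Cx Cy i j →
      Step I s ((s.grow ε).merge₂ s(i, j) Cx Cy)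
  | case₃ (s : State T) (ε : ℝ) (C : Finset (Vertex T)) :
      s.Running → IsIncrement I s ε → ¬ Cand₁ I s ε → ¬ Cand₂ I s ε →
      IsTight s ε C →
      Step I s ((s.grow ε).deactivate C)

/-- `Reached I k s`: the main loop can be in state `s` after `k` iterations. -/
inductive Reached (I : Instance T) : ℕ → State T → Prop
  | start : Reached I 0 (State.start T)
  | next (k : ℕ) (s s' : State T) : Reached I k s → Step I s s' → Reached I (k + 1) s'

/-- The main loop can terminate in state `s`. -/
def Terminal (I : Instance T) (s : State T) : Prop :=
  (∃ k, Reached I k s) ∧ ¬ s.Running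

end Instance

/-! ### Pruning -/

/-- The graph on the vertices of a vehicle with edge set `F`. -/
abbrev graph (F : Finset (Edge T)) : SimpleGraph (Vertex T) :=
  SimpleGraph.fromEdgeSet (F : Set (Edge T))

/-- Requirements on the edges kept for the first vehicle. -/
structure Keeps₁ (s : State T) (F : Finset (Edge T)) : Prop where
  sub : F ⊆ s.F₁
  unmarked : ∀ v, s.label v = none → (graph F).Reachable v none
  marked : ∀ u v C C', s.label u = some C → s.label v = some C' → C ⊆ C' →
    (graph F).Reachable u none → (graph F).Reachable v none

/-- Requirements on the edges kept for the second vehicle, given the edges `F₁` kept for the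
first. -/
structure Keeps₂ (s : State T) (F₁ F : Finset (Edge T)) : Prop where
  sub : F ⊆ s.F₂
  cover : ∀ t : T, ¬ (graph F₁).Reachable (some t) none → (graph F).Reachable (some t) none

/-- `F₁`, `F₂` are the forests of the state `s` after as many edges as possible are removed. -/
structure Pruned (s : State T) (F₁ F₂ : Finset (Edge T)) : Prop where
  keeps₁ : Keeps₁ s F₁
  min₁ : ∀ G, Keeps₁ s G → F₁.card ≤ G.card
  keeps₂ : Keeps₂ s F₁ F₂
  min₂ : ∀ G, Keeps₂ s F₁ G → F₂.card ≤ G.card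

/-! ### Heterogeneous spanning forests, doubling and shortcutting -/

/-- `F` is the edge set of a tree whose vertices are the depot and the targets in `A`. -/
def IsTreeOn (F : Finset (Edge T)) (A : Finset T) : Prop :=
  (∀ e ∈ F, ¬ e.IsDiag ∧ ∀ v ∈ e, v ∈ insertNone A) ∧
    ((graph F).induce (insertNone A : Set (Vertex T))).IsTree

/-- Heterogeneous spanning forest: a tree containing `d₁` and a tree containing `d₂` such that each
target lies in exactly one of them. -/
def IsHSF (F₁ F₂ : Finset (Edge T)) : Prop :=
  ∃ A : Finset T, IsTreeOn F₁ A ∧ IsTreeOn F₂ Aᶜ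

/-- Total cost of the forest. -/
def Instance.forestCost (I : Instance T) (F₁ F₂ : Finset (Edge T)) : ℝ :=
  ∑ e ∈ F₁, I.cost₁ e + ∑ e ∈ F₂, I.cost₂ e

/-- The tour `l` arises from `F` by doubling the edges and shortcutting: along a closed walk from
the depot that uses each edge of `F` exactly twice, all but one occurrence of each target (and all
intermediate visits of the depot) are skipped. -/
def IsShortcut (F : Finset (Edge T)) (l : List T) : Prop :=
  ∃ W : (graph F).Walk none none, (∀ e ∈ F, W.edges.count e = 2) ∧
    l.Nodup ∧ (l.map some).Sublist W.support ∧ ∀ t : T, some t ∈ W.support → t ∈ l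

/-- `l₁`, `l₂` is a pair of tours that the complete procedure can return: primal-dual main loop,
pruning, doubling and shortcutting. -/
def Instance.Returns (I : Instance T) (l₁ l₂ : List T) : Prop :=
  ∃ s F₁ F₂, I.Terminal s ∧ Pruned s F₁ F₂ ∧ IsShortcut F₁ l₁ ∧ IsShortcut F₂ l₂

end Algorithm

/-! ### A programming language with a step count -/

/-- Data types of the language. -/
inductive Ty : Type
  | nat : Ty
  | real : Ty
  | prod : Ty → Ty → Ty
  | list : Ty → Ty

/-- The values of a data type. -/
@[reducible] def Ty.Val : Ty → Type
  | .nat => ℕ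
  | .real => ℝ
  | .prod a b => a.Val × b.Val
  | .list a => List a.Val

/-- Programs, with input and output types. The only operations on reals are addition, subtraction,
halving and comparison, and the only arithmetic operation on naturals is the successor, so that a
step lengthens the numbers in use by at most one bit. Pairs and lists are stored by reference. -/
inductive Prog : Ty → Ty → Type
  | skip {a : Ty} : Prog a a
  | comp {a b c : Ty} : Prog b c → Prog a b → Prog a c
  | pair {a b c : Ty} : Prog a b → Prog a c → Prog a (.prod b c)
  | fst {a b : Ty} : Prog (.prod a b) a
  | snd {a b : Ty} : Prog (.prod a b) b
  | zero {a : Ty} : Prog a .nat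
  | succ : Prog .nat .nat
  | natEq : Prog (.prod .nat .nat) .nat
  | natLe : Prog (.prod .nat .nat) .nat
  | realZero {a : Ty} : Prog a .real
  | add : Prog (.prod .real .real) .real
  | sub : Prog (.prod .real .real) .real
  | half : Prog .real .real
  | realLe : Prog (.prod .real .real) .nat
  | nil {a b : Ty} : Prog a (.list b)
  | cons {a : Ty} : Prog (.prod a (.list a)) (.list a)
  /-- case distinction on a list, with an environment -/
  | uncons {a b c : Ty} :
      Prog a c → Prog (.prod a (.prod b (.list b))) c → Prog (.prod a (.list b)) c
  /-- branch on whether the test returns `0` (second branch) or not (first branch) -/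
  | cond {a b : Ty} : Prog a .nat → Prog a b → Prog a b → Prog a b
  /-- repeat a program a given number of times -/
  | loop {a : Ty} : Prog a a → Prog (.prod a .nat) a
  /-- run a program on an accumulator for each element of a list, from left to right -/
  | each {a b : Ty} : Prog (.prod a b) a → Prog (.prod a (.list b)) a

/-- Execution of a program on an input: the output and the number of steps. Each operation costs one
step, in addition to the steps of the programs that it executes. -/
def Prog.run : {a b : Ty} → Prog a b → a.Val → b.Val × ℕ
  | _, _, .skip, x => (x, 1)
  | _, _, .comp g f, x =>
      let r := f.run x
      let r' := g.run r.1
      (r'.1, r.2 + r'.2 + 1)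
  | _, _, .pair f g, x => (((f.run x).1, (g.run x).1), (f.run x).2 + (g.run x).2 + 1)
  | _, _, .fst, x => (x.1, 1)
  | _, _, .snd, x => (x.2, 1)
  | _, _, .zero, _ => ((0 : ℕ), 1)
  | _, _, .succ, x => (Nat.succ x, 1)
  | _, _, .natEq, x => ((if x.1 = x.2 then 1 else 0 : ℕ), 1)
  | _, _, .natLe, x => ((if x.1 ≤ x.2 then 1 else 0 : ℕ), 1)
  | _, _, .realZero, _ => ((0 : ℝ), 1)
  | _, _, .add, x => ((x.1 + x.2 : ℝ), 1)
  | _, _, .sub, x => ((x.1 - x.2 : ℝ), 1)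
  | _, _, .half, x => ((x / 2 : ℝ), 1)
  | _, _, .realLe, x => ((if (x.1 : ℝ) ≤ (x.2 : ℝ) then 1 else 0 : ℕ), 1)
  | _, _, .nil, _ => ([], 1)
  | _, _, .cons, x => (x.1 :: x.2, 1)
  | _, _, .uncons f g, x =>
      match x.2 with
      | [] => ((f.run x.1).1, (f.run x.1).2 + 1)
      | h :: t => ((g.run (x.1, (h, t))).1, (g.run (x.1, (h, t))).2 + 1)
  | _, _, .cond test f g, x =>
      let r := test.run x
      if r.1 = (0 : ℕ) then ((g.run x).1, r.2 + (g.run x).2 + 1)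
      else ((f.run x).1, r.2 + (f.run x).2 + 1)
  | _, _, .loop f, x =>
      (fun r => ((f.run r.1).1, r.2 + (f.run r.1).2 + 1))^[x.2] (x.1, 1)
  | _, _, .each f, x =>
      x.2.foldl (fun r h => ((f.run (r.1, h)).1, r.2 + (f.run (r.1, h)).2 + 1)) (x.1, 1)

/-- Input: the number of targets and the two cost matrices. -/
abbrev inputTy : Ty := .prod .nat (.prod (.list (.list .real)) (.list (.list .real)))

/-- Output: the two tours, as lists of numbers of targets. -/
abbrev outputTy : Ty := .prod (.list .nat) (.list .nat)

/-- The vertices of a vehicle in order, the depot first. -/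
def vertexList (n : ℕ) : List (Vertex (Fin n)) := none :: (List.finRange n).map some

/-- The matrix of a cost function, as a list of rows. -/
def matrix {n : ℕ} (c : Edge (Fin n) → ℝ) : List (List ℝ) :=
  (vertexList n).map fun u => (vertexList n).map fun v => c s(u, v)

/-- The input that describes an instance. -/
def Instance.input {n : ℕ} (I : Instance (Fin n)) : inputTy.Val :=
  (n, (matrix I.cost₁, matrix I.cost₂))

/-- The output that describes a pair of tours. -/
def output {n : ℕ} (l₁ l₂ : List (Fin n)) : outputTy.Val :=
  (l₁.map Fin.val, l₂.map Fin.val)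

end TwoDepot

end

/-!
The algorithm is a primal-dual method in the manner of Goemans and Williamson with two coupled
forests. The dual variables bound the optimum from below by weak duality
(`Instance.DualFeasible.le_lpCost`) applied to the relaxation (`exists_lpFeasible`), so everything
rests on two facts about the main loop: its dual variables are feasible, and they pay for at least
half of the doubled pruned forests.

Both follow from an invariant of the main loop, `Inv`. A component of the second vehicle that does
not contain its depot lies in a component of the first vehicle. The reason is that the first vehicle
is cheaper between targets and its components grow whenever those of the second vehicle inside them
do; hence an edge between targets becomes tight for the first vehicle first (`Inv.same_component`).
Therefore an active component of the first vehicle either has a child, which is active as well and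
pays for its growth in the coupling constraint, or it has none and is stopped when its constraint is
tight; this gives the constraint for all sets of targets (`Inv.dual_grow`). A component is
deactivated only when the second forest connects all its vertices to the second depot, which then
happens within the component. A union of labels is a disjoint union of such components, so its
coupling constraint is tight (the field `closed` of `Inv`). The number of components plus the number
of active ones decreases in every iteration, which bounds the number of iterations
(`Instance.Reached.potential`).

After pruning, the targets cut off from the first depot form a union of labels. The second forest
spans them together with its depot, so the pruned forests are a heterogeneous spanning forest
(`Inv.isHSF`). For the cost, each edge is charged to the sets that it crosses (`sum_cost_eq`). At
any time during the main loop, contracting the components turns a pruned forest into a tree on the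
components that meet it. Inactive components of the first vehicle other than that of the depot are
not leaves of this tree, since they consist of labels and would have been pruned (`Inv.two_le_deg`),
and inactive components of the second vehicle other than that of the depot do not meet the pruned
tree; so active components have average degree at most two (`Comps.sum_deg_le`). Summed over time,
the first tree costs at most twice the dual variables of the sets that it meets, and the second tree
at most twice the second vehicle's dual variables of the sets of cut off targets. By tightness the
latter have the same sum as those of the first vehicle, and `forestCost_le_dualValue` follows. A
closed walk through a doubled tree is built by inserting detours (`PartialTour.extend`), and the
triangle inequality bounds the cost of its shortcuts (`IsShortcut.tourCost_le`).

The program works on tables indexed by vertices: components and edge sets become relations, and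
pruning and traversal become closures of relations. A class `PolyTime` of functions computed by one
program in polynomial time is closed under the operations of the language, under reading and forming
tables and under loops over all vertices, so the procedure on tables belongs to it. It is correct
because the tables simulate the main loop (`Sim`, `exists_sim_final`), and because the vertices kept
by every admissible pruning are computed by a closure (`Sim.pruned`).
-/

noncomputable section
set_option linter.unusedSectionVars false

namespace TwoDepot

open Finset

/-! ### Forests and their components -/

section Forests

variable {T : Type*} [Fintype T] [DecidableEq T]

theorem graph_adj {F : Finset (Edge T)} {a b : Vertex T} :
    (graph F).Adj a b ↔ s(a, b) ∈ F ∧ a ≠ b := by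
  simp [graph]

theorem graph_mono {F G : Finset (Edge T)} (h : F ⊆ G) : graph F ≤ graph G :=
  SimpleGraph.fromEdgeSet_mono (by exact_mod_cast h)

/-- A property that spreads along the edges of `F` spreads from the end of a path to its start. -/
theorem of_reachable {F : Finset (Edge T)} {P : Vertex T → Prop}
    (hP : ∀ a b, s(a, b) ∈ F → P b → P a) {a b : Vertex T}
    (h : (graph F).Reachable a b) (hb : P b) : P a := by
  obtain ⟨W⟩ := h
  induction W with
  | nil => exact hb
  | cons h _ ih => exact hP _ _ (graph_adj.1 h).1 (ih hb)

theorem reachable_of_mem {F : Finset (Edge T)} {a b : Vertex T} (h : s(a, b) ∈ F) :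
    (graph F).Reachable a b := by
  by_cases hab : a = b
  · subst hab; exact SimpleGraph.Reachable.refl _
  · exact (graph_adj.2 ⟨h, hab⟩).reachable

/-- A subforest that connects the ends of an edge of a forest contains that edge. -/
theorem mem_of_reachable {F G : Finset (Edge T)} (hG : (graph G).IsAcyclic) (hFG : F ⊆ G)
    {a b : Vertex T} (hab : s(a, b) ∈ G) (hne : a ≠ b) (h : (graph F).Reachable a b) :
    s(a, b) ∈ F := by
  by_contra hn
  have hb := SimpleGraph.isAcyclic_iff_forall_adj_isBridge.1 hG (graph_adj.2 ⟨hab, hne⟩)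
  rw [SimpleGraph.isBridge_iff] at hb
  refine hb (h.mono fun u v huv => ?_)
  rw [graph_adj] at huv
  rw [SimpleGraph.deleteEdges_adj, graph_adj]
  refine ⟨⟨hFG huv.1, huv.2⟩, fun he => hn ?_⟩
  rw [Set.mem_singleton_iff] at he
  exact he ▸ huv.1

/-- `F` is a forest, and `C` is the set of its components. -/
structure Comps (F : Finset (Edge T)) (C : Finset (Finset (Vertex T))) : Prop where
  exists_mem : ∀ v, ∃ X ∈ C, v ∈ X
  eq_of_mem : ∀ {X Y v}, X ∈ C → Y ∈ C → v ∈ X → v ∈ Y → X = Y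
  nonempty : ∀ {X}, X ∈ C → X.Nonempty
  edge : ∀ {a b}, s(a, b) ∈ F → ∃ X ∈ C, a ∈ X ∧ b ∈ X
  conn : ∀ {X a b}, X ∈ C → a ∈ X → b ∈ X → (graph F).Reachable a b
  acyclic : (graph F).IsAcyclic
  not_diag : ∀ {e}, e ∈ F → ¬ e.IsDiag

/-- In the graph without edges every vertex is a component. -/
theorem Comps.start : Comps (∅ : Finset (Edge T)) (univ.image fun v => {v}) where
  exists_mem v := ⟨{v}, by simp, by simp⟩
  eq_of_mem := by
    intro X Y v hX hY hvX hvY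
    simp only [mem_image, mem_univ, true_and] at hX hY
    obtain ⟨x, rfl⟩ := hX
    obtain ⟨y, rfl⟩ := hY
    simp_all
  nonempty := by
    intro X hX
    simp only [mem_image, mem_univ, true_and] at hX
    obtain ⟨x, rfl⟩ := hX
    simp
  edge := by simp
  conn := by
    intro X a b hX ha hb
    simp only [mem_image, mem_univ, true_and] at hX
    obtain ⟨x, rfl⟩ := hX
    rw [mem_singleton] at ha hb
    subst ha; subst hb
    exact SimpleGraph.Reachable.refl _
  acyclic := by simp [graph]
  not_diag := by simp

namespace Comps

variable {F : Finset (Edge T)} {C : Finset (Finset (Vertex T))}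

theorem mem_of_mem_of_reachable (h : Comps F C) {X : Finset (Vertex T)} {a b : Vertex T}
    (hX : X ∈ C) (hb : b ∈ X) (hab : (graph F).Reachable a b) : a ∈ X :=
  of_reachable (P := fun v => v ∈ X) (fun u v huv hv => by
    obtain ⟨Y, hY, hu, hv'⟩ := h.edge huv
    exact h.eq_of_mem hY hX hv' hv ▸ hu) hab hb

theorem not_reachable (h : Comps F C) {X Y : Finset (Vertex T)} {a b : Vertex T}
    (hX : X ∈ C) (hY : Y ∈ C) (hne : X ≠ Y) (ha : a ∈ X) (hb : b ∈ Y) :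
    ¬ (graph F).Reachable a b := fun hab =>
  hne (h.eq_of_mem hX hY ha (h.mem_of_mem_of_reachable hY hb hab))

theorem subset_or_disjoint (h : Comps F C) {X Y : Finset (Vertex T)} (hX : X ∈ C)
    (hY : ∃ Z ∈ C, Y ⊆ Z) : Y ⊆ X ∨ Disjoint Y X := by
  obtain ⟨Z, hZ, hYZ⟩ := hY
  by_cases hXZ : X = Z
  · exact Or.inl (hXZ ▸ hYZ)
  · refine Or.inr (Finset.disjoint_left.2 fun v hv hvX => hXZ ?_)
    exact h.eq_of_mem hX hZ hvX (hYZ hv)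

/-- The components after an edge between two components has been added. -/
theorem merge (h : Comps F C) {X Y : Finset (Vertex T)} {i j : Vertex T} (hX : X ∈ C) (hY : Y ∈ C)
    (hne : X ≠ Y) (hi : i ∈ X) (hj : j ∈ Y) :
    Comps (insert s(i, j) F) (insert (X ∪ Y) ((C.erase X).erase Y)) := by
  have hij : i ≠ j := fun hij => hne (h.eq_of_mem hX hY hi (hij ▸ hj))
  have hle : graph F ≤ graph (insert s(i, j) F) := graph_mono (subset_insert _ _)
  have hr : (graph (insert s(i, j) F)).Reachable i j := reachable_of_mem (mem_insert_self _ _)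
  have hsup : ∀ Z ∈ C, ∃ Z' ∈ insert (X ∪ Y) ((C.erase X).erase Y), Z ⊆ Z' := by
    intro Z hZ
    by_cases h1 : Z = X
    · exact ⟨X ∪ Y, by simp, h1 ▸ subset_union_left⟩
    by_cases h2 : Z = Y
    · exact ⟨X ∪ Y, by simp, h2 ▸ subset_union_right⟩
    exact ⟨Z, by simp [*], Subset.rfl⟩
  constructor
  · intro v
    obtain ⟨Z, hZ, hv⟩ := h.exists_mem v
    obtain ⟨Z', hZ', hs⟩ := hsup Z hZ
    exact ⟨Z', hZ', hs hv⟩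
  · intro Z W v hZ hW hvZ hvW
    simp only [mem_insert, mem_erase] at hZ hW
    rcases hZ with rfl | ⟨h1, h2, h3⟩ <;> rcases hW with rfl | ⟨h4, h5, h6⟩
    · rfl
    · rcases mem_union.1 hvZ with hv | hv
      · exact absurd (h.eq_of_mem h6 hX hvW hv) h5
      · exact absurd (h.eq_of_mem h6 hY hvW hv) h4
    · rcases mem_union.1 hvW with hv | hv
      · exact absurd (h.eq_of_mem h3 hX hvZ hv) h2
      · exact absurd (h.eq_of_mem h3 hY hvZ hv) h1
    · exact h.eq_of_mem h3 h6 hvZ hvW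
  · intro Z hZ
    simp only [mem_insert, mem_erase] at hZ
    rcases hZ with rfl | ⟨h1, h2, h3⟩
    · exact ⟨i, mem_union_left _ hi⟩
    · exact h.nonempty h3
  · intro a b hab
    rcases mem_insert.1 hab with hab | hab
    · refine ⟨X ∪ Y, by simp, ?_⟩
      rcases Sym2.eq_iff.1 hab with ⟨rfl, rfl⟩ | ⟨rfl, rfl⟩ <;> simp [hi, hj]
    · obtain ⟨Z, hZ, ha, hb⟩ := h.edge hab
      obtain ⟨Z', hZ', hs⟩ := hsup Z hZ
      exact ⟨Z', hZ', hs ha, hs hb⟩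
  · intro Z a b hZ ha hb
    simp only [mem_insert, mem_erase] at hZ
    rcases hZ with rfl | ⟨h1, h2, h3⟩
    · have key : ∀ v ∈ X ∪ Y, (graph (insert s(i, j) F)).Reachable v i := by
        intro v hv
        rcases mem_union.1 hv with hv | hv
        · exact (h.conn hX hv hi).mono hle
        · exact ((h.conn hY hv hj).mono hle).trans hr.symm
      exact (key a ha).trans (key b hb).symm
    · exact (h.conn h3 ha hb).mono hle
  · have hs : graph (insert s(i, j) F) = graph F ⊔ SimpleGraph.edge i j := by
      ext a b
      simp only [graph_adj, SimpleGraph.sup_adj, SimpleGraph.edge_adj, mem_insert, Sym2.eq_iff]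
      tauto
    rw [hs]
    exact h.acyclic.sup_edge_of_not_reachable (h.not_reachable hX hY hne hi hj)
  · intro e he
    rcases mem_insert.1 he with rfl | he
    · simpa using hij
    · exact h.not_diag he

theorem card_merge (h : Comps F C) {X Y : Finset (Vertex T)} (hX : X ∈ C) (hY : Y ∈ C)
    (hne : X ≠ Y) : (insert (X ∪ Y) ((C.erase X).erase Y)).card + 1 = C.card := by
  have hn : X ∪ Y ∉ (C.erase X).erase Y := by
    intro hm
    simp only [mem_erase] at hm
    obtain ⟨x, hx⟩ := h.nonempty hX
    exact hm.2.1 (h.eq_of_mem hm.2.2 hX (mem_union_left _ hx) hx)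
  have hY' : Y ∈ C.erase X := mem_erase.2 ⟨hne.symm, hY⟩
  rw [card_insert_of_notMem hn, card_erase_of_mem hY', card_erase_of_mem hX]
  have : 0 < (C.erase X).card := card_pos.2 ⟨_, hY'⟩
  rw [card_erase_of_mem hX] at this
  omega

end Comps

/-- The edge `e` has exactly one end in `X`. -/
def Crosses (X : Finset (Vertex T)) (e : Edge T) : Prop :=
  ∃ a ∈ X, ∃ b, b ∉ X ∧ e = s(a, b)

instance (X : Finset (Vertex T)) : DecidablePred (Crosses X) := fun e => by
  unfold Crosses; infer_instance

theorem crosses_mk {X : Finset (Vertex T)} {a b : Vertex T} :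
    Crosses X s(a, b) ↔ (a ∈ X ∧ b ∉ X) ∨ (b ∈ X ∧ a ∉ X) := by
  constructor
  · rintro ⟨c, hc, d, hd, h⟩
    rcases Sym2.eq_iff.1 h with ⟨rfl, rfl⟩ | ⟨rfl, rfl⟩ <;> simp [hc, hd]
  · rintro (⟨h, h'⟩ | ⟨h, h'⟩)
    · exact ⟨a, h, b, h', rfl⟩
    · exact ⟨b, h, a, h', Sym2.eq_swap⟩

theorem mem_cut {S : Finset T} {e : Edge T} :
    e ∈ cut S ↔ Crosses (S.map Function.Embedding.some) e := by
  simp only [cut, mem_filter, mem_univ, true_and, Crosses]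
  constructor
  · rintro ⟨a, ha, v, hv, rfl⟩
    exact ⟨some a, mem_map.2 ⟨a, ha, rfl⟩, v, hv, rfl⟩
  · rintro ⟨a, ha, v, hv, rfl⟩
    obtain ⟨t, ht, rfl⟩ := mem_map.1 ha
    exact ⟨t, ht, v, hv, rfl⟩

/-- Number of edges of `F` with exactly one end in `X`. -/
def deg (F : Finset (Edge T)) (X : Finset (Vertex T)) : ℕ := (F.filter (Crosses X)).card

namespace Comps

variable {F G F' : Finset (Edge T)} {C : Finset (Finset (Vertex T))}

/-- Handshaking in the contracted forest: an edge of the larger forest that is not in `F` joins two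
components of `F`, while an edge of `F` leaves none. -/
theorem sum_deg (h : Comps F C) (hFG : F ⊆ G) (hG : (graph G).IsAcyclic)
    (hnd : ∀ e ∈ G, ¬ e.IsDiag) (hF' : F' ⊆ G) : ∑ X ∈ C, deg F' X = 2 * (F' \ F).card := by
  have h1 : ∑ X ∈ C, deg F' X = ∑ e ∈ F', (C.filter fun X => Crosses X e).card := by
    simp only [deg, card_filter]
    exact sum_comm
  rw [h1, mul_comm, ← smul_eq_mul, ← sum_const, ← sum_filter_add_sum_filter_not F' (· ∈ F)]
  have h2 : ∑ e ∈ F' with e ∈ F, (C.filter fun X => Crosses X e).card = 0 := by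
    refine sum_eq_zero fun e he => ?_
    rw [card_eq_zero, filter_eq_empty_iff]
    intro X hX
    induction e using Sym2.ind with | _ a b =>
    obtain ⟨Y, hY, ha, hb⟩ := h.edge (mem_filter.1 he).2
    rw [crosses_mk]
    rintro (⟨h3, h4⟩ | ⟨h3, h4⟩)
    · exact h4 (h.eq_of_mem hX hY h3 ha ▸ hb)
    · exact h4 (h.eq_of_mem hX hY h3 hb ▸ ha)
  rw [h2, zero_add, sdiff_eq_filter]
  refine sum_congr rfl fun e he => ?_
  rw [mem_filter] at he
  induction e using Sym2.ind with | _ a b =>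
  obtain ⟨X, hX, ha⟩ := h.exists_mem a
  obtain ⟨Y, hY, hb⟩ := h.exists_mem b
  have hab : a ≠ b := by simpa using hnd _ (hF' he.1)
  have hXY : X ≠ Y := by
    rintro rfl
    exact he.2 (mem_of_reachable hG hFG (hF' he.1) hab (h.conn hX ha hb))
  rw [← card_pair hXY]
  congr 1
  ext Z
  simp only [mem_filter, crosses_mk, mem_insert, mem_singleton]
  constructor
  · rintro ⟨hZ, ⟨h3, h4⟩ | ⟨h3, h4⟩⟩
    · exact Or.inl (h.eq_of_mem hZ hX h3 ha)
    · exact Or.inr (h.eq_of_mem hZ hY h3 hb)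
  · rintro (rfl | rfl)
    · exact ⟨hX, Or.inl ⟨ha, fun hb' => hXY (h.eq_of_mem hX hY hb' hb)⟩⟩
    · exact ⟨hY, Or.inr ⟨hb, fun ha' => hXY (h.eq_of_mem hX hY ha ha')⟩⟩

/-- Contracting the components of `F` turns the remaining edges of a larger forest into a forest:
if they all have their ends in `R`, they number less than the components that meet `R`. -/
theorem card_sdiff_lt (hG : (graph G).IsAcyclic) (hnd : ∀ e ∈ G, ¬ e.IsDiag) (hF' : F' ⊆ G)
    {R : Finset (Vertex T)} {r : Vertex T} (hr : r ∈ R) (hends : ∀ e ∈ F', ∀ v ∈ e, v ∈ R)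
    (h : Comps F C) (hFG : F ⊆ G) :
    (F' \ F).card + 1 ≤ (C.filter fun X => ∃ v ∈ X, v ∈ R).card := by
  -- adding one of the remaining edges to `F` merges two components that meet `R`
  induction hk : (F' \ F).card generalizing F C with
  | zero =>
    obtain ⟨X, hX, hrX⟩ := h.exists_mem r
    rw [zero_add, Nat.one_le_iff_ne_zero, ← Nat.pos_iff_ne_zero, card_pos]
    exact ⟨X, mem_filter.2 ⟨hX, r, hrX, hr⟩⟩
  | succ k ih =>
    obtain ⟨e, he⟩ : (F' \ F).Nonempty := card_pos.1 (by omega)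
    rw [mem_sdiff] at he
    induction e using Sym2.ind with | _ a b =>
    obtain ⟨X, hX, ha⟩ := h.exists_mem a
    obtain ⟨Y, hY, hb⟩ := h.exists_mem b
    have hab : a ≠ b := by simpa using hnd _ (hF' he.1)
    have hXY : X ≠ Y := by
      rintro rfl
      exact he.2 (mem_of_reachable hG hFG (hF' he.1) hab (h.conn hX ha hb))
    have haR : a ∈ R := hends _ he.1 a (by simp)
    have hbR : b ∈ R := hends _ he.1 b (by simp)
    have hd : F' \ insert s(a, b) F = (F' \ F).erase s(a, b) := by
      ext x; simp only [mem_sdiff, mem_insert, mem_erase]; tauto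
    have hc := ih (h.merge hX hY hXY ha hb) (insert_subset (hF' he.1) hFG) (by
      rw [hd, card_erase_of_mem (mem_sdiff.2 he), hk]; rfl)
    have hN : (insert (X ∪ Y) ((C.erase X).erase Y)).filter (fun X => ∃ v ∈ X, v ∈ R) =
        insert (X ∪ Y) (((C.filter fun X => ∃ v ∈ X, v ∈ R).erase X).erase Y) := by
      ext Z
      simp only [mem_filter, mem_insert, mem_erase]
      constructor
      · rintro ⟨rfl | h1, h2⟩
        · exact Or.inl rfl
        · tauto
      · rintro (rfl | h1)
        · exact ⟨Or.inl rfl, a, mem_union_left _ ha, haR⟩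
        · tauto
    have hX' : X ∈ C.filter fun X => ∃ v ∈ X, v ∈ R := mem_filter.2 ⟨hX, a, ha, haR⟩
    have hY' : Y ∈ (C.filter fun X => ∃ v ∈ X, v ∈ R).erase X :=
      mem_erase.2 ⟨hXY.symm, mem_filter.2 ⟨hY, b, hb, hbR⟩⟩
    rw [hN] at hc
    have h1 := card_insert_le (X ∪ Y) (((C.filter fun X => ∃ v ∈ X, v ∈ R).erase X).erase Y)
    rw [card_erase_of_mem hY', card_erase_of_mem hX'] at h1
    have h2 := card_pos.2 ⟨_, hY'⟩
    rw [card_erase_of_mem hX'] at h2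
    omega

/-- If no component outside `Q`, other than the one of the depot, is a leaf of the contracted
tree, then the components in `Q` have average degree at most two. -/
theorem sum_deg_le (h : Comps F C) (hFG : F ⊆ G) (hG : (graph G).IsAcyclic)
    (hnd : ∀ e ∈ G, ¬ e.IsDiag) (hF' : F' ⊆ G) {R : Finset (Vertex T)} (hR : none ∈ R)
    (hends : ∀ e ∈ F', ∀ v ∈ e, v ∈ R) {Q : Finset (Finset (Vertex T))} (hQ : Q ⊆ C)
    (hdeg : ∀ X ∈ C, X ∉ Q → none ∉ X → (∃ v ∈ X, v ∈ R) → 2 ≤ deg F' X) :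
    ∑ X ∈ Q, deg F' X ≤ 2 * (Q.filter fun X => ∃ v ∈ X, v ∈ R).card := by
  obtain ⟨X₀, hX₀, hr⟩ := h.exists_mem none
  have h1 := card_sdiff_lt hG hnd hF' hR hends h hFG
  have h2 := h.sum_deg hFG hG hnd hF'
  -- `N` consists of the components that are vertices of the contracted tree
  set N := C.filter fun X => ∃ v ∈ X, v ∈ R with hN
  have h3 : ∑ X ∈ Q, deg F' X + ∑ X ∈ C \ Q, deg F' X = ∑ X ∈ C, deg F' X := by
    rw [add_comm]; exact sum_sdiff hQ
  have h4 : 2 * ((N \ Q).erase X₀).card ≤ ∑ X ∈ C \ Q, deg F' X := by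
    calc 2 * ((N \ Q).erase X₀).card = ∑ X ∈ (N \ Q).erase X₀, 2 := by
          rw [sum_const, smul_eq_mul, mul_comm]
      _ ≤ ∑ X ∈ (N \ Q).erase X₀, deg F' X := by
          refine sum_le_sum fun X hX => ?_
          rw [mem_erase, mem_sdiff, hN, mem_filter] at hX
          exact hdeg X hX.2.1.1 hX.2.2 (fun hn => hX.1 (h.eq_of_mem hX.2.1.1 hX₀ hn hr)) hX.2.1.2
      _ ≤ _ := by
          refine sum_le_sum_of_subset fun X hX => ?_
          rw [mem_erase, mem_sdiff, hN, mem_filter] at hX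
          exact mem_sdiff.2 ⟨hX.2.1.1, hX.2.2⟩
  have h5 : (N \ Q).card ≤ ((N \ Q).erase X₀).card + 1 := by
    have := pred_card_le_card_erase (s := N \ Q) (a := X₀)
    omega
  have h6 : N.card = (Q.filter fun X => ∃ v ∈ X, v ∈ R).card + (N \ Q).card := by
    rw [← card_inter_add_card_sdiff N Q]
    congr 2
    ext X
    simp only [hN, mem_inter, mem_filter]
    exact ⟨fun hX => ⟨hX.2, hX.1.2⟩, fun hX => ⟨⟨hQ hX.1, hX.2⟩, hX.1⟩⟩
  omega

end Comps

end Forests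

/-! ### Dual variables of one vehicle -/

section Dual

variable {T : Type*} [Fintype T] [DecidableEq T]

/-- A set of targets as a set of vertices. -/
abbrev lift (S : Finset T) : Finset (Vertex T) := S.map Function.Embedding.some

theorem lift_eraseNone {X : Finset (Vertex T)} (h : none ∉ X) : lift (eraseNone X) = X := by
  rw [lift, map_some_eraseNone, erase_eq_of_notMem h]

theorem lift_injective : Function.Injective (lift : Finset T → Finset (Vertex T)) :=
  map_injective _

theorem sum_lift {Q : Finset (Finset (Vertex T))} (hQ : ∀ X ∈ Q, none ∉ X)
    (g : Finset (Vertex T) → ℝ) :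
    ∑ S : Finset T, (if lift S ∈ Q then g (lift S) else 0) = ∑ X ∈ Q, g X := by
  rw [← sum_filter]
  refine sum_nbij lift (by simp) (fun _ _ _ _ h => lift_injective h) ?_ (by simp)
  intro X hX
  have hX' : X ∈ Q := by simpa using hX
  exact ⟨eraseNone X, by simpa [lift_eraseNone (hQ X hX')] using hX', lift_eraseNone (hQ X hX')⟩

/-- The effect of raising the dual variables of the sets in `Q` by `ε` on the sum over a family of
sets. -/
theorem sum_grow {Q : Finset (Finset (Vertex T))} (hQ : ∀ X ∈ Q, none ∉ X) {ε : ℝ}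
    {Y Y' : Finset T → ℝ} (hY : ∀ S, Y' S = Y S + if lift S ∈ Q then ε else 0)
    (P : Finset (Vertex T) → Prop) [DecidablePred P] :
    ∑ S : Finset T with P (lift S), Y' S =
      ∑ S : Finset T with P (lift S), Y S + ∑ X ∈ Q, if P X then ε else 0 := by
  rw [← sum_lift hQ fun X => if P X then ε else 0]
  simp only [hY, sum_filter, ← sum_add_distrib]
  refine sum_congr rfl fun S _ => ?_
  split_ifs <;> simp

/-- The dual variables `Y` of one vehicle are carried by unions of former components and feasible
for the edges, `p v` is the total value of the sets around `v`, and the edges of `F` are tight. -/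
structure DualInv (cost : Edge T → ℝ) (F : Finset (Edge T)) (C : Finset (Finset (Vertex T)))
    (Y : Finset T → ℝ) (p : Vertex T → ℝ) : Prop extends Comps F C where
  nonneg : ∀ S, 0 ≤ Y S
  empty : Y ∅ = 0
  laminar : ∀ {S}, Y S ≠ 0 → ∃ X ∈ C, lift S ⊆ X
  pot : ∀ v, p v = ∑ S : Finset T with v ∈ lift S, Y S
  tight : ∀ e ∈ F, ∑ S : Finset T with e ∈ cut S, Y S = cost e
  feas : ∀ e ∈ edges T, ∑ S : Finset T with e ∈ cut S, Y S ≤ cost e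

theorem mem_edges {i j : Vertex T} : s(i, j) ∈ edges T ↔ i ≠ j := by simp [edges]

namespace Comps

variable {F : Finset (Edge T)} {C Q : Finset (Finset (Vertex T))}

theorem sum_mem (h : Comps F C) (hQ : Q ⊆ C) (v : Vertex T) (ε : ℝ) :
    ∑ X ∈ Q, (if v ∈ X then ε else 0) = if ∃ X ∈ Q, v ∈ X then ε else 0 := by
  split_ifs with hv
  · obtain ⟨X, hX, hvX⟩ := hv
    rw [sum_eq_single_of_mem X hX, if_pos hvX]
    intro Y hY hYX
    exact if_neg fun hvY => hYX (h.eq_of_mem (hQ hY) (hQ hX) hvY hvX)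
  · exact sum_eq_zero fun X hX => if_neg fun hvX => hv ⟨X, hX, hvX⟩

theorem not_crosses (h : Comps F C) {X Z : Finset (Vertex T)} {i j : Vertex T} (hX : X ∈ C)
    (hi : i ∈ X) (hj : j ∈ X) (hZ : Z ∈ C) : ¬ Crosses Z s(i, j) := by
  rw [crosses_mk]
  rintro (⟨h1, h2⟩ | ⟨h1, h2⟩)
  · exact h2 (h.eq_of_mem hX hZ hi h1 ▸ hj)
  · exact h2 (h.eq_of_mem hX hZ hj h1 ▸ hi)

theorem sum_crosses (h : Comps F C) (hQ : Q ⊆ C) {X Y : Finset (Vertex T)} {i j : Vertex T}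
    (hX : X ∈ C) (hY : Y ∈ C) (hXY : X ≠ Y) (hi : i ∈ X) (hj : j ∈ Y) (ε : ℝ) :
    ∑ Z ∈ Q, (if Crosses Z s(i, j) then ε else 0) =
      (if X ∈ Q then ε else 0) + if Y ∈ Q then ε else 0 := by
  have key : ∀ Z ∈ Q, (if Crosses Z s(i, j) then ε else 0) =
      (if X = Z then ε else 0) + if Y = Z then ε else 0 := by
    intro Z hZ
    have e1 : i ∈ Z ↔ X = Z := ⟨fun hz => h.eq_of_mem hX (hQ hZ) hi hz, fun hz => hz ▸ hi⟩
    have e2 : j ∈ Z ↔ Y = Z := ⟨fun hz => h.eq_of_mem hY (hQ hZ) hj hz, fun hz => hz ▸ hj⟩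
    simp only [crosses_mk, e1, e2]
    by_cases h1 : X = Z
    · have h2 : Y ≠ Z := fun h2 => hXY (h1.trans h2.symm)
      simp [h1, h2]
    · by_cases h2 : Y = Z <;> simp [h1, h2]
  rw [sum_congr rfl key, sum_add_distrib, sum_ite_eq, sum_ite_eq]

end Comps

namespace DualInv

variable {cost : Edge T → ℝ} {F : Finset (Edge T)} {C Q : Finset (Finset (Vertex T))}
  {Y Y' : Finset T → ℝ} {p p' : Vertex T → ℝ}

theorem start (h : ∀ u v, u ≠ v → 0 ≤ cost s(u, v)) :
    DualInv cost ∅ (univ.image fun v => {v}) (fun _ => 0) fun _ => 0 where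
  toComps := Comps.start
  nonneg _ := le_rfl
  empty := rfl
  laminar h := absurd rfl h
  pot _ := by simp
  tight := by simp
  feas e he := by
    induction e using Sym2.ind with | _ a b =>
    simpa using h a b (mem_edges.1 he)

/-- Between different components, the dual constraint only involves the potentials. -/
theorem sum_cut (h : DualInv cost F C Y p) {X Z : Finset (Vertex T)} {i j : Vertex T}
    (hX : X ∈ C) (hZ : Z ∈ C) (hXZ : X ≠ Z) (hi : i ∈ X) (hj : j ∈ Z) :
    ∑ S : Finset T with s(i, j) ∈ cut S, Y S = p i + p j := by
  rw [h.pot, h.pot]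
  simp only [sum_filter, ← sum_add_distrib, mem_cut, crosses_mk]
  refine sum_congr rfl fun S _ => ?_
  by_cases hS : Y S = 0
  · simp [hS]
  · obtain ⟨W, hW, hSW⟩ := h.laminar hS
    have hn : ¬ (i ∈ lift S ∧ j ∈ lift S) := fun hn =>
      hXZ ((h.eq_of_mem hX hW hi (hSW hn.1)).trans (h.eq_of_mem hZ hW hj (hSW hn.2)).symm)
    by_cases h1 : i ∈ lift S <;> by_cases h2 : j ∈ lift S
    · exact absurd ⟨h1, h2⟩ hn
    all_goals simp only [h1, h2, not_true, not_false_eq_true, and_true, and_false, or_false,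
      or_true, if_true, if_false, add_zero, zero_add]

theorem slack_nonneg (h : DualInv cost F C Y p) {X Z : Finset (Vertex T)} {i j : Vertex T}
    (hX : X ∈ C) (hZ : Z ∈ C) (hXZ : X ≠ Z) (hi : i ∈ X) (hj : j ∈ Z) :
    0 ≤ cost s(i, j) - p i - p j := by
  have h1 := h.feas s(i, j) (mem_edges.2 fun hij => hXZ (h.eq_of_mem hX hZ hi (hij ▸ hj)))
  rw [h.sum_cut hX hZ hXZ hi hj] at h1
  linarith

/-- Raising the dual variables of the components in `Q` by an amount that no edge forbids. -/
theorem grow (h : DualInv cost F C Y p) (hQC : Q ⊆ C) (hQ : ∀ X ∈ Q, none ∉ X) {ε : ℝ}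
    (hε : 0 ≤ ε) (hY : ∀ S, Y' S = Y S + if lift S ∈ Q then ε else 0)
    (hp : ∀ v, p' v = p v + if ∃ X ∈ Q, v ∈ X then ε else 0)
    (hmax : ∀ X ∈ C, ∀ Z ∈ C, X ≠ Z → ∀ i ∈ X, ∀ j ∈ Z,
      (if X ∈ Q then ε else 0) + (if Z ∈ Q then ε else 0) ≤ cost s(i, j) - p i - p j) :
    DualInv cost F C Y' p' where
  toComps := h.toComps
  nonneg S := by
    rw [hY]
    have := h.nonneg S
    split_ifs <;> linarith
  empty := by
    rw [hY, h.empty, if_neg, zero_add]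
    intro hn
    exact absurd (h.nonempty (hQC hn)) (by simp)
  laminar := by
    intro S hS
    by_cases hSQ : lift S ∈ Q
    · exact ⟨_, hQC hSQ, Subset.rfl⟩
    · exact h.laminar (by rwa [hY, if_neg hSQ, add_zero] at hS)
  pot v := by
    rw [hp, sum_grow hQ hY (fun X => v ∈ X), ← h.pot, h.sum_mem hQC]
  tight e he := by
    rw [← h.tight e he]
    simp only [mem_cut]
    rw [sum_grow hQ hY (fun X => Crosses X e), add_eq_left]
    induction e using Sym2.ind with | _ a b =>
    obtain ⟨X, hX, ha, hb⟩ := h.edge he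
    exact sum_eq_zero fun Z hZ => if_neg (h.not_crosses hX ha hb (hQC hZ))
  feas e he := by
    induction e using Sym2.ind with | _ i j =>
    have h1 := h.feas _ he
    simp only [mem_cut] at h1 ⊢
    rw [sum_grow hQ hY (fun X => Crosses X s(i, j))]
    obtain ⟨X, hX, hi⟩ := h.exists_mem i
    obtain ⟨Z, hZ, hj⟩ := h.exists_mem j
    by_cases hXZ : X = Z
    · subst hXZ
      rw [sum_eq_zero fun Z hZ => if_neg (h.not_crosses hX hi hj (hQC hZ)), add_zero]
      exact h1
    · rw [h.sum_crosses hQC hX hZ hXZ hi hj]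
      have h2 := h.sum_cut hX hZ hXZ hi hj
      simp only [mem_cut] at h2
      have := hmax X hX Z hZ hXZ i hi j hj
      linarith

/-- Adding a tight edge between two components. -/
theorem merge_edge (h : DualInv cost F C Y p) {X Z : Finset (Vertex T)} {i j : Vertex T}
    (hX : X ∈ C) (hZ : Z ∈ C) (hXZ : X ≠ Z) (hi : i ∈ X) (hj : j ∈ Z)
    (ht : p i + p j = cost s(i, j)) :
    DualInv cost (insert s(i, j) F) (insert (X ∪ Z) ((C.erase X).erase Z)) Y p where
  toComps := h.merge hX hZ hXZ hi hj
  nonneg := h.nonneg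
  empty := h.empty
  laminar := by
    intro S hS
    obtain ⟨W, hW, hSW⟩ := h.laminar hS
    by_cases h1 : W = X
    · exact ⟨X ∪ Z, by simp, hSW.trans (h1 ▸ subset_union_left)⟩
    by_cases h2 : W = Z
    · exact ⟨X ∪ Z, by simp, hSW.trans (h2 ▸ subset_union_right)⟩
    exact ⟨W, by simp [*], hSW⟩
  pot := h.pot
  tight e he := by
    rcases mem_insert.1 he with rfl | he
    · rw [h.sum_cut hX hZ hXZ hi hj, ht]
    · exact h.tight e he
  feas := h.feas

end DualInv

end Dual

/-! ### The invariant of the main loop -/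

section Loop

variable {T : Type*} [Fintype T] [DecidableEq T]

/-- The edges of `F` with both ends in `X`. -/
def inside (F : Finset (Edge T)) (X : Finset (Vertex T)) : Finset (Edge T) :=
  F.filter fun e => ∀ v ∈ e, v ∈ X

theorem mem_inside {F : Finset (Edge T)} {X : Finset (Vertex T)} {a b : Vertex T} :
    s(a, b) ∈ inside F X ↔ s(a, b) ∈ F ∧ a ∈ X ∧ b ∈ X := by
  simp [inside]

theorem inside_subset (F : Finset (Edge T)) (X : Finset (Vertex T)) : inside F X ⊆ F :=
  filter_subset _ _

theorem inside_mono {F G : Finset (Edge T)} {X Z : Finset (Vertex T)} (h : F ⊆ G) (h' : X ⊆ Z) :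
    inside F X ⊆ inside G Z := by
  intro e he
  rw [inside, mem_filter] at he ⊢
  exact ⟨h he.1, fun v hv => h' (he.2 v hv)⟩

theorem subset_merge {C : Finset (Finset (Vertex T))} (X Y : Finset (Vertex T))
    {Z : Finset (Vertex T)} (hZ : Z ∈ C) : ∃ W ∈ insert (X ∪ Y) ((C.erase X).erase Y), Z ⊆ W := by
  by_cases h1 : Z = X
  · exact ⟨X ∪ Y, by simp, h1 ▸ subset_union_left⟩
  by_cases h2 : Z = Y
  · exact ⟨X ∪ Y, by simp, h2 ▸ subset_union_right⟩
  exact ⟨Z, by simp [*], Subset.rfl⟩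

/-- Dual variables supported within components: a set contained in `U` and in a component lies
either within the component `X` or within `U \ X`. -/
theorem Comps.sum_subset_split {F : Finset (Edge T)} {C : Finset (Finset (Vertex T))}
    (h : Comps F C) {Y : Finset T → ℝ} (h0 : Y ∅ = 0)
    (hlam : ∀ {S}, Y S ≠ 0 → ∃ X ∈ C, lift S ⊆ X) {X U : Finset (Vertex T)} (hX : X ∈ C)
    (hXU : X ⊆ U) :
    ∑ S : Finset T with lift S ⊆ U, Y S =
      ∑ S : Finset T with lift S ⊆ X, Y S + ∑ S : Finset T with lift S ⊆ U \ X, Y S := by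
  simp only [sum_filter, ← sum_add_distrib]
  refine sum_congr rfl fun S _ => ?_
  by_cases hS : Y S = 0
  · simp [hS]
  have hne : (lift S).Nonempty := by
    rw [map_nonempty, nonempty_iff_ne_empty]
    rintro rfl
    exact hS h0
  obtain ⟨v, hv⟩ := hne
  rcases h.subset_or_disjoint hX (hlam hS) with h1 | h1
  · have h2 : ¬ lift S ⊆ U \ X := fun h2 => (mem_sdiff.1 (h2 hv)).2 (h1 hv)
    simp only [h1, h1.trans hXU, h2, if_true, if_false, add_zero]
  · have h2 : ¬ lift S ⊆ X := fun h2 => (disjoint_left.1 h1 hv) (h2 hv)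
    have h3 : lift S ⊆ U \ X ↔ lift S ⊆ U := by
      rw [subset_sdiff]; exact ⟨fun h => h.1, fun h => ⟨h, h1⟩⟩
    simp only [h2, h3, if_false, zero_add]

/-- The invariant of the main loop. Besides the facts about each vehicle separately and the meaning
of the tables, it records how the components of the second vehicle lie in those of the first, how
labels are nested, and the relations between the dual variables of the two vehicles. -/
structure Inv (I : Instance T) (s : State T) : Prop where
  d₁ : DualInv I.cost₁ s.F₁ s.C₁ s.Y₁ s.p₁
  d₂ : DualInv I.cost₂ s.F₂ s.C₂ s.Y₂ s.p₂
  active₁_le : ∀ {X}, X ∈ s.C₁ → s.active₁ X ≤ 1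
  root₁ : ∀ {X}, X ∈ s.C₁ → none ∈ X → s.active₁ X = 0
  root₂ : ∀ {X}, X ∈ s.C₂ → none ∈ X → s.active₂ X = 0
  /-- a component without the second depot is active unless the first vehicle reaches it -/
  active₂_eq : ∀ {X D}, X ∈ s.C₂ → none ∉ X → D ∈ s.C₁ → X ⊆ D →
    s.active₂ X = if none ∈ D then 0 else 1
  parent : ∀ {X}, X ∈ s.C₂ → none ∉ X → s.parent X ∈ s.C₁ ∧ X ⊆ s.parent X
  children : ∀ {D}, D ∈ s.C₁ → ∀ X, X ∈ s.children D ↔ X ∈ s.C₂ ∧ none ∉ X ∧ X ⊆ D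
  /-- an inactive component without the depot consists of marked vertices -/
  dead : ∀ {D}, D ∈ s.C₁ → none ∉ D → s.active₁ D = 0 → ∀ v ∈ D, ∃ L ⊆ D, s.label v = some L
  /-- an active component contains an unmarked vertex -/
  live : ∀ {D}, D ∈ s.C₁ → s.active₁ D = 1 → ∃ v ∈ D, s.label v = none
  label_mem : ∀ {v L}, s.label v = some L → v ∈ L
  label_none : ∀ {v L}, s.label v = some L → none ∉ L
  label_sub : ∀ {v L}, s.label v = some L → ∃ D ∈ s.C₁, L ⊆ D
  /-- the vertices of a label have labels contained in it -/
  label_label : ∀ {v L}, s.label v = some L → ∀ u ∈ L, ∃ L' ⊆ L, s.label u = some L'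
  /-- the second forest connects a marked vertex to the depot within the label -/
  label_reach : ∀ {v L}, s.label v = some L →
    (graph (inside s.F₂ (insert none L))).Reachable v none
  /-- sets with a dual variable of the second vehicle lie in components of the first vehicle -/
  laminar₂ : ∀ {S}, s.Y₂ S ≠ 0 → ∃ D ∈ s.C₁, lift S ⊆ D
  w : ∀ {X}, X ∈ s.C₁ → s.w X = ∑ S : Finset T with lift S ⊆ X, s.Y₁ S
  bound : ∀ {X}, X ∈ s.C₁ → s.bound X = ∑ S : Finset T with lift S ⊆ X, s.Y₂ S
  /-- components of the second vehicle grow only within growing components of the first -/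
  pot_le : ∀ v, s.p₂ v ≤ s.p₁ v
  dual : ∀ U : Finset (Vertex T), ∑ S : Finset T with lift S ⊆ U, s.Y₁ S ≤
    ∑ S : Finset T with lift S ⊆ U, s.Y₂ S
  /-- the dual constraint of a union of labels is tight -/
  closed : ∀ B : Finset (Vertex T), (∀ v ∈ B, ∃ L ⊆ B, s.label v = some L) →
    ∑ S : Finset T with lift S ⊆ B, s.Y₂ S ≤ ∑ S : Finset T with lift S ⊆ B, s.Y₁ S
  /-- edges of the second forest between targets do not leave the components of the first -/
  edge₂ : ∀ {a b : T}, s(some a, some b) ∈ s.F₂ → ∃ D ∈ s.C₁, some a ∈ D ∧ some b ∈ D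

theorem Inv.start (I : Instance T) : Inv I (State.start T) where
  d₁ := DualInv.start I.nonneg₁
  d₂ := DualInv.start I.nonneg₂
  active₁_le := by intro X _; simp only [State.start]; split_ifs <;> simp
  root₁ := by intro X _ h; simp [State.start, h]
  root₂ := by intro X _ h; simp [State.start, h]
  active₂_eq := by
    intro X D hX hn hD hXD
    simp only [State.start, mem_image, mem_univ, true_and] at hX hD
    obtain ⟨x, rfl⟩ := hX
    obtain ⟨y, rfl⟩ := hD
    simp_all [State.start]
  parent := by
    intro X hX hn
    simp only [State.start, hn, if_false] at hX ⊢
    exact ⟨hX, Subset.rfl⟩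
  children := by
    intro D hD X
    simp only [State.start, mem_image, mem_univ, true_and] at hD ⊢
    obtain ⟨y, rfl⟩ := hD
    by_cases hy : y = none
    · subst hy
      simp only [mem_singleton, if_true, notMem_empty, false_iff]
      rintro ⟨⟨x, rfl⟩, h1, h2⟩
      simp_all
    · have : none ∉ ({y} : Finset (Vertex T)) := by simpa using Ne.symm hy
      rw [if_neg this, mem_singleton]
      constructor
      · rintro rfl
        exact ⟨⟨y, rfl⟩, this, Subset.rfl⟩
      · rintro ⟨⟨x, rfl⟩, h1, h2⟩
        simpa using h2
  dead := by
    intro D _ hn h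
    simp [State.start, hn] at h
  live := by
    intro D hD _
    obtain ⟨v, hv⟩ := Comps.start.nonempty hD
    exact ⟨v, hv, rfl⟩
  label_mem h := by simp [State.start] at h
  label_none h := by simp [State.start] at h
  label_sub h := by simp [State.start] at h
  label_label h := by simp [State.start] at h
  label_reach h := by simp [State.start] at h
  laminar₂ h := absurd rfl h
  w := by simp [State.start]
  bound := by simp [State.start]
  pot_le _ := le_rfl
  dual _ := by simp [State.start]
  closed _ _ := by simp [State.start]
  edge₂ h := by simp [State.start] at h

namespace Inv

variable {I : Instance T} {s : State T}

theorem subset_of_mem (h : Inv I s) {X D : Finset (Vertex T)} {v : Vertex T} (hX : X ∈ s.C₂)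
    (hn : none ∉ X) (hD : D ∈ s.C₁) (hvX : v ∈ X) (hvD : v ∈ D) : X ⊆ D := by
  obtain ⟨h1, h2⟩ := h.parent hX hn
  exact h.d₁.eq_of_mem h1 hD (h2 hvX) hvD ▸ h2

/-- A marked vertex is connected to the second depot. -/
theorem none_mem_of_label (h : Inv I s) {X L : Finset (Vertex T)} {v : Vertex T}
    (hv : s.label v = some L) (hX : X ∈ s.C₂) (hvX : v ∈ X) : none ∈ X :=
  h.d₂.mem_of_mem_of_reachable hX hvX ((h.label_reach hv).mono
    (graph_mono (inside_subset _ _))).symm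

theorem active₂_le (h : Inv I s) {X D : Finset (Vertex T)} {v : Vertex T} (hX : X ∈ s.C₂)
    (hD : D ∈ s.C₁) (hvX : v ∈ X) (hvD : v ∈ D) : s.active₂ X ≤ s.active₁ D := by
  by_cases hn : none ∈ X
  · simp [h.root₂ hX hn]
  have hXD := h.subset_of_mem hX hn hD hvX hvD
  rw [h.active₂_eq hX hn hD hXD]
  split_ifs with hnD
  · simp
  · by_contra hlt
    obtain ⟨L, _, hL⟩ := h.dead hD hnD (by omega) v hvD
    exact hn (h.none_mem_of_label hL hX hvX)

theorem active₂_le_one (h : Inv I s) {X : Finset (Vertex T)} (hX : X ∈ s.C₂) :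
    s.active₂ X ≤ 1 := by
  obtain ⟨v, hv⟩ := h.d₂.nonempty hX
  obtain ⟨D, hD, hvD⟩ := h.d₁.exists_mem v
  exact (h.active₂_le hX hD hv hvD).trans (h.active₁_le hD)

/-- The active components of the first vehicle. -/
def _root_.TwoDepot.State.act₁ (s : State T) : Finset (Finset (Vertex T)) :=
  s.C₁.filter fun X => s.active₁ X = 1

/-- The active components of the second vehicle. -/
def _root_.TwoDepot.State.act₂ (s : State T) : Finset (Finset (Vertex T)) :=
  s.C₂.filter fun X => s.active₂ X = 1

theorem none_notMem_act₁ (h : Inv I s) {X : Finset (Vertex T)} (hX : X ∈ s.act₁) : none ∉ X := by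
  rw [State.act₁, mem_filter] at hX
  intro hn
  have := h.root₁ hX.1 hn
  omega

theorem none_notMem_act₂ (h : Inv I s) {X : Finset (Vertex T)} (hX : X ∈ s.act₂) : none ∉ X := by
  rw [State.act₂, mem_filter] at hX
  intro hn
  have := h.root₂ hX.1 hn
  omega

theorem active₁_eq (h : Inv I s) {X : Finset (Vertex T)} (hX : X ∈ s.C₁) :
    s.active₁ X = if X ∈ s.act₁ then 1 else 0 := by
  have := h.active₁_le hX
  simp only [State.act₁, mem_filter, hX, true_and]
  split_ifs <;> omega

theorem active₂_eq_ite (h : Inv I s) {X : Finset (Vertex T)} (hX : X ∈ s.C₂) :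
    s.active₂ X = if X ∈ s.act₂ then 1 else 0 := by
  have := h.active₂_le_one hX
  simp only [State.act₂, mem_filter, hX, true_and]
  split_ifs <;> omega

theorem exists_parent_act (h : Inv I s) {X : Finset (Vertex T)} (hX : X ∈ s.act₂) :
    ∃ D ∈ s.act₁, X ⊆ D := by
  have hn := h.none_notMem_act₂ hX
  rw [State.act₂, mem_filter] at hX
  obtain ⟨h1, h2⟩ := h.parent hX.1 hn
  obtain ⟨v, hv⟩ := h.d₂.nonempty hX.1
  have h3 := h.active₂_le hX.1 h1 hv (h2 hv)
  have h4 := h.active₁_le h1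
  exact ⟨_, mem_filter.2 ⟨h1, by omega⟩, h2⟩

theorem grow_Y₁ (s : State T) (ε : ℝ) (S : Finset T) :
    (s.grow ε).Y₁ S = s.Y₁ S + if lift S ∈ s.act₁ then ε else 0 := by
  simp only [State.grow, State.act₁, mem_filter]
  split_ifs <;> simp

theorem grow_Y₂ (s : State T) (ε : ℝ) (S : Finset T) :
    (s.grow ε).Y₂ S = s.Y₂ S + if lift S ∈ s.act₂ then ε else 0 := by
  simp only [State.grow, State.act₂, mem_filter]
  split_ifs <;> simp

theorem grow_p₁ (s : State T) (ε : ℝ) (v : Vertex T) :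
    (s.grow ε).p₁ v = s.p₁ v + if ∃ X ∈ s.act₁, v ∈ X then ε else 0 := by
  simp only [State.grow, State.act₁, mem_filter, and_assoc]
  split_ifs <;> simp

theorem grow_p₂ (s : State T) (ε : ℝ) (v : Vertex T) :
    (s.grow ε).p₂ v = s.p₂ v + if ∃ X ∈ s.act₂, v ∈ X then ε else 0 := by
  simp only [State.grow, State.act₂, mem_filter, and_assoc]
  split_ifs <;> simp

/-- Growing keeps the dual constraint of every set `U`. An active component of the first vehicle
with a child inside `U` is paid for by this child, which is active too; a childless one may grow
until its own constraint is tight, and then the constraint of the rest of `U` suffices. -/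
theorem dual_grow (h : Inv I s) {ε : ℝ} (hε : 0 ≤ ε)
    (hmax₃ : ∀ X ∈ s.act₁, s.children X = ∅ → ε ≤ s.bound X - s.w X)
    (hd₁ : DualInv I.cost₁ s.F₁ s.C₁ (s.grow ε).Y₁ (s.grow ε).p₁)
    (hd₂ : DualInv I.cost₂ s.F₂ s.C₂ (s.grow ε).Y₂ (s.grow ε).p₂)
    (hlam : ∀ {S}, (s.grow ε).Y₂ S ≠ 0 → ∃ D ∈ s.C₁, lift S ⊆ D) (U : Finset (Vertex T)) :
    ∑ S : Finset T with lift S ⊆ U, (s.grow ε).Y₁ S ≤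
      ∑ S : Finset T with lift S ⊆ U, (s.grow ε).Y₂ S := by
  have e₁ := fun U => sum_grow (fun X => h.none_notMem_act₁) (grow_Y₁ s ε) (fun X => X ⊆ U)
  have e₂ := fun U => sum_grow (fun X => h.none_notMem_act₂) (grow_Y₂ s ε) (fun X => X ⊆ U)
  induction hk : U.card using Nat.strong_induction_on generalizing U with
  | _ k ih =>
  by_cases hX : ∃ X ∈ s.act₁, X ⊆ U ∧ s.children X = ∅
  · -- split off a childless component `X`
    obtain ⟨X, hX, hXU, hch⟩ := hX
    have hXC : X ∈ s.C₁ := (mem_filter.1 hX).1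
    rw [hd₁.sum_subset_split hd₁.empty hd₁.laminar hXC hXU,
      hd₁.sum_subset_split hd₂.empty hlam hXC hXU]
    have h1 : ∑ Z ∈ s.act₁, (if Z ⊆ X then ε else 0) = ε := by
      rw [sum_eq_single_of_mem X hX, if_pos Subset.rfl]
      intro Z hZ hZX
      refine if_neg fun hs => hZX ?_
      obtain ⟨v, hv⟩ := h.d₁.nonempty (mem_filter.1 hZ).1
      exact h.d₁.eq_of_mem (mem_filter.1 hZ).1 hXC hv (hs hv)
    have h2 : 0 ≤ ∑ Z ∈ s.act₂, (if Z ⊆ X then ε else 0) :=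
      sum_nonneg fun Z _ => by split_ifs <;> simp [hε]
    have h3 := hmax₃ X hX hch
    rw [h.w hXC, h.bound hXC] at h3
    obtain ⟨v, hv⟩ := h.d₁.nonempty hXC
    have h4 : (U \ X).card < k := by
      rw [← hk]
      exact card_lt_card ⟨sdiff_subset, fun hs => (mem_sdiff.1 (hs (hXU hv))).2 hv⟩
    have h5 := ih _ h4 (U \ X) rfl
    rw [e₁ X, e₂ X, h1]
    linarith
  · -- choosing a child of each active component of the first vehicle is injective
    have hcard : (s.act₁.filter fun X => X ⊆ U).card ≤ (s.act₂.filter fun X => X ⊆ U).card := by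
      have hch : ∀ X ∈ s.act₁.filter fun X => X ⊆ U, ∃ Z ∈ s.children X, True := by
        intro X hX'
        rw [mem_filter] at hX'
        have : s.children X ≠ ∅ := fun h' => hX ⟨X, hX'.1, hX'.2, h'⟩
        obtain ⟨Z, hZ⟩ := nonempty_iff_ne_empty.2 this
        exact ⟨Z, hZ, trivial⟩
      choose! f hf _ using hch
      have hf' : ∀ X ∈ s.act₁.filter fun X => X ⊆ U, f X ∈ s.C₂ ∧ none ∉ f X ∧ f X ⊆ X :=
        fun X hX' => (h.children (mem_filter.1 (mem_filter.1 hX').1).1 _).1 (hf X hX')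
      refine card_le_card_of_injOn f ?_ ?_
      · intro X hX'
        obtain ⟨h1, h2, h3⟩ := hf' X hX'
        have hX'' := mem_filter.1 hX'
        refine mem_coe.2 (mem_filter.2 ⟨mem_filter.2 ⟨h1, ?_⟩, h3.trans hX''.2⟩)
        rw [h.active₂_eq h1 h2 (mem_filter.1 hX''.1).1 h3,
          if_neg (h.none_notMem_act₁ hX''.1)]
      · intro X hX' Z hZ' hXZ
        obtain ⟨h1, _, h3⟩ := hf' X hX'
        obtain ⟨_, _, h4⟩ := hf' Z hZ'
        obtain ⟨v, hv⟩ := h.d₂.nonempty h1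
        exact h.d₁.eq_of_mem (mem_filter.1 (mem_filter.1 hX').1).1
          (mem_filter.1 (mem_filter.1 hZ').1).1 (h3 hv) (h4 (hXZ ▸ hv))
    rw [e₁, e₂, ← sum_filter, ← sum_filter, sum_const, sum_const]
    refine add_le_add (h.dual U) ?_
    rw [nsmul_eq_mul, nsmul_eq_mul]
    exact mul_le_mul_of_nonneg_right (by exact_mod_cast hcard) hε

/-- Growing preserves the invariant if `ε` does not exceed the value of any event. -/
theorem grow (h : Inv I s) {ε : ℝ} (hε : 0 ≤ ε)
    (hmax₁ : ∀ X ∈ s.C₁, ∀ Z ∈ s.C₁, X ≠ Z → ∀ i ∈ X, ∀ j ∈ Z,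
      (if X ∈ s.act₁ then ε else 0) + (if Z ∈ s.act₁ then ε else 0) ≤
        I.cost₁ s(i, j) - s.p₁ i - s.p₁ j)
    (hmax₂ : ∀ X ∈ s.C₂, ∀ Z ∈ s.C₂, X ≠ Z → ∀ i ∈ X, ∀ j ∈ Z,
      (if X ∈ s.act₂ then ε else 0) + (if Z ∈ s.act₂ then ε else 0) ≤
        I.cost₂ s(i, j) - s.p₂ i - s.p₂ j)
    (hmax₃ : ∀ X ∈ s.act₁, s.children X = ∅ → ε ≤ s.bound X - s.w X) :
    Inv I (s.grow ε) := by
  have hd₁ := h.d₁.grow (filter_subset _ _) (fun X => h.none_notMem_act₁) hε (grow_Y₁ s ε)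
    (grow_p₁ s ε) hmax₁
  have hd₂ := h.d₂.grow (filter_subset _ _) (fun X => h.none_notMem_act₂) hε (grow_Y₂ s ε)
    (grow_p₂ s ε) hmax₂
  have e₁ := fun U => sum_grow (fun X => h.none_notMem_act₁) (grow_Y₁ s ε) (fun X => X ⊆ U)
  have e₂ := fun U => sum_grow (fun X => h.none_notMem_act₂) (grow_Y₂ s ε) (fun X => X ⊆ U)
  have hlam : ∀ {S}, (s.grow ε).Y₂ S ≠ 0 → ∃ D ∈ s.C₁, lift S ⊆ D := by
    intro S hS
    by_cases hSQ : lift S ∈ s.act₂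
    · obtain ⟨D, hD, hs⟩ := h.exists_parent_act hSQ
      exact ⟨D, (mem_filter.1 hD).1, hs⟩
    · exact h.laminar₂ (by rwa [grow_Y₂, if_neg hSQ, add_zero] at hS)
  refine { h with
    d₁ := hd₁
    d₂ := hd₂
    laminar₂ := hlam
    dual := h.dual_grow hε hmax₃ hd₁ hd₂ hlam
    w := ?_
    bound := ?_
    pot_le := ?_
    closed := ?_ }
  · intro X (hX : X ∈ s.C₁)
    rw [e₁ X, ← h.w hX]
    have : ∑ Z ∈ s.act₁, (if Z ⊆ X then ε else 0) = if X ∈ s.act₁ then ε else 0 := by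
      rw [← sum_ite_eq s.act₁ X fun _ => ε]
      refine sum_congr rfl fun Z hZ => if_congr ?_ rfl rfl
      refine ⟨fun hs => ?_, fun hs => hs ▸ Subset.rfl⟩
      obtain ⟨v, hv⟩ := h.d₁.nonempty (mem_filter.1 hZ).1
      exact (h.d₁.eq_of_mem (mem_filter.1 hZ).1 hX hv (hs hv)).symm
    rw [this]
    simp only [State.grow, State.act₁, mem_filter]
    split_ifs <;> simp
  · intro X (hX : X ∈ s.C₁)
    rw [e₂ X, ← h.bound hX, ← sum_filter, sum_const, nsmul_eq_mul]
    by_cases ha : X ∈ s.act₁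
    · have hc : s.act₂.filter (fun Z => Z ⊆ X) = s.children X := by
        ext Z
        rw [h.children hX, mem_filter, State.act₂, mem_filter]
        constructor
        · rintro ⟨h1, h2⟩
          exact ⟨h1.1, h.none_notMem_act₂ (mem_filter.2 h1), h2⟩
        · rintro ⟨h1, h2, h3⟩
          refine ⟨⟨h1, ?_⟩, h3⟩
          rw [h.active₂_eq h1 h2 hX h3, if_neg (h.none_notMem_act₁ ha)]
      rw [hc, mul_comm]
      rw [State.act₁, mem_filter] at ha
      simp only [State.grow, ha, and_self, if_true]
    · have hc : s.act₂.filter (fun Z => Z ⊆ X) = ∅ := by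
        rw [filter_eq_empty_iff]
        intro Z hZ hZX
        obtain ⟨D, hD, hs⟩ := h.exists_parent_act hZ
        obtain ⟨v, hv⟩ := h.d₂.nonempty (mem_filter.1 hZ).1
        exact ha (h.d₁.eq_of_mem (mem_filter.1 hD).1 hX (hs hv) (hZX hv) ▸ hD)
      rw [hc]
      rw [State.act₁, mem_filter] at ha
      simp only [State.grow, ha, if_false, card_empty, Nat.cast_zero, zero_mul, add_zero]
  · intro v
    rw [grow_p₁, grow_p₂]
    refine add_le_add (h.pot_le v) ?_
    by_cases hv : ∃ X ∈ s.act₂, v ∈ X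
    · obtain ⟨X, hX, hvX⟩ := hv
      obtain ⟨D, hD, hs⟩ := h.exists_parent_act hX
      rw [if_pos ⟨X, hX, hvX⟩, if_pos ⟨D, hD, hs hvX⟩]
    · rw [if_neg hv]
      split_ifs <;> simp [hε]
  · -- no active component lies in a union of labels
    intro B hB
    have hB' : ∀ v ∈ B, ∃ L ⊆ B, s.label v = some L := hB
    have z₁ : ∑ X ∈ s.act₁, (if X ⊆ B then ε else 0) = 0 := by
      refine sum_eq_zero fun X hX => if_neg fun hs => ?_
      obtain ⟨v, hv, hl⟩ := h.live (mem_filter.1 hX).1 (mem_filter.1 hX).2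
      obtain ⟨L, _, hL⟩ := hB' v (hs hv)
      simp [hl] at hL
    have z₂ : ∑ X ∈ s.act₂, (if X ⊆ B then ε else 0) = 0 := by
      refine sum_eq_zero fun X hX => if_neg fun hs => ?_
      obtain ⟨v, hv⟩ := h.d₂.nonempty (mem_filter.1 hX).1
      obtain ⟨L, _, hL⟩ := hB' v (hs hv)
      exact h.none_notMem_act₂ hX (h.none_mem_of_label hL (mem_filter.1 hX).1 hv)
    rw [e₁, e₂, z₁, z₂, add_zero, add_zero]
    exact h.closed B hB'

end Inv

end Loop

/-! ### The iterations preserve the invariant -/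

section Steps

variable {T : Type*} [Fintype T] [DecidableEq T]

namespace Inv

variable {I : Instance T} {s : State T}

/-- Adding a tight edge to the first forest preserves the invariant. -/
theorem merge₁ (h : Inv I s) {X Y : Finset (Vertex T)} {i j : Vertex T} (hX : X ∈ s.C₁)
    (hY : Y ∈ s.C₁) (hXY : X ≠ Y) (hi : i ∈ X) (hj : j ∈ Y)
    (hpos : 0 < s.active₁ X + s.active₁ Y) (ht : s.p₁ i + s.p₁ j = I.cost₁ s(i, j)) :
    Inv I (s.merge₁ s(i, j) X Y) := by
  have hd := h.d₁.merge_edge hX hY hXY hi hj ht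
  have hmem : ∀ D, D ∈ insert (X ∪ Y) ((s.C₁.erase X).erase Y) ↔
      D = X ∪ Y ∨ D ∈ s.C₁ ∧ D ≠ X ∧ D ≠ Y := by
    intro D; simp only [mem_insert, mem_erase]; tauto
  have hold : ∀ D, D ∈ s.C₁ → D ≠ X → D ≠ X ∪ Y := by
    rintro D hD h1 rfl
    exact h1 (h.d₁.eq_of_mem hD hX (mem_union_left _ hi) hi)
  have hsub : ∀ Z ∈ s.C₂, none ∉ Z → (Z ⊆ X ∪ Y ↔ Z ⊆ X ∨ Z ⊆ Y) := by
    intro Z hZ hn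
    refine ⟨fun hs => ?_, fun hs => ?_⟩
    · obtain ⟨v, hv⟩ := h.d₂.nonempty hZ
      rcases mem_union.1 (hs hv) with hv' | hv'
      · exact Or.inl (h.subset_of_mem hZ hn hX hv hv')
      · exact Or.inr (h.subset_of_mem hZ hn hY hv hv')
    · exact hs.elim (fun hs => hs.trans subset_union_left) fun hs => hs.trans subset_union_right
  have hch : ∀ Z, Z ∈ s.children X ∪ s.children Y ↔ Z ∈ s.C₂ ∧ none ∉ Z ∧ Z ⊆ X ∪ Y := by
    intro Z
    rw [mem_union, h.children hX, h.children hY]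
    constructor
    · rintro (⟨h1, h2, h3⟩ | ⟨h1, h2, h3⟩)
      · exact ⟨h1, h2, (hsub Z h1 h2).2 (Or.inl h3)⟩
      · exact ⟨h1, h2, (hsub Z h1 h2).2 (Or.inr h3)⟩
    · rintro ⟨h1, h2, h3⟩
      exact ((hsub Z h1 h2).1 h3).imp (fun h3 => ⟨h1, h2, h3⟩) fun h3 => ⟨h1, h2, h3⟩
  have hdiff : (X ∪ Y) \ X = Y := by
    rw [union_sdiff_left]
    refine sdiff_eq_self_of_disjoint (disjoint_left.2 fun v hv hv' => hXY ?_)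
    exact h.d₁.eq_of_mem hX hY hv' hv
  have hsum : ∀ {U : Finset (Vertex T)}, (∃ D ∈ s.C₁, U ⊆ D) →
      ∃ D ∈ insert (X ∪ Y) ((s.C₁.erase X).erase Y), U ⊆ D := by
    rintro U ⟨D, hD, hs⟩
    obtain ⟨D', hD', hs'⟩ := subset_merge X Y hD
    exact ⟨D', hD', hs.trans hs'⟩
  refine { h with
    d₁ := hd
    d₂ := h.d₂
    active₁_le := ?_
    root₁ := ?_
    root₂ := ?_
    active₂_eq := ?_
    parent := ?_
    children := ?_
    dead := ?_
    live := ?_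
    label_sub := fun hl => hsum (h.label_sub hl)
    laminar₂ := fun hS => hsum (h.laminar₂ hS)
    w := ?_
    bound := ?_
    edge₂ := ?_ }
  · intro D hD
    rcases (hmem D).1 hD with rfl | ⟨h1, h2, h3⟩
    · simp only [State.merge₁, Function.update_self]; split_ifs <;> simp
    · simp only [State.merge₁, Function.update_of_ne (hold D h1 h2)]
      exact h.active₁_le h1
  · intro D hD hn
    rcases (hmem D).1 hD with rfl | ⟨h1, h2, h3⟩
    · simp only [State.merge₁, Function.update_self, hn, if_true]
    · simp only [State.merge₁, Function.update_of_ne (hold D h1 h2)]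
      exact h.root₁ h1 hn
  · intro Z hZ hn
    simp only [State.merge₁]
    split_ifs
    · rfl
    · exact h.root₂ hZ hn
  · intro Z D (hZ : Z ∈ s.C₂) hn hD hZD
    simp only [State.merge₁]
    rcases (hmem D).1 hD with rfl | ⟨h1, h2, h3⟩
    · have hZ' := (hch Z).2 ⟨hZ, hn, hZD⟩
      by_cases hr : none ∈ X ∪ Y
      · simp only [hr, hZ', and_self, if_true]
      · simp only [hr, false_and, if_false]
        have hr' := mt mem_union.2 hr
        push Not at hr'
        rcases (hsub Z hZ hn).1 hZD with hs | hs
        · rw [h.active₂_eq hZ hn hX hs, if_neg hr'.1]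
        · rw [h.active₂_eq hZ hn hY hs, if_neg hr'.2]
    · have hZ' : Z ∉ s.children X ∪ s.children Y := by
        intro hZ'
        obtain ⟨v, hv⟩ := h.d₂.nonempty hZ
        rcases (hsub Z hZ hn).1 ((hch Z).1 hZ').2.2 with hs | hs
        · exact h2 (h.d₁.eq_of_mem h1 hX (hZD hv) (hs hv))
        · exact h3 (h.d₁.eq_of_mem h1 hY (hZD hv) (hs hv))
      simp only [hZ', and_false, if_false]
      exact h.active₂_eq hZ hn h1 hZD
  · intro Z (hZ : Z ∈ s.C₂) hn
    simp only [State.merge₁]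
    split_ifs with hZ'
    · exact ⟨mem_insert_self _ _, ((hch Z).1 hZ').2.2⟩
    · obtain ⟨h1, h2⟩ := h.parent hZ hn
      refine ⟨(hmem _).2 (Or.inr ⟨h1, fun h3 => hZ' ?_, fun h3 => hZ' ?_⟩), h2⟩
      · exact (hch Z).2 ⟨hZ, hn, (hsub Z hZ hn).2 (Or.inl (h3 ▸ h2))⟩
      · exact (hch Z).2 ⟨hZ, hn, (hsub Z hZ hn).2 (Or.inr (h3 ▸ h2))⟩
  · intro D hD Z
    rcases (hmem D).1 hD with rfl | ⟨h1, h2, h3⟩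
    · simp only [State.merge₁, Function.update_self]
      exact hch Z
    · simp only [State.merge₁, Function.update_of_ne (hold D h1 h2)]
      exact h.children h1 Z
  · intro D hD hn ha v hv
    rcases (hmem D).1 hD with rfl | ⟨h1, h2, h3⟩
    · simp only [State.merge₁, Function.update_self, hn, if_false, one_ne_zero] at ha
    · simp only [State.merge₁, Function.update_of_ne (hold D h1 h2)] at ha
      exact h.dead h1 hn ha v hv
  · intro D hD ha
    rcases (hmem D).1 hD with rfl | ⟨h1, h2, h3⟩
    · have a1 := h.active₁_le hX
      have a2 := h.active₁_le hY
      by_cases a3 : s.active₁ X = 1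
      · obtain ⟨v, hv, hl⟩ := h.live hX a3
        exact ⟨v, mem_union_left _ hv, hl⟩
      · obtain ⟨v, hv, hl⟩ := h.live hY (by omega)
        exact ⟨v, mem_union_right _ hv, hl⟩
    · simp only [State.merge₁, Function.update_of_ne (hold D h1 h2)] at ha
      exact h.live h1 ha
  · intro D hD
    rcases (hmem D).1 hD with rfl | ⟨h1, h2, h3⟩
    · simp only [State.merge₁, Function.update_self]
      rw [h.d₁.sum_subset_split h.d₁.empty h.d₁.laminar hX subset_union_left, hdiff,
        h.w hX, h.w hY]
    · simp only [State.merge₁, Function.update_of_ne (hold D h1 h2)]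
      exact h.w h1
  · intro D hD
    rcases (hmem D).1 hD with rfl | ⟨h1, h2, h3⟩
    · simp only [State.merge₁, Function.update_self]
      rw [h.d₁.sum_subset_split h.d₂.empty h.laminar₂ hX subset_union_left, hdiff,
        h.bound hX, h.bound hY]
    · simp only [State.merge₁, Function.update_of_ne (hold D h1 h2)]
      exact h.bound h1
  · intro a b hab
    obtain ⟨D, hD, ha, hb⟩ := h.edge₂ hab
    obtain ⟨D', hD', hs⟩ := subset_merge X Y hD
    exact ⟨D', hD', hs ha, hs hb⟩

/-- Adding a tight edge to the second forest preserves the invariant, if it joins targets only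
within a component of the first vehicle. -/
theorem merge₂ (h : Inv I s) {X Y : Finset (Vertex T)} {i j : Vertex T} (hX : X ∈ s.C₂)
    (hY : Y ∈ s.C₂) (hXY : X ≠ Y) (hi : i ∈ X) (hj : j ∈ Y)
    (hpos : 0 < s.active₂ X + s.active₂ Y) (ht : s.p₂ i + s.p₂ j = I.cost₂ s(i, j))
    (hsame : i ≠ none → j ≠ none → ∃ D ∈ s.C₁, i ∈ D ∧ j ∈ D) :
    Inv I (s.merge₂ s(i, j) X Y) := by
  have hd := h.d₂.merge_edge hX hY hXY hi hj ht
  have hmem : ∀ D, D ∈ insert (X ∪ Y) ((s.C₂.erase X).erase Y) ↔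
      D = X ∪ Y ∨ D ∈ s.C₂ ∧ D ≠ X ∧ D ≠ Y := by
    intro D; simp only [mem_insert, mem_erase]; tauto
  have hold : ∀ D, D ∈ s.C₂ → D ≠ X → D ≠ X ∪ Y := by
    rintro D hD h1 rfl
    exact h1 (h.d₂.eq_of_mem hD hX (mem_union_left _ hi) hi)
  have hreach : ∀ {v L}, s.label v = some L →
      (graph (inside (insert s(i, j) s.F₂) (insert none L))).Reachable v none := fun hl =>
    (h.label_reach hl).mono (graph_mono (inside_mono (subset_insert _ _) Subset.rfl))
  have hedge : ∀ {a b : T}, s(some a, some b) ∈ insert s(i, j) s.F₂ →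
      ∃ D ∈ s.C₁, some a ∈ D ∧ some b ∈ D := by
    intro a b hab
    rcases mem_insert.1 hab with hab | hab
    · rcases Sym2.eq_iff.1 hab with ⟨rfl, rfl⟩ | ⟨rfl, rfl⟩
      · exact hsame (by simp) (by simp)
      · obtain ⟨D, hD, h1, h2⟩ := hsame (by simp) (by simp)
        exact ⟨D, hD, h2, h1⟩
    · exact h.edge₂ hab
  by_cases hr : none ∈ X ∪ Y
  · -- `Z` is the component that is joined to the depot
    set Z := if none ∈ X then Y else X with hZ
    have hZC : Z ∈ s.C₂ := by rw [hZ]; split_ifs <;> assumption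
    have hZn : none ∉ Z := by
      rw [hZ]
      split_ifs with hnX
      · exact fun hnY => hXY (h.d₂.eq_of_mem hX hY hnX hnY)
      · exact hnX
    have hZXY : ∀ W, none ∉ W → (W ≠ X ∧ W ≠ Y ↔ W ≠ Z) := by
      intro W hW
      rw [hZ]
      split_ifs with hnX
      · have : W ≠ X := fun hWX => hW (hWX ▸ hnX)
        simp [this]
      · have hnY : none ∈ Y := (mem_union.1 hr).resolve_left hnX
        have : W ≠ Y := fun hWX => hW (hWX ▸ hnY)
        simp [this]
    obtain ⟨hP, hZP⟩ := h.parent hZC hZn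
    have hs : s.merge₂ s(i, j) X Y = { s with
        F₂ := insert s(i, j) s.F₂
        C₂ := insert (X ∪ Y) ((s.C₂.erase X).erase Y)
        active₂ := Function.update s.active₂ (X ∪ Y) 0
        parent := Function.update s.parent (X ∪ Y) ∅
        children := Function.update s.children (s.parent Z)
          ((s.children (s.parent Z)).erase Z) } := by
      rw [State.merge₂, if_pos hr]
    rw [hs]
    refine { h with
      d₂ := hd
      root₂ := ?_
      active₂_eq := ?_
      parent := ?_
      children := ?_
      label_reach := hreach
      edge₂ := hedge }
    · intro W hW hn
      rcases (hmem W).1 hW with rfl | ⟨h1, h2, h3⟩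
      · simp only [Function.update_self]
      · simp only [Function.update_of_ne (hold W h1 h2)]
        exact h.root₂ h1 hn
    · intro W D hW hn hD hWD
      rcases (hmem W).1 hW with rfl | ⟨h1, h2, h3⟩
      · exact absurd hr hn
      · simp only [Function.update_of_ne (hold W h1 h2)]
        exact h.active₂_eq h1 hn hD hWD
    · intro W hW hn
      rcases (hmem W).1 hW with rfl | ⟨h1, h2, h3⟩
      · exact absurd hr hn
      · simp only [Function.update_of_ne (hold W h1 h2)]
        exact h.parent h1 hn
    · intro D hD W
      have hC : none ∉ W → (W ∈ insert (X ∪ Y) ((s.C₂.erase X).erase Y) ↔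
          W ∈ s.C₂ ∧ W ≠ Z) := by
        intro hn
        rw [hmem, hZXY W hn]
        exact ⟨fun h' => h'.resolve_left fun hW => hn (hW ▸ hr), Or.inr⟩
      by_cases hDP : D = s.parent Z
      · subst hDP
        simp only [Function.update_self, mem_erase, h.children hP]
        constructor
        · rintro ⟨h1, h2, h3, h4⟩
          exact ⟨(hC h3).2 ⟨h2, h1⟩, h3, h4⟩
        · rintro ⟨h1, h2, h3⟩
          exact ⟨((hC h2).1 h1).2, ((hC h2).1 h1).1, h2, h3⟩
      · simp only [Function.update_of_ne hDP, h.children hD]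
        constructor
        · rintro ⟨h1, h2, h3⟩
          refine ⟨(hC h2).2 ⟨h1, ?_⟩, h2, h3⟩
          rintro rfl
          obtain ⟨v, hv⟩ := h.d₂.nonempty hZC
          exact hDP (h.d₁.eq_of_mem hD hP (h3 hv) (hZP hv))
        · rintro ⟨h1, h2, h3⟩
          exact ⟨((hC h2).1 h1).1, h2, h3⟩
  · -- both components lie in the same component `P` of the first vehicle
    have hr' := mt mem_union.2 hr
    push Not at hr'
    obtain ⟨P, hP, hiP, hjP⟩ := hsame (fun hi' => hr'.1 (hi' ▸ hi)) (fun hj' => hr'.2 (hj' ▸ hj))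
    have hXP := h.subset_of_mem hX hr'.1 hP hi hiP
    have hYP := h.subset_of_mem hY hr'.2 hP hj hjP
    have hparent : s.parent X = P := by
      obtain ⟨h1, h2⟩ := h.parent hX hr'.1
      exact h.d₁.eq_of_mem h1 hP (h2 hi) hiP
    have hPn : none ∉ P := by
      intro hn
      rw [h.active₂_eq hX hr'.1 hP hXP, h.active₂_eq hY hr'.2 hP hYP, if_pos hn] at hpos
      exact absurd hpos (by simp)
    have hs : s.merge₂ s(i, j) X Y = { s with
        F₂ := insert s(i, j) s.F₂
        C₂ := insert (X ∪ Y) ((s.C₂.erase X).erase Y)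
        active₂ := Function.update s.active₂ (X ∪ Y) 1
        parent := Function.update s.parent (X ∪ Y) P
        children := Function.update s.children P
          (insert (X ∪ Y) (((s.children P).erase X).erase Y)) } := by
      rw [State.merge₂, if_neg hr, hparent]
    rw [hs]
    refine { h with
      d₂ := hd
      root₂ := ?_
      active₂_eq := ?_
      parent := ?_
      children := ?_
      label_reach := hreach
      edge₂ := hedge }
    · intro W hW hn
      rcases (hmem W).1 hW with rfl | ⟨h1, h2, h3⟩
      · exact absurd hn hr
      · simp only [Function.update_of_ne (hold W h1 h2)]
        exact h.root₂ h1 hn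
    · intro W D hW hn hD hWD
      rcases (hmem W).1 hW with rfl | ⟨h1, h2, h3⟩
      · have hDP : D = P := h.d₁.eq_of_mem hD hP (hWD (mem_union_left _ hi)) hiP
        subst hDP
        simp only [Function.update_self, hPn, if_false]
      · simp only [Function.update_of_ne (hold W h1 h2)]
        exact h.active₂_eq h1 hn hD hWD
    · intro W hW hn
      rcases (hmem W).1 hW with rfl | ⟨h1, h2, h3⟩
      · simp only [Function.update_self]
        exact ⟨hP, union_subset hXP hYP⟩
      · simp only [Function.update_of_ne (hold W h1 h2)]
        exact h.parent h1 hn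
    · intro D hD W
      by_cases hDP : D = P
      · subst hDP
        simp only [Function.update_self, mem_erase, mem_insert, h.children hP]
        constructor
        · rintro (rfl | ⟨h1, h2, h3, h4⟩)
          · exact ⟨Or.inl rfl, hr, union_subset hXP hYP⟩
          · exact ⟨Or.inr ⟨h1, h2, h3⟩, h4⟩
        · rintro ⟨rfl | ⟨h1, h2, h3⟩, h4⟩
          · exact Or.inl rfl
          · exact Or.inr ⟨h1, h2, h3, h4⟩
      · simp only [Function.update_of_ne hDP, h.children hD]
        have hne : ∀ {v}, v ∈ P → v ∈ W → ¬ W ⊆ D := fun hv hvW hWD =>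
          hDP (h.d₁.eq_of_mem hD hP (hWD hvW) hv)
        rw [hmem]
        constructor
        · rintro ⟨h1, h2, h3⟩
          refine ⟨Or.inr ⟨h1, ?_, ?_⟩, h2, h3⟩
          · rintro rfl; exact hne hiP hi h3
          · rintro rfl; exact hne hjP hj h3
        · rintro ⟨rfl | ⟨h1, _, _⟩, h2, h3⟩
          · exact absurd h3 (hne hiP (mem_union_left _ hi))
          · exact ⟨h1, h2, h3⟩

/-- Deactivating a childless component whose dual constraint is tight preserves the invariant. As it
has no children, the second forest connects all its vertices to the depot, and it does so inside the
component because its other edges do not leave components of the first vehicle. -/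
theorem deactivate (h : Inv I s) {X : Finset (Vertex T)} (hX : X ∈ s.C₁)
    (ha : s.active₁ X = 1) (hch : s.children X = ∅) (ht : s.bound X = s.w X) :
    Inv I (s.deactivate X) := by
  have hn : none ∉ X := fun hn => by rw [h.root₁ hX hn] at ha; exact absurd ha (by simp)
  have hlab : ∀ v, (s.deactivate X).label v =
      if v ∈ X ∧ s.label v = none then some X else s.label v := fun v => rfl
  have hsubX : ∀ {v L}, v ∈ X → s.label v = some L → L ⊆ X := by
    intro v L hv hl
    obtain ⟨D, hD, hs⟩ := h.label_sub hl
    rw [h.d₁.eq_of_mem hX hD hv (hs (h.label_mem hl))]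
    exact hs
  have hall : ∀ v ∈ X, ∃ L ⊆ X, (s.deactivate X).label v = some L := by
    intro v hv
    rw [hlab]
    cases hl : s.label v with
    | none => exact ⟨X, Subset.rfl, by simp [hv]⟩
    | some L => exact ⟨L, hsubX hv hl, by simp⟩
  have hcases : ∀ {v L}, (s.deactivate X).label v = some L →
      (v ∈ X ∧ s.label v = none ∧ L = X) ∨ s.label v = some L := by
    intro v L hl
    rw [hlab] at hl
    split_ifs at hl with hv
    · exact Or.inl ⟨hv.1, hv.2, (Option.some.inj hl).symm⟩
    · exact Or.inr hl
  have hkeep : ∀ {v L}, s.label v = some L → (s.deactivate X).label v = some L := by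
    intro v L hl
    rw [hlab, if_neg (by simp [hl]), hl]
  have hreach : ∀ v ∈ X, (graph (inside s.F₂ (insert none X))).Reachable v none := by
    intro v hv
    obtain ⟨Z, hZ, hvZ⟩ := h.d₂.exists_mem v
    have hZn : none ∈ Z := by
      by_contra hZn
      have := (h.children hX Z).2 ⟨hZ, hZn, h.subset_of_mem hZ hZn hX hvZ hv⟩
      simp [hch] at this
    refine of_reachable (P := fun u => u ∈ insert none X →
      (graph (inside s.F₂ (insert none X))).Reachable u none) ?_ (h.d₂.conn hZ hvZ hZn)
      (fun _ => SimpleGraph.Reachable.refl _) (mem_insert_of_mem hv)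
    intro a b hab hb haX
    cases a with
    | none => exact SimpleGraph.Reachable.refl _
    | some a =>
      have haX' : some a ∈ X := by simpa using haX
      have hbX : b ∈ insert none X := by
        cases b with
        | none => exact mem_insert_self _ _
        | some b =>
          obtain ⟨D, hD, h1, h2⟩ := h.edge₂ hab
          rw [h.d₁.eq_of_mem hX hD haX' h1]
          exact mem_insert_of_mem h2
      exact (reachable_of_mem (mem_inside.2 ⟨hab, haX, hbX⟩)).trans (hb hbX)
  have hact : ∀ D, D ≠ X → (s.deactivate X).active₁ D = s.active₁ D := fun D hD =>
    Function.update_of_ne hD _ _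
  have hactX : (s.deactivate X).active₁ X = 0 := Function.update_self _ _ _
  refine { h with
    active₁_le := ?_
    root₁ := ?_
    dead := ?_
    live := ?_
    label_mem := ?_
    label_none := ?_
    label_sub := ?_
    label_label := ?_
    label_reach := ?_
    closed := ?_ }
  · intro D hD
    by_cases hDX : D = X
    · rw [hDX, hactX]; simp
    · rw [hact D hDX]; exact h.active₁_le hD
  · intro D hD hnD
    by_cases hDX : D = X
    · rw [hDX, hactX]
    · rw [hact D hDX]; exact h.root₁ hD hnD
  · intro D hD hnD h0 v hv
    by_cases hDX : D = X
    · subst hDX; exact hall v hv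
    · rw [hact D hDX] at h0
      obtain ⟨L, hL, hl⟩ := h.dead hD hnD h0 v hv
      exact ⟨L, hL, hkeep hl⟩
  · intro D hD h1
    by_cases hDX : D = X
    · rw [hDX, hactX] at h1; exact absurd h1 (by simp)
    · rw [hact D hDX] at h1
      obtain ⟨v, hv, hl⟩ := h.live hD h1
      refine ⟨v, hv, ?_⟩
      rw [hlab, if_neg, hl]
      exact fun hvX => hDX (h.d₁.eq_of_mem hD hX hv hvX.1)
  · intro v L hl
    rcases hcases hl with ⟨h1, _, rfl⟩ | hl
    · exact h1
    · exact h.label_mem hl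
  · intro v L hl
    rcases hcases hl with ⟨h1, _, rfl⟩ | hl
    · exact hn
    · exact h.label_none hl
  · intro v L hl
    rcases hcases hl with ⟨h1, _, rfl⟩ | hl
    · exact ⟨L, hX, Subset.rfl⟩
    · exact h.label_sub hl
  · intro v L hl u hu
    rcases hcases hl with ⟨h1, _, rfl⟩ | hl
    · exact hall u hu
    · obtain ⟨L', hL', hl'⟩ := h.label_label hl u hu
      exact ⟨L', hL', hkeep hl'⟩
  · intro v L hl
    rcases hcases hl with ⟨h1, _, rfl⟩ | hl
    · exact hreach v h1
    · exact h.label_reach hl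
  · intro B hB
    by_cases hnew : ∃ v ∈ B, v ∈ X ∧ s.label v = none
    · -- then `B` contains `X`, whose constraint is tight, and the rest of `B` was tight before
      obtain ⟨v, hvB, hvX, hv⟩ := hnew
      have hXB : X ⊆ B := by
        obtain ⟨L, hL, hl⟩ := hB v hvB
        rcases hcases hl with ⟨_, _, rfl⟩ | hl
        · exact hL
        · simp [hv] at hl
      have hrest := h.closed (B \ X) (by
        intro u hu
        rw [mem_sdiff] at hu
        obtain ⟨L, hL, hl⟩ := hB u hu.1
        rcases hcases hl with ⟨h1, _, _⟩ | hl
        · exact absurd h1 hu.2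
        · refine ⟨L, ?_, hl⟩
          rcases h.d₁.subset_or_disjoint hX (h.label_sub hl) with h1 | h1
          · exact absurd (h1 (h.label_mem hl)) hu.2
          · rw [subset_sdiff]; exact ⟨hL, h1⟩)
      have e1 := h.d₁.sum_subset_split h.d₁.empty h.d₁.laminar hX hXB
      have e2 := h.d₁.sum_subset_split h.d₂.empty h.laminar₂ hX hXB
      rw [h.bound hX, h.w hX] at ht
      change ∑ S : Finset T with lift S ⊆ B, s.Y₂ S ≤ ∑ S : Finset T with lift S ⊆ B, s.Y₁ S
      linarith
    · push Not at hnew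
      refine h.closed B fun v hv => ?_
      obtain ⟨L, hL, hl⟩ := hB v hv
      rcases hcases hl with ⟨h1, h2, _⟩ | hl
      · exact absurd h2 (hnew v hv h1)
      · exact ⟨L, hL, hl⟩

end Inv

end Steps

/-! ### Progress and termination of the main loop -/

section Progress

variable {T : Type*} [Fintype T] [DecidableEq T]

theorem State.mem_act₁ {s : State T} {X : Finset (Vertex T)} :
    X ∈ s.act₁ ↔ X ∈ s.C₁ ∧ s.active₁ X = 1 := mem_filter

namespace Inv

variable {I : Instance T} {s : State T}

theorem link₁_nonneg (h : Inv I s) {ε : ℝ} {X Y : Finset (Vertex T)} {i j : Vertex T}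
    (hl : IsLink I.cost₁ s.C₁ s.active₁ s.p₁ ε X Y i j) : 0 ≤ ε := by
  rw [hl.eq]
  exact div_nonneg (h.d₁.slack_nonneg hl.memx hl.memy hl.ne hl.hi hl.hj) (Nat.cast_nonneg _)

theorem link₂_nonneg (h : Inv I s) {ε : ℝ} {X Y : Finset (Vertex T)} {i j : Vertex T}
    (hl : IsLink I.cost₂ s.C₂ s.active₂ s.p₂ ε X Y i j) : 0 ≤ ε := by
  rw [hl.eq]
  exact div_nonneg (h.d₂.slack_nonneg hl.memx hl.memy hl.ne hl.hi hl.hj) (Nat.cast_nonneg _)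

theorem increment_nonneg (h : Inv I s) {ε : ℝ} (hε : I.IsIncrement s ε) : 0 ≤ ε := by
  rcases hε.1 with ⟨X, Y, i, j, hl⟩ | ⟨X, Y, i, j, hl⟩ | ⟨X, hX, _, _, rfl⟩
  · exact h.link₁_nonneg hl
  · exact h.link₂_nonneg hl
  · have := h.dual X
    rw [← h.w hX, ← h.bound hX] at this
    linarith

/-- Growing by the increment preserves the invariant: it is the least value of all events. -/
theorem grow_increment (h : Inv I s) {ε : ℝ} (hε : I.IsIncrement s ε) : Inv I (s.grow ε) := by
  have h0 := h.increment_nonneg hε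
  refine h.grow h0 ?_ ?_ ?_
  · intro X hX Z hZ hXZ i hi j hj
    have hs := h.d₁.slack_nonneg hX hZ hXZ hi hj
    by_cases hpos : 0 < s.active₁ X + s.active₁ Z
    · have h1 := hε.2 (Or.inl ⟨X, Z, i, j, hX, hZ, hXZ, hi, hj, hpos, rfl⟩)
      rw [le_div_iff₀ (by exact_mod_cast hpos)] at h1
      refine le_trans (le_of_eq ?_) h1
      rw [h.active₁_eq hX, h.active₁_eq hZ]
      push_cast
      rw [mul_add]
      congr 1 <;> split_ifs <;> simp
    · rw [h.active₁_eq hX, h.active₁_eq hZ] at hpos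
      have h1 : X ∉ s.act₁ := fun hx => hpos (by simp [hx])
      have h2 : Z ∉ s.act₁ := fun hx => hpos (by simp [hx])
      rw [if_neg h1, if_neg h2, add_zero]
      exact hs
  · intro X hX Z hZ hXZ i hi j hj
    have hs := h.d₂.slack_nonneg hX hZ hXZ hi hj
    by_cases hpos : 0 < s.active₂ X + s.active₂ Z
    · have h1 := hε.2 (Or.inr (Or.inl ⟨X, Z, i, j, hX, hZ, hXZ, hi, hj, hpos, rfl⟩))
      rw [le_div_iff₀ (by exact_mod_cast hpos)] at h1
      refine le_trans (le_of_eq ?_) h1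
      rw [h.active₂_eq_ite hX, h.active₂_eq_ite hZ]
      push_cast
      rw [mul_add]
      congr 1 <;> split_ifs <;> simp
    · rw [h.active₂_eq_ite hX, h.active₂_eq_ite hZ] at hpos
      have h1 : X ∉ s.act₂ := fun hx => hpos (by simp [hx])
      have h2 : Z ∉ s.act₂ := fun hx => hpos (by simp [hx])
      rw [if_neg h1, if_neg h2, add_zero]
      exact hs
  · intro X hX hch
    rw [State.act₁, mem_filter] at hX
    exact hε.2 (Or.inr (Or.inr ⟨X, hX.1, hX.2, hch, rfl⟩))

/-- The edge that determines the increment is tight after growing. -/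
theorem grow_tight₁ (h : Inv I s) {ε : ℝ} {X Y : Finset (Vertex T)} {i j : Vertex T}
    (hl : IsLink I.cost₁ s.C₁ s.active₁ s.p₁ ε X Y i j) :
    (s.grow ε).p₁ i + (s.grow ε).p₁ j = I.cost₁ s(i, j) := by
  have key : ∀ {Z v}, Z ∈ s.C₁ → v ∈ Z → (s.grow ε).p₁ v = s.p₁ v + ε * s.active₁ Z := by
    intro Z v hZ hv
    have : (∃ W ∈ s.act₁, v ∈ W) ↔ Z ∈ s.act₁ :=
      ⟨fun ⟨W, hW, hvW⟩ => h.d₁.eq_of_mem (mem_filter.1 hW).1 hZ hvW hv ▸ hW,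
        fun hZ' => ⟨Z, hZ', hv⟩⟩
    rw [grow_p₁, h.active₁_eq hZ, if_congr this rfl rfl]
    split_ifs <;> simp
  have h1 := hl.eq
  rw [eq_div_iff (by exact_mod_cast hl.pos.ne')] at h1
  rw [key hl.memx hl.hi, key hl.memy hl.hj]
  push_cast at h1
  linarith

/-- The edge that determines the increment is tight after growing. -/
theorem grow_tight₂ (h : Inv I s) {ε : ℝ} {X Y : Finset (Vertex T)} {i j : Vertex T}
    (hl : IsLink I.cost₂ s.C₂ s.active₂ s.p₂ ε X Y i j) :
    (s.grow ε).p₂ i + (s.grow ε).p₂ j = I.cost₂ s(i, j) := by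
  have key : ∀ {Z v}, Z ∈ s.C₂ → v ∈ Z → (s.grow ε).p₂ v = s.p₂ v + ε * s.active₂ Z := by
    intro Z v hZ hv
    have : (∃ W ∈ s.act₂, v ∈ W) ↔ Z ∈ s.act₂ :=
      ⟨fun ⟨W, hW, hvW⟩ => h.d₂.eq_of_mem (mem_filter.1 hW).1 hZ hvW hv ▸ hW,
        fun hZ' => ⟨Z, hZ', hv⟩⟩
    rw [grow_p₂, h.active₂_eq_ite hZ, if_congr this rfl rfl]
    split_ifs <;> simp
  have h1 := hl.eq
  rw [eq_div_iff (by exact_mod_cast hl.pos.ne')] at h1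
  rw [key hl.memx hl.hi, key hl.memy hl.hj]
  push_cast at h1
  linarith

/-- As the first vehicle is cheaper and its components grow whenever those of the second vehicle
do, an edge between targets that is selected for the second vehicle lies in a component of the
first vehicle. -/
theorem same_component (h : Inv I s) {ε : ℝ} (hε : I.IsIncrement s ε) (hc : ¬ I.Cand₁ s ε)
    {X Y : Finset (Vertex T)} {i j : Vertex T}
    (hl : IsLink I.cost₂ s.C₂ s.active₂ s.p₂ ε X Y i j) (hi : i ≠ none) (hj : j ≠ none) :
    ∃ D ∈ s.C₁, i ∈ D ∧ j ∈ D := by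
  obtain ⟨D, hD, hiD⟩ := h.d₁.exists_mem i
  obtain ⟨E, hE, hjE⟩ := h.d₁.exists_mem j
  by_cases hDE : D = E
  · exact ⟨D, hD, hiD, hDE ▸ hjE⟩
  exfalso
  have a1 := h.active₂_le hl.memx hD hl.hi hiD
  have a2 := h.active₂_le hl.memy hE hl.hj hjE
  have hpos := hl.pos
  have hpos' : 0 < s.active₁ D + s.active₁ E := by omega
  have hlink : IsLink I.cost₁ s.C₁ s.active₁ s.p₁
      ((I.cost₁ s(i, j) - s.p₁ i - s.p₁ j) / ((s.active₁ D + s.active₁ E : ℕ) : ℝ)) D E i j :=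
    ⟨hD, hE, hDE, hiD, hjE, hpos', rfl⟩
  have h1 := hε.2 (Or.inl ⟨D, E, i, j, hlink⟩)
  have h2 : (I.cost₁ s(i, j) - s.p₁ i - s.p₁ j) / ((s.active₁ D + s.active₁ E : ℕ) : ℝ) ≤ ε := by
    rw [hl.eq]
    have hc' : I.cost₁ s(i, j) ≤ I.cost₂ s(i, j) := by
      cases i with
      | none => exact absurd rfl hi
      | some a =>
        cases j with
        | none => exact absurd rfl hj
        | some b =>
          refine I.cheaper a b ?_
          rintro rfl
          exact hl.ne (h.d₂.eq_of_mem hl.memx hl.memy hl.hi hl.hj)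
    have n1 := h.d₁.slack_nonneg hD hE hDE hiD hjE
    have p1 := h.pot_le i
    have p2 := h.pot_le j
    refine div_le_div₀ (by linarith) (by linarith) (by exact_mod_cast hpos) ?_
    exact_mod_cast (by omega)
  refine hc ⟨D, E, i, j, ?_⟩
  rw [le_antisymm h1 h2] at *
  exact hlink

/-- Every iteration preserves the invariant. -/
theorem step (h : Inv I s) {s' : State T} (hs : I.Step s s') : Inv I s' := by
  cases hs with
  | case₁ ε X Y i j hrun hε hl =>
    exact (h.grow_increment hε).merge₁ hl.memx hl.memy hl.ne hl.hi hl.hj hl.pos (h.grow_tight₁ hl)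
  | case₂ ε X Y i j hrun hε hc hl =>
    exact (h.grow_increment hε).merge₂ hl.memx hl.memy hl.ne hl.hi hl.hj hl.pos (h.grow_tight₂ hl)
      (h.same_component hε hc hl)
  | case₃ ε X hrun hε hc₁ hc₂ ht =>
    refine (h.grow_increment hε).deactivate ht.1 ht.2.1 ht.2.2.1 ?_
    have e1 : (s.grow ε).bound X = s.bound X := by
      simp only [State.grow, ht.1, ht.2.1, ht.2.2.1, and_self, if_true, card_empty, Nat.cast_zero,
        mul_zero, add_zero]
    have e2 : (s.grow ε).w X = s.w X + ε := by
      simp only [State.grow, ht.1, ht.2.1, and_self, if_true]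
    rw [e1, e2, ht.2.2.2]
    ring

theorem of_reached {k : ℕ} (h : I.Reached k s) : Inv I s := by
  induction h with
  | start => exact Inv.start I
  | next k s s' _ hs ih => exact ih.step hs

/-- Every iteration merges two components of a vehicle or deactivates a component of the first. -/
theorem potential_step (h : Inv I s) {s' : State T} (hs : I.Step s s') :
    s'.C₁.card + s'.C₂.card + s'.act₁.card + 1 ≤ s.C₁.card + s.C₂.card + s.act₁.card := by
  cases hs with
  | case₁ ε X Y i j hrun hε hl =>
    have hcard := h.d₁.card_merge hl.memx hl.memy hl.ne
    have hact : (((s.grow ε).merge₁ s(i, j) X Y).act₁).card ≤ s.act₁.card := by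
      have hsub : ((s.grow ε).merge₁ s(i, j) X Y).act₁ ⊆
          insert (X ∪ Y) ((s.act₁.erase X).erase Y) := by
        intro D hD
        rw [State.mem_act₁] at hD
        simp only [State.merge₁, State.grow, mem_insert, mem_erase, State.mem_act₁] at hD ⊢
        by_cases hDu : D = X ∪ Y
        · exact Or.inl hDu
        · rw [Function.update_of_ne hDu] at hD
          tauto
      refine (card_le_card hsub).trans ((card_insert_le _ _).trans ?_)
      have hpos := hl.pos
      rw [h.active₁_eq hl.memx, h.active₁_eq hl.memy] at hpos
      by_cases hX : X ∈ s.act₁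
      · have h1 := card_le_card (erase_subset Y (s.act₁.erase X))
        rw [card_erase_of_mem hX] at h1
        have := card_pos.2 ⟨_, hX⟩
        omega
      · have hY : Y ∈ s.act₁ := by
          by_contra hY
          simp [hX, hY] at hpos
        rw [erase_eq_of_notMem hX, card_erase_of_mem hY]
        have := card_pos.2 ⟨_, hY⟩
        omega
    have e1 : ((s.grow ε).merge₁ s(i, j) X Y).C₁ = insert (X ∪ Y) ((s.C₁.erase X).erase Y) := rfl
    have e2 : ((s.grow ε).merge₁ s(i, j) X Y).C₂ = s.C₂ := rfl
    rw [e1, e2]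
    omega
  | case₂ ε X Y i j hrun hε hc hl =>
    have hcard := h.d₂.card_merge hl.memx hl.memy hl.ne
    have e1 : ((s.grow ε).merge₂ s(i, j) X Y).C₁ = s.C₁ := by
      simp only [State.merge₂]; split_ifs <;> rfl
    have e2 : ((s.grow ε).merge₂ s(i, j) X Y).C₂ = insert (X ∪ Y) ((s.C₂.erase X).erase Y) := by
      simp only [State.merge₂]; split_ifs <;> rfl
    have e3 : ((s.grow ε).merge₂ s(i, j) X Y).act₁ = s.act₁ := by
      simp only [State.merge₂]; split_ifs <;> rfl
    rw [e1, e2, e3]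
    omega
  | case₃ ε X hrun hε hc₁ hc₂ ht =>
    have hX : X ∈ s.act₁ := mem_filter.2 ⟨ht.1, ht.2.1⟩
    have hsub : ((s.grow ε).deactivate X).act₁ ⊆ s.act₁.erase X := by
      intro D hD
      rw [State.mem_act₁] at hD
      simp only [State.deactivate, State.grow, mem_erase, State.mem_act₁] at hD ⊢
      by_cases hDX : D = X
      · subst hDX
        simp at hD
      · rw [Function.update_of_ne hDX] at hD
        exact ⟨hDX, hD⟩
    have h1 := card_le_card hsub
    rw [card_erase_of_mem hX] at h1
    have := card_pos.2 ⟨_, hX⟩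
    have e1 : ((s.grow ε).deactivate X).C₁ = s.C₁ := rfl
    have e2 : ((s.grow ε).deactivate X).C₂ = s.C₂ := rfl
    rw [e1, e2]
    omega

end Inv

/-- At the start there are `|T| + 1` components of each vehicle, `|T|` of them active. -/
theorem Instance.Reached.potential {I : Instance T} {s : State T} {k : ℕ} (h : I.Reached k s) :
    k + s.C₁.card + s.C₂.card + s.act₁.card ≤ 3 * Fintype.card T + 2 := by
  induction h with
  | start =>
    have h1 : (State.start T).C₁.card ≤ Fintype.card T + 1 := by
      refine card_image_le.trans ?_
      rw [card_univ, Fintype.card_option]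
    have h2 : (State.start T).act₁.card ≤ Fintype.card T := by
      have hsub : (State.start T).act₁ ⊆ (univ : Finset T).image fun t => {some t} := by
        intro X hX
        rw [State.mem_act₁] at hX
        simp only [State.start, mem_image, mem_univ, true_and] at hX ⊢
        obtain ⟨⟨v, rfl⟩, hv⟩ := hX
        cases v with
        | none => simp at hv
        | some t => exact ⟨t, rfl⟩
      exact (card_le_card hsub).trans (card_image_le.trans card_univ.le)
    have h3 : (State.start T).C₂.card ≤ Fintype.card T + 1 := h1
    omega
  | next k s s' hr hs ih =>
    have := (Inv.of_reached hr).potential_step hs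
    omega

/-- While a component is active, the edge from it to the depot competes for the increment. -/
theorem Inv.exists_increment {I : Instance T} {s : State T} (h : Inv I s) (hrun : s.Running) :
    ∃ ε, I.IsIncrement s ε := by
  classical
  obtain ⟨X, hX, ha⟩ := hrun
  have hn : none ∉ X := h.none_notMem_act₁ (mem_filter.2 ⟨hX, ha⟩)
  obtain ⟨v, hv⟩ := h.d₁.nonempty hX
  obtain ⟨D, hD, hnD⟩ := h.d₁.exists_mem none
  set A : Set ℝ := {δ : ℝ | I.Cand₁ s δ ∨ I.Cand₂ s δ ∨ ∃ C, Instance.IsTight s δ C} with hA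
  have hfin : A.Finite := by
    refine Set.Finite.subset (((Set.finite_range fun x : Finset (Vertex T) × Finset (Vertex T) ×
        Vertex T × Vertex T => (I.cost₁ s(x.2.2.1, x.2.2.2) - s.p₁ x.2.2.1 - s.p₁ x.2.2.2) /
          ((s.active₁ x.1 + s.active₁ x.2.1 : ℕ) : ℝ)).union
      (Set.finite_range fun x : Finset (Vertex T) × Finset (Vertex T) ×
        Vertex T × Vertex T => (I.cost₂ s(x.2.2.1, x.2.2.2) - s.p₂ x.2.2.1 - s.p₂ x.2.2.2) /
          ((s.active₂ x.1 + s.active₂ x.2.1 : ℕ) : ℝ))).union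
      (Set.finite_range fun x : Finset (Vertex T) => s.bound x - s.w x)) ?_
    rintro δ (⟨Z, W, i, j, hl⟩ | ⟨Z, W, i, j, hl⟩ | ⟨Z, hZ⟩)
    · exact Or.inl (Or.inl ⟨(Z, W, i, j), hl.eq.symm⟩)
    · exact Or.inl (Or.inr ⟨(Z, W, i, j), hl.eq.symm⟩)
    · exact Or.inr ⟨Z, hZ.2.2.2.symm⟩
  have hne : A.Nonempty := ⟨_, Or.inl ⟨X, D, v, none, hX, hD, fun hXD => hn (hXD ▸ hnD), hv, hnD,
    by omega, rfl⟩⟩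
  obtain ⟨ε, hε, hmin⟩ := Set.exists_min_image A id hfin hne
  exact ⟨ε, hε, fun δ hδ => hmin δ hδ⟩

theorem Inv.exists_step {I : Instance T} {s : State T} (h : Inv I s) (hrun : s.Running) :
    ∃ s', I.Step s s' := by
  obtain ⟨ε, hε⟩ := h.exists_increment hrun
  by_cases h1 : I.Cand₁ s ε
  · obtain ⟨X, Y, i, j, hl⟩ := h1
    exact ⟨_, .case₁ s ε X Y i j hrun hε hl⟩
  by_cases h2 : I.Cand₂ s ε
  · obtain ⟨X, Y, i, j, hl⟩ := h2
    exact ⟨_, .case₂ s ε X Y i j hrun hε h1 hl⟩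
  · rcases hε.1 with h3 | h3 | ⟨X, hX⟩
    · exact absurd h3 h1
    · exact absurd h3 h2
    · exact ⟨_, .case₃ s ε X hrun hε h1 h2 hX⟩

end Progress

/-! ### Pruning -/

section Pruning

variable {T : Type*} [Fintype T] [DecidableEq T]

open Classical in
/-- The vertices that `F` connects to the depot. -/
def attached (F : Finset (Edge T)) : Finset (Vertex T) :=
  univ.filter fun v => (graph F).Reachable v none

theorem mem_attached {F : Finset (Edge T)} {v : Vertex T} :
    v ∈ attached F ↔ (graph F).Reachable v none := by
  simp [attached]

theorem none_mem_attached (F : Finset (Edge T)) : none ∈ attached F :=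
  mem_attached.2 (SimpleGraph.Reachable.refl _)

theorem reachable_inside_attached {F : Finset (Edge T)} {v : Vertex T}
    (h : (graph F).Reachable v none) : (graph (inside F (attached F))).Reachable v none := by
  refine of_reachable (P := fun v => (graph (inside F (attached F))).Reachable v none) ?_ h
    (SimpleGraph.Reachable.refl _)
  intro a b hab hb
  have hb' : (graph F).Reachable b none := hb.mono (graph_mono (inside_subset _ _))
  exact (reachable_of_mem (mem_inside.2 ⟨hab, mem_attached.2 ((reachable_of_mem hab).trans hb'),
    mem_attached.2 hb'⟩)).trans hb

theorem isTreeOn_of_reachable {F : Finset (Edge T)} {A : Finset T} (hac : (graph F).IsAcyclic)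
    (hF : ∀ e ∈ F, ¬ e.IsDiag ∧ ∀ v ∈ e, v ∈ insertNone A)
    (hr : ∀ a ∈ A, (graph F).Reachable (some a) none) : IsTreeOn F A := by
  refine ⟨hF, ?_, hac.induce _⟩
  have hn : none ∈ insertNone A := by simp
  have key :
      ∀ v (hv : v ∈ insertNone A), ((graph F).induce (insertNone A : Set (Vertex T))).Reachable
      ⟨v, hv⟩ ⟨none, hn⟩ := by
    intro v hv
    have hvr : (graph F).Reachable v none := by
      cases v with
      | none => exact SimpleGraph.Reachable.refl _
      | some a => exact hr a (by simpa using hv)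
    refine of_reachable (P := fun v => ∀ hv : v ∈ insertNone A,
      ((graph F).induce (insertNone A : Set (Vertex T))).Reachable ⟨v, hv⟩ ⟨none, hn⟩) ?_ hvr
      (fun _ => SimpleGraph.Reachable.refl _) hv
    intro a b hab hb ha
    have hb' : b ∈ insertNone A := (hF _ hab).2 b (by simp)
    have hne : a ≠ b := by simpa using (hF _ hab).1
    refine SimpleGraph.Reachable.trans (SimpleGraph.Adj.reachable ?_) (hb hb')
    exact SimpleGraph.comap_adj.2 (graph_adj.2 ⟨hab, hne⟩)
  have : Nonempty (insertNone A : Set (Vertex T)) := ⟨⟨none, hn⟩⟩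
  refine ⟨fun u v => (key u.1 u.2).trans (key v.1 v.2).symm⟩

section Final

variable {I : Instance T} {s : State T}

/-- When no component is active, unmarked vertices are connected to the depot. -/
theorem Inv.exists_label (h : Inv I s) (hrun : ¬ s.Running) {v : Vertex T}
    (hv : ¬ (graph s.F₁).Reachable v none) : ∃ L, s.label v = some L := by
  obtain ⟨D, hD, hvD⟩ := h.d₁.exists_mem v
  have hn : none ∉ D := fun hn => hv (h.d₁.conn hD hvD hn)
  have h0 : s.active₁ D = 0 := by
    have := h.active₁_le hD
    by_contra h0
    exact hrun ⟨D, hD, by omega⟩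
  obtain ⟨L, _, hL⟩ := h.dead hD hn h0 v hvD
  exact ⟨L, hL⟩

theorem Inv.keeps₁ (h : Inv I s) (hrun : ¬ s.Running) : Keeps₁ s s.F₁ where
  sub := Subset.rfl
  unmarked v hv := by
    by_contra hn
    obtain ⟨L, hL⟩ := h.exists_label hrun hn
    simp [hv] at hL
  marked u v C C' hu hv hC hr := by
    obtain ⟨D, hD, hs⟩ := h.label_sub hv
    have h1 := hs (hC (h.label_mem hu))
    exact (h.d₁.conn hD (hs (h.label_mem hv)) h1).trans hr

/-- The label of a vertex that is cut off from the first depot is cut off altogether. -/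
theorem Inv.label_subset (h : Inv I s) {F : Finset (Edge T)} (hF : Keeps₁ s F) {v : Vertex T}
    (hv : v ∉ attached F) : ∃ L ⊆ (attached F)ᶜ, s.label v = some L := by
  cases hl : s.label v with
  | none => exact absurd (mem_attached.2 (hF.unmarked v hl)) hv
  | some L =>
    refine ⟨L, fun u hu => ?_, rfl⟩
    rw [mem_compl, mem_attached]
    intro hr
    obtain ⟨L', hL', hl'⟩ := h.label_label hl u hu
    exact hv (mem_attached.2 (hF.marked u v L' L hl' hl hL' hr))

/-- The edges of the second forest among the targets cut off from the first depot connect all of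
them to the second depot, as each can be reached within its label. -/
theorem Inv.keeps₂_inside (h : Inv I s) {F : Finset (Edge T)} (hF : Keeps₁ s F) :
    Keeps₂ s F (inside s.F₂ (insert none (attached F)ᶜ)) where
  sub := inside_subset _ _
  cover t ht := by
    obtain ⟨L, hL, hl⟩ := h.label_subset hF (mt mem_attached.1 ht)
    exact (h.label_reach hl).mono (graph_mono (inside_mono Subset.rfl (insert_subset_insert _ hL)))

theorem Inv.exists_pruned (h : Inv I s) (hrun : ¬ s.Running) : ∃ F₁ F₂, Pruned s F₁ F₂ := by
  classical
  obtain ⟨F₁, hF₁, hmin₁⟩ := exists_min_image (s.F₁.powerset.filter (Keeps₁ s)) card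
    ⟨s.F₁, mem_filter.2 ⟨mem_powerset.2 Subset.rfl, h.keeps₁ hrun⟩⟩
  rw [mem_filter] at hF₁
  have hk := h.keeps₂_inside hF₁.2
  obtain ⟨F₂, hF₂, hmin₂⟩ := exists_min_image (s.F₂.powerset.filter (Keeps₂ s F₁)) card
    ⟨_, mem_filter.2 ⟨mem_powerset.2 hk.sub, hk⟩⟩
  rw [mem_filter] at hF₂
  exact ⟨F₁, F₂, hF₁.2, fun G hG => hmin₁ G (mem_filter.2 ⟨mem_powerset.2 hG.sub, hG⟩), hF₂.2,
    fun G hG => hmin₂ G (mem_filter.2 ⟨mem_powerset.2 hG.sub, hG⟩)⟩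

variable {F₁ F₂ : Finset (Edge T)}

/-- By minimality, all edges of the pruned first forest are connected to the depot. -/
theorem Pruned.ends₁ (hp : Pruned s F₁ F₂) : ∀ e ∈ F₁, ∀ v ∈ e, v ∈ attached F₁ := by
  have hle := graph_mono (inside_subset F₁ (attached F₁))
  have hk : Keeps₁ s (inside F₁ (attached F₁)) :=
    ⟨(inside_subset _ _).trans hp.keeps₁.sub,
      fun v hv => reachable_inside_attached (hp.keeps₁.unmarked v hv),
      fun u v C C' hu hv hC hr => reachable_inside_attached
        (hp.keeps₁.marked u v C C' hu hv hC (hr.mono hle))⟩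
  have heq := eq_of_subset_of_card_le (inside_subset _ _) (hp.min₁ _ hk)
  intro e he v hv
  rw [← heq, inside, mem_filter] at he
  exact he.2 v hv

/-- In a forest, the edges between vertices that are to be connected to the depot are needed. -/
theorem Inv.inside_subset_of_keeps₂ (h : Inv I s) {F G : Finset (Edge T)} (hG : Keeps₂ s F G) :
    inside s.F₂ (insert none (attached F)ᶜ) ⊆ G := by
  intro e he
  induction e using Sym2.ind with | _ a b =>
  rw [mem_inside] at he
  have key : ∀ v ∈ insert none (attached F)ᶜ, (graph G).Reachable v none := by
    intro v hv
    cases v with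
    | none => exact SimpleGraph.Reachable.refl _
    | some t =>
      refine hG.cover t fun hr => ?_
      simp only [mem_insert, reduceCtorEq, false_or, mem_compl, mem_attached] at hv
      exact hv hr
  refine mem_of_reachable h.d₂.acyclic hG.sub he.1 ?_
    ((key a he.2.1).trans (key b he.2.2).symm)
  simpa using h.d₂.not_diag he.1

theorem Inv.pruned_eq₂ (h : Inv I s) (hp : Pruned s F₁ F₂) :
    F₂ = inside s.F₂ (insert none (attached F₁)ᶜ) :=
  (eq_of_subset_of_card_le (h.inside_subset_of_keeps₂ hp.keeps₂)
    (hp.min₂ _ (h.keeps₂_inside hp.keeps₁))).symm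

theorem Inv.isHSF (h : Inv I s) (hp : Pruned s F₁ F₂) : IsHSF F₁ F₂ := by
  classical
  have hA : ∀ v, v ∈ insertNone (eraseNone (attached F₁)) ↔ v ∈ attached F₁ := by
    intro v
    cases v with
    | none => simp [none_mem_attached]
    | some t => simp
  refine ⟨eraseNone (attached F₁), isTreeOn_of_reachable
    (h.d₁.acyclic.anti (graph_mono hp.keeps₁.sub)) ?_ ?_, isTreeOn_of_reachable
    (h.d₂.acyclic.anti (graph_mono hp.keeps₂.sub)) ?_ ?_⟩
  · exact fun e he => ⟨h.d₁.not_diag (hp.keeps₁.sub he), fun v hv => (hA v).2 (hp.ends₁ e he v hv)⟩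
  · exact fun a ha => mem_attached.1 (by simpa using ha)
  · refine fun e he => ⟨h.d₂.not_diag (hp.keeps₂.sub he), fun v hv => ?_⟩
    rw [h.pruned_eq₂ hp, inside, mem_filter] at he
    have := he.2 v hv
    cases v with
    | none => simp
    | some t => simpa using this
  · exact fun a ha => hp.keeps₂.cover a fun hr => by simp [mem_attached, hr] at ha

/-- A set of vertices that consists of labels is not a leaf of the pruned tree: otherwise all edges
at its vertices could be removed. -/
theorem Inv.two_le_deg (h : Inv I s) (hp : Pruned s F₁ F₂) {X : Finset (Vertex T)}
    (hn : none ∉ X) (hX : ∀ v ∈ X, ∃ L ⊆ X, s.label v = some L) (hm : ∃ v ∈ X, v ∈ attached F₁) :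
    2 ≤ deg F₁ X := by
  by_contra hlt
  have huniq : ∀ {a b a' b'}, s(a, b) ∈ F₁ → s(a', b') ∈ F₁ → a ∈ X → b ∉ X → a' ∈ X → b' ∉ X →
      b = b' := by
    intro a b a' b' h1 h2 ha hb ha' hb'
    have h3 := card_le_one.1 (show (F₁.filter (Crosses X)).card ≤ 1 by
      rw [deg] at hlt; omega) _ (mem_filter.2 ⟨h1, crosses_mk.2 (Or.inl ⟨ha, hb⟩)⟩) _
      (mem_filter.2 ⟨h2, crosses_mk.2 (Or.inl ⟨ha', hb'⟩)⟩)
    rcases Sym2.eq_iff.1 h3 with ⟨_, h4⟩ | ⟨h4, _⟩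
    · exact h4
    · exact absurd (h4 ▸ ha) hb'
  -- all edges that cross `X` have the same end outside, so paths between vertices outside can be
  -- shortcut there
  set G := F₁.filter fun e => ∀ v ∈ e, v ∉ X with hG
  have hGm : ∀ {a b}, s(a, b) ∈ G ↔ s(a, b) ∈ F₁ ∧ a ∉ X ∧ b ∉ X := by
    intro a b; simp [hG]
  have hGF : G ⊆ F₁ := filter_subset _ _
  have hreach : ∀ {v}, (graph F₁).Reachable v none → v ∉ X → (graph G).Reachable v none := by
    intro v hv hvX
    refine (of_reachable (P := fun v => (v ∉ X → (graph G).Reachable v none) ∧ (v ∈ X →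
      ∀ a b, s(a, b) ∈ F₁ → a ∈ X → b ∉ X → (graph G).Reachable b none)) ?_ hv
      ⟨fun _ => SimpleGraph.Reachable.refl _, fun h0 => absurd h0 hn⟩).1 hvX
    rintro a b hab ⟨hb1, hb2⟩
    refine ⟨fun haX => ?_, fun haX a' b' hab' ha' hb' => ?_⟩
    · by_cases hbX : b ∈ X
      · exact hb2 hbX b a (Sym2.eq_swap ▸ hab) hbX haX
      · exact (reachable_of_mem (hGm.2 ⟨hab, haX, hbX⟩)).trans (hb1 hbX)
    · by_cases hbX : b ∈ X
      · exact hb2 hbX a' b' hab' ha' hb'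
      · exact huniq hab hab' haX hbX ha' hb' ▸ hb1 hbX
  have hout : ∀ {v}, (graph G).Reachable v none → v ∉ X := fun hv =>
    of_reachable (P := fun v => v ∉ X) (fun a b hab _ => (hGm.1 hab).2.1) hv hn
  have hk : Keeps₁ s G := by
    refine ⟨hGF.trans hp.keeps₁.sub, fun v hv => ?_, fun u v C C' hu hv hC hr => ?_⟩
    · refine hreach (hp.keeps₁.unmarked v hv) fun hvX => ?_
      obtain ⟨L, _, hL⟩ := hX v hvX
      simp [hv] at hL
    · refine hreach (hp.keeps₁.marked u v C C' hu hv hC (hr.mono (graph_mono hGF))) fun hvX => ?_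
      obtain ⟨L, hLX, hL⟩ := hX v hvX
      rw [hv] at hL
      obtain rfl := Option.some.inj hL
      exact hout hr (hLX (hC (h.label_mem hu)))
  have heq := eq_of_subset_of_card_le hGF (hp.min₁ _ hk)
  obtain ⟨v, hvX, hv⟩ := hm
  rw [mem_attached, ← heq] at hv
  exact hout hv hvX

end Final

/-! ### The cost of the pruned forests -/

section Cost

variable {I : Instance T} {s s' t : State T}

theorem Instance.Step.label_mono (hs : I.Step s s') {v : Vertex T} {L : Finset (Vertex T)}
    (hv : s.label v = some L) : s'.label v = some L := by
  cases hs with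
  | case₁ => exact hv
  | case₂ => simp only [State.merge₂]; split_ifs <;> exact hv
  | case₃ => simp [State.deactivate, State.grow, hv]

theorem Instance.Step.F₁_subset (hs : I.Step s s') : s.F₁ ⊆ s'.F₁ := by
  cases hs with
  | case₁ => exact subset_insert _ _
  | case₂ => simp only [State.merge₂]; split_ifs <;> exact Subset.rfl
  | case₃ => exact Subset.rfl

theorem Instance.Step.F₂_subset (hs : I.Step s s') : s.F₂ ⊆ s'.F₂ := by
  cases hs with
  | case₁ => exact Subset.rfl
  | case₂ => simp only [State.merge₂]; split_ifs <;> exact subset_insert _ _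
  | case₃ => exact Subset.rfl

/-- As long as a vertex is unmarked, its component grows; when it is marked, its component becomes
its label. -/
theorem Instance.Step.C₁_or_label (h : Inv I s) (hs : I.Step s s') {v : Vertex T}
    (hv : s.label v = none) {X : Finset (Vertex T)} (hX : X ∈ s.C₁) (hvX : v ∈ X) :
    (s'.label v = none ∧ ∃ X' ∈ s'.C₁, X ⊆ X') ∨ s'.label v = some X := by
  cases hs with
  | case₁ ε Y Z => exact Or.inl ⟨hv, subset_merge Y Z hX⟩
  | case₂ =>
    refine Or.inl ?_
    simp only [State.merge₂]
    split_ifs <;> exact ⟨hv, X, hX, Subset.rfl⟩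
  | case₃ ε Y _ _ _ _ ht =>
    by_cases hXY : X = Y
    · subst hXY
      exact Or.inr (by simp [State.deactivate, State.grow, hv, hvX])
    · have hvY : v ∉ Y := fun hvY => hXY (h.d₁.eq_of_mem hX ht.1 hvX hvY)
      exact Or.inl ⟨by simp [State.deactivate, State.grow, hv, hvY], X, hX, Subset.rfl⟩

theorem Instance.Step.exists_raise (h : Inv I s) (hs : I.Step s s') :
    ∃ ε : ℝ, 0 ≤ ε ∧ (∀ S, s'.Y₁ S = s.Y₁ S + if lift S ∈ s.act₁ then ε else 0) ∧
      ∀ S, s'.Y₂ S = s.Y₂ S + if lift S ∈ s.act₂ then ε else 0 := by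
  cases hs with
  | case₁ ε _ _ _ _ _ hε => exact ⟨ε, h.increment_nonneg hε, Inv.grow_Y₁ s ε, Inv.grow_Y₂ s ε⟩
  | case₂ ε _ _ _ _ _ hε =>
    refine ⟨ε, h.increment_nonneg hε, ?_⟩
    simp only [State.merge₂]
    split_ifs <;> exact ⟨Inv.grow_Y₁ s ε, Inv.grow_Y₂ s ε⟩
  | case₃ ε _ _ hε => exact ⟨ε, h.increment_nonneg hε, Inv.grow_Y₁ s ε, Inv.grow_Y₂ s ε⟩

open Relation in
theorem label_mono (h : ReflTransGen I.Step s t) {v : Vertex T} {L : Finset (Vertex T)}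
    (hv : s.label v = some L) : t.label v = some L := by
  induction h with
  | refl => exact hv
  | tail _ h ih => exact h.label_mono ih

open Relation in
theorem F₁_mono (h : ReflTransGen I.Step s t) : s.F₁ ⊆ t.F₁ := by
  induction h with
  | refl => exact Subset.rfl
  | tail _ h ih => exact ih.trans h.F₁_subset

open Relation in
theorem F₂_mono (h : ReflTransGen I.Step s t) : s.F₂ ⊆ t.F₂ := by
  induction h with
  | refl => exact Subset.rfl
  | tail _ h ih => exact ih.trans h.F₂_subset

open Relation in
/-- The label that an unmarked vertex gets later contains its present component. -/
theorem subset_label (h : ReflTransGen I.Step s t) (hs : Inv I s) {v : Vertex T}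
    (hv : s.label v = none) {L : Finset (Vertex T)} (hL : t.label v = some L)
    {X : Finset (Vertex T)} (hX : X ∈ s.C₁) (hvX : v ∈ X) : X ⊆ L := by
  induction h using ReflTransGen.head_induction_on generalizing X with
  | refl => simp [hv] at hL
  | head h h' ih =>
    rcases h.C₁_or_label hs hv hX hvX with ⟨h1, X', hX', hXX'⟩ | h1
    · exact hXX'.trans (ih (hs.step h) h1 hX' (hXX' hvX))
    · rw [label_mono h' h1] at hL
      exact (Option.some.inj hL).subset

/-- The inductive step of the bound on the cost of a pruned forest: raising the dual variables of
the sets in `Q`, which have average degree at most two. -/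
theorem sum_mul_deg_grow {Q : Finset (Finset (Vertex T))} (hQ : ∀ X ∈ Q, none ∉ X) {ε : ℝ}
    (hε : 0 ≤ ε) {Y Y' : Finset T → ℝ} (hY : ∀ S, Y' S = Y S + if lift S ∈ Q then ε else 0)
    {F : Finset (Edge T)} {P : Finset (Vertex T) → Prop} [DecidablePred P]
    (ih : ∑ S : Finset T, Y S * deg F (lift S) ≤ 2 * ∑ S : Finset T with P (lift S), Y S)
    (hdeg : ∑ X ∈ Q, deg F X ≤ 2 * (Q.filter P).card) :
    ∑ S : Finset T, Y' S * deg F (lift S) ≤ 2 * ∑ S : Finset T with P (lift S), Y' S := by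
  rw [sum_grow hQ hY P, ← sum_filter, sum_const, nsmul_eq_mul]
  have h1 : ∑ S : Finset T, Y' S * deg F (lift S) =
      ∑ S : Finset T, Y S * deg F (lift S) + ε * ∑ X ∈ Q, (deg F X : ℝ) := by
    rw [mul_sum, ← sum_lift hQ, ← sum_add_distrib]
    refine sum_congr rfl fun S _ => ?_
    rw [hY]
    split_ifs <;> ring
  have h2 : (∑ X ∈ Q, (deg F X : ℝ)) ≤ 2 * ((Q.filter P).card : ℝ) := by exact_mod_cast hdeg
  have h3 := mul_le_mul_of_nonneg_left h2 hε
  rw [h1]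
  linarith

/-- The edges of the forest are tight, so their cost can be charged to the sets that they cross. -/
theorem sum_cost_eq {cost : Edge T → ℝ} {F F' : Finset (Edge T)}
    {C : Finset (Finset (Vertex T))} {Y : Finset T → ℝ} {p : Vertex T → ℝ}
    (h : DualInv cost F C Y p) (hF' : F' ⊆ F) :
    ∑ e ∈ F', cost e = ∑ S : Finset T, Y S * deg F' (lift S) := by
  have h1 : ∑ e ∈ F', cost e = ∑ e ∈ F', ∑ S : Finset T, if Crosses (lift S) e then Y S else 0 :=
    sum_congr rfl fun e he => by
      rw [← h.tight e (hF' he), sum_filter]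
      simp only [mem_cut]
  rw [h1, sum_comm]
  refine sum_congr rfl fun S _ => ?_
  rw [← sum_filter, sum_const, nsmul_eq_mul, mul_comm, deg]

variable {F₁ F₂ : Finset (Edge T)}

open Relation in
/-- Inactive components consist of marked vertices, hence are not leaves of the pruned tree, so the
active components have average degree at most two. -/
theorem sum_deg₁_le {k : ℕ} (hr : I.Reached k s) (hst : ReflTransGen I.Step s t)
    (ht : Inv I t) (hp : Pruned t F₁ F₂) :
    ∑ S : Finset T, s.Y₁ S * deg F₁ (lift S) ≤
      2 * ∑ S : Finset T with ∃ v ∈ lift S, v ∈ attached F₁, s.Y₁ S := by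
  induction hr with
  | start => simp [State.start]
  | next k s s' hr hs ih =>
    have h := Inv.of_reached hr
    have hst' := ReflTransGen.head hs hst
    obtain ⟨ε, hε, hY, _⟩ := hs.exists_raise h
    refine sum_mul_deg_grow (fun X => h.none_notMem_act₁) hε hY
      (P := fun X => ∃ v ∈ X, v ∈ attached F₁) (ih hst') ?_
    refine h.d₁.sum_deg_le (F₁_mono hst') ht.d₁.acyclic (fun e he => ht.d₁.not_diag he)
      hp.keeps₁.sub (none_mem_attached F₁) hp.ends₁ (filter_subset _ _) ?_
    intro X hX hXa hn hm
    have h0 : s.active₁ X = 0 := by rw [h.active₁_eq hX, if_neg hXa]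
    refine ht.two_le_deg hp hn (fun v hv => ?_) hm
    obtain ⟨L, hLX, hL⟩ := h.dead hX hn h0 v hv
    exact ⟨L, hLX, label_mono hst' hL⟩

open Relation in
/-- Every component that meets the pruned second tree is active or contains the depot, so the active
components have average degree at most two. -/
theorem sum_deg₂_le {k : ℕ} (hr : I.Reached k s) (hst : ReflTransGen I.Step s t)
    (ht : Inv I t) (hp : Pruned t F₁ F₂) :
    ∑ S : Finset T, s.Y₂ S * deg F₂ (lift S) ≤
      2 * ∑ S : Finset T with lift S ⊆ (attached F₁)ᶜ, s.Y₂ S := by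
  induction hr with
  | start => simp [State.start]
  | next k s s' hr hs ih =>
    have h := Inv.of_reached hr
    have hst' := ReflTransGen.head hs hst
    obtain ⟨ε, hε, _, hY⟩ := hs.exists_raise h
    -- a vertex of `X` that is cut off later is unmarked, since `X` does not contain the depot; the
    -- label that it gets later contains the parent of `X` and is cut off altogether
    have key : ∀ X ∈ s.C₂, none ∉ X → (∃ v ∈ X, v ∈ insert none (attached F₁)ᶜ) →
        X ∈ s.act₂ ∧ X ⊆ (attached F₁)ᶜ := by
      rintro X hX hn ⟨v, hvX, hv⟩
      have hv' : v ∉ attached F₁ := by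
        rcases mem_insert.1 hv with rfl | hv
        · exact absurd hvX hn
        · exact mem_compl.1 hv
      obtain ⟨L, hLB, hL⟩ := ht.label_subset hp.keeps₁ hv'
      have hl : s.label v = none := by
        cases hl : s.label v with
        | none => rfl
        | some L' => exact absurd (h.none_mem_of_label hl hX hvX) hn
      obtain ⟨hD, hXD⟩ := h.parent hX hn
      have hDL := subset_label hst' h hl hL hD (hXD hvX)
      refine ⟨mem_filter.2 ⟨hX, ?_⟩, hXD.trans (hDL.trans hLB)⟩
      rw [h.active₂_eq hX hn hD hXD, if_neg fun hnD => ht.label_none hL (hDL hnD)]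
    refine sum_mul_deg_grow (fun X => h.none_notMem_act₂) hε hY
      (P := fun X => X ⊆ (attached F₁)ᶜ) (ih hst') ?_
    refine (h.d₂.sum_deg_le (R := insert none (attached F₁)ᶜ) (F₂_mono hst') ht.d₂.acyclic
      (fun e he => ht.d₂.not_diag he) hp.keeps₂.sub (mem_insert_self _ _) ?_
      (filter_subset _ _) ?_).trans ?_
    · intro e he
      rw [ht.pruned_eq₂ hp, inside, mem_filter] at he
      exact he.2
    · intro X hX hXa hn hm
      exact absurd (key X hX hn hm).1 hXa
    · refine Nat.mul_le_mul_left _ (card_le_card fun X hX => ?_)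
      obtain ⟨h1, h2⟩ := mem_filter.1 hX
      exact mem_filter.2 ⟨h1, (key X (mem_filter.1 h1).1 (h.none_notMem_act₂ h1) h2).2⟩

theorem dualValue_eq {Y : Finset T → ℝ} (h : Y ∅ = 0) : dualValue Y = 2 * ∑ S : Finset T, Y S := by
  rw [dualValue, sum_filter_of_ne]
  intro S _ hS
  rw [nonempty_iff_ne_empty]
  rintro rfl
  exact hS h

/-- The tree of the first vehicle costs at most twice the dual variables of the sets that meet it,
and the tree of the second vehicle at most twice those of the sets of remaining targets, where the
dual variables of both vehicles have the same sum. -/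
theorem forestCost_le_dualValue {k : ℕ} (hr : I.Reached k t) (hp : Pruned t F₁ F₂) :
    I.forestCost F₁ F₂ ≤ dualValue t.Y₁ := by
  have h := Inv.of_reached hr
  have h1 := sum_deg₁_le hr .refl h hp
  have h2 := sum_deg₂_le hr .refl h hp
  have h3 := h.closed (attached F₁)ᶜ fun v hv => h.label_subset hp.keeps₁ (mem_compl.1 hv)
  rw [Instance.forestCost, sum_cost_eq h.d₁ hp.keeps₁.sub,
    sum_cost_eq h.d₂ hp.keeps₂.sub, dualValue_eq h.d₁.empty]
  have h5 := sum_filter_add_sum_filter_not univ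
    (fun S : Finset T => ∃ v ∈ lift S, v ∈ attached F₁) t.Y₁
  have h4 : (univ.filter fun S : Finset T => ¬ ∃ v ∈ lift S, v ∈ attached F₁) =
      univ.filter fun S : Finset T => lift S ⊆ (attached F₁)ᶜ := by
    ext S
    simp only [mem_filter, mem_univ, true_and, not_exists, not_and, subset_iff, mem_compl]
  rw [h4] at h5
  linarith

theorem sum_nonempty_subset {Y : Finset T → ℝ} (h : Y ∅ = 0) (U : Finset T) :
    ∑ S : Finset T with S.Nonempty ∧ S ⊆ U, Y S = ∑ S : Finset T with lift S ⊆ lift U, Y S := by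
  simp only [lift, map_subset_map]
  rw [sum_filter, sum_filter]
  refine sum_congr rfl fun S _ => ?_
  rcases S.eq_empty_or_nonempty with rfl | hS
  · simp [h]
  · simp [hS]

theorem Inv.dualFeasible (h : Inv I s) : I.DualFeasible s.Y₁ s.Y₂ where
  edge₁ := h.d₁.feas
  edge₂ := h.d₂.feas
  bound U := by
    rw [sum_nonempty_subset h.d₁.empty, sum_nonempty_subset h.d₂.empty]
    exact h.dual _
  nonneg₁ S _ := h.d₁.nonneg S
  nonneg₂ S _ := h.d₂.nonneg S

end Cost

end Pruning

/-! ### Weak duality and the relaxation -/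

section Relaxation

variable {T : Type*} [Fintype T] [DecidableEq T]

theorem mem_edges_of_mem_cut {S : Finset T} {e : Edge T} (h : e ∈ cut S) :
    e ∈ edges T ∧ S.Nonempty := by
  rw [mem_cut] at h
  obtain ⟨a, ha, b, hb, rfl⟩ := h
  refine ⟨mem_edges.2 fun hab => hb (hab ▸ ha), ?_⟩
  obtain ⟨t, ht, _⟩ := mem_map.1 ha
  exact ⟨t, ht⟩

theorem sum_mul_sum_cut (Y : Finset T → ℝ) (x : Edge T → ℝ) :
    ∑ S : Finset T with S.Nonempty, Y S * ∑ e ∈ cut S, x e =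
      ∑ e ∈ edges T, (∑ S : Finset T with e ∈ cut S, Y S) * x e := by
  simp only [mul_sum, sum_mul]
  refine sum_comm' fun S e => ?_
  simp only [mem_filter, mem_univ, true_and]
  exact ⟨fun h => ⟨h.2, (mem_edges_of_mem_cut h.2).1⟩, fun h => ⟨(mem_edges_of_mem_cut h.1).2, h.1⟩⟩

theorem sum_mul_sum_supset (Y z : Finset T → ℝ) :
    ∑ S : Finset T with S.Nonempty, Y S * ∑ U : Finset T with S ⊆ U, z U =
      ∑ U : Finset T, z U * ∑ S : Finset T with S.Nonempty ∧ S ⊆ U, Y S := by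
  simp only [mul_sum]
  rw [sum_comm' (t' := univ) (s' := fun U => univ.filter fun S => S.Nonempty ∧ S ⊆ U)]
  · exact sum_congr rfl fun U _ => sum_congr rfl fun S _ => mul_comm _ _
  · intro S U
    simp

/-- Weak duality. -/
theorem Instance.DualFeasible.le_lpCost {I : Instance T} {Y₁ Y₂ : Finset T → ℝ}
    (h : I.DualFeasible Y₁ Y₂) {x y : Edge T → ℝ} {z : Finset T → ℝ} (hf : LPFeasible x y z) :
    dualValue Y₁ ≤ I.lpCost x y := by
  have h1 : dualValue Y₁ ≤ ∑ S : Finset T with S.Nonempty, Y₁ S * ∑ e ∈ cut S, x e +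
      2 * ∑ S : Finset T with S.Nonempty, Y₁ S * ∑ U : Finset T with S ⊆ U, z U := by
    rw [dualValue, mul_sum, mul_sum, ← sum_add_distrib]
    refine sum_le_sum fun S hS => ?_
    have hS' := (mem_filter.1 hS).2
    have := mul_le_mul_of_nonneg_left (hf.cover S hS') (h.nonneg₁ S hS')
    linarith
  have h2 : 2 * ∑ S : Finset T with S.Nonempty, Y₂ S * ∑ U : Finset T with S ⊆ U, z U ≤
      ∑ S : Finset T with S.Nonempty, Y₂ S * ∑ e ∈ cut S, y e := by
    rw [mul_sum]
    refine sum_le_sum fun S hS => ?_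
    have hS' := (mem_filter.1 hS).2
    have := mul_le_mul_of_nonneg_left (hf.second S hS') (h.nonneg₂ S hS')
    linarith
  have h3 : ∑ S : Finset T with S.Nonempty, Y₁ S * ∑ U : Finset T with S ⊆ U, z U ≤
      ∑ S : Finset T with S.Nonempty, Y₂ S * ∑ U : Finset T with S ⊆ U, z U := by
    rw [sum_mul_sum_supset, sum_mul_sum_supset]
    exact sum_le_sum fun U _ => mul_le_mul_of_nonneg_left (h.bound U) (hf.z_nonneg U)
  rw [sum_mul_sum_cut] at h1 h2
  have h4 : ∑ e ∈ edges T, (∑ S : Finset T with e ∈ cut S, Y₁ S) * x e ≤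
      ∑ e ∈ edges T, I.cost₁ e * x e :=
    sum_le_sum fun e he => mul_le_mul_of_nonneg_right (h.edge₁ e he) (hf.x_nonneg e he)
  have h5 : ∑ e ∈ edges T, (∑ S : Finset T with e ∈ cut S, Y₂ S) * y e ≤
      ∑ e ∈ edges T, I.cost₂ e * y e :=
    sum_le_sum fun e he => mul_le_mul_of_nonneg_right (h.edge₂ e he) (hf.y_nonneg e he)
  rw [Instance.lpCost]
  linarith

/-- The edges between consecutive vertices of a list. -/
def pathEdges : List (Vertex T) → List (Edge T)
  | [] => []
  | [_] => []
  | u :: v :: l => s(u, v) :: pathEdges (v :: l)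

theorem pathEdges_append (l₁ l₂ : List (Vertex T)) (u : Vertex T) :
    pathEdges (l₁ ++ u :: l₂) = pathEdges (l₁ ++ [u]) ++ pathEdges (u :: l₂) := by
  induction l₁ with
  | nil => simp [pathEdges]
  | cons v l ih =>
    cases l with
    | nil => simp [pathEdges]
    | cons w l => simpa [pathEdges] using ih

/-- The edges of a tour; a vehicle that stays at its depot uses none. -/
def tourEdges : List T → List (Edge T)
  | [] => []
  | t :: l => pathEdges (none :: (t :: l).map some ++ [none])

theorem returnCost_eq (c : Edge T → ℝ) (t : T) (l : List T) :
    returnCost c t l = ((pathEdges (some t :: l.map some ++ [none])).map c).sum := by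
  induction l generalizing t with
  | nil => simp [returnCost, pathEdges]
  | cons t' l ih =>
    rw [returnCost, ih]
    simp [pathEdges]

theorem tourCost_eq (c : Edge T → ℝ) (l : List T) :
    tourCost c l = ((tourEdges l).map c).sum := by
  cases l with
  | nil => rfl
  | cons t l =>
    rw [tourCost, returnCost_eq]
    simp [tourEdges, pathEdges]

theorem not_isDiag_pathEdges {l : List T} {t : T} (h : (t :: l).Nodup) :
    ∀ e ∈ pathEdges (some t :: l.map some ++ [none]), ¬ e.IsDiag := by
  induction l generalizing t with
  | nil => simp [pathEdges]
  | cons t' l ih =>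
    intro e he
    simp only [List.map_cons, List.cons_append, pathEdges, List.mem_cons] at he
    rcases he with rfl | he
    · simp only [List.nodup_cons, List.mem_cons, not_or] at h
      simpa using h.1.1
    · exact ih (List.nodup_cons.1 h).2 e (by simpa using he)

theorem tourEdges_subset {l : List T} (h : l.Nodup) : ∀ e ∈ tourEdges l, e ∈ edges T := by
  intro e he
  cases l with
  | nil => simp [tourEdges] at he
  | cons t l =>
    simp only [tourEdges, List.map_cons, List.cons_append, pathEdges, List.mem_cons] at he
    rcases he with rfl | he
    · exact mem_edges.2 (by simp)
    · simpa [edges] using not_isDiag_pathEdges h e (by simpa using he)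

theorem exists_crosses (X : Finset (Vertex T)) (l : List (Vertex T)) (u v : Vertex T)
    (h : ¬ (u ∈ X ↔ v ∈ X)) : ∃ e ∈ pathEdges (u :: l ++ [v]), Crosses X e := by
  induction l generalizing u with
  | nil =>
    refine ⟨s(u, v), by simp [pathEdges], crosses_mk.2 ?_⟩
    tauto
  | cons w l ih =>
    by_cases hw : u ∈ X ↔ w ∈ X
    · obtain ⟨e, he, hc⟩ := ih w (by rwa [← hw])
      exact ⟨e, by simpa [pathEdges] using Or.inr he, hc⟩
    · refine ⟨s(u, w), by simp [pathEdges], crosses_mk.2 ?_⟩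
      tauto

/-- A tour enters and leaves every set that contains one of its targets. -/
theorem two_le_sum_cut {S : Finset T} {l : List T} {a : T} (ha : a ∈ S) (hl : a ∈ l) :
    (2 : ℝ) ≤ ∑ e ∈ cut S, ((tourEdges l).count e : ℝ) := by
  obtain ⟨l₁, l₂, rfl⟩ := List.append_of_mem hl
  have hE : tourEdges (l₁ ++ a :: l₂) = pathEdges (none :: l₁.map some ++ [some a]) ++
      pathEdges (some a :: l₂.map some ++ [none]) := by
    have : tourEdges (l₁ ++ a :: l₂) = pathEdges (none :: (l₁ ++ a :: l₂).map some ++ [none]) := by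
      cases l₁ <;> rfl
    rw [this]
    have := pathEdges_append (none :: l₁.map some) (l₂.map some ++ [none]) (some a)
    simpa using this
  have haS : some a ∈ lift S := mem_map.2 ⟨a, ha, rfl⟩
  have hcut : ∀ {E : List (Edge T)}, (∃ e ∈ E, Crosses (lift S) e) →
      (1 : ℝ) ≤ ∑ e ∈ cut S, (E.count e : ℝ) := by
    rintro E ⟨e, he, hc⟩
    have h1 := single_le_sum (f := fun e => (E.count e : ℝ)) (fun _ _ => Nat.cast_nonneg _)
      (mem_cut.2 hc)
    refine le_trans ?_ h1
    exact_mod_cast List.count_pos_iff.2 he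
  rw [hE]
  simp only [List.count_append, Nat.cast_add, sum_add_distrib]
  have h1 := hcut (exists_crosses (lift S) (l₁.map some) none (some a)
    (by simp [ha]))
  have h2 := hcut (exists_crosses (lift S) (l₂.map some) (some a) none
    (by simp [ha]))
  linarith

theorem sum_edges_count (c : Edge T → ℝ) {l : List T} (h : l.Nodup) :
    ∑ e ∈ edges T, c e * ((tourEdges l).count e : ℝ) = tourCost c l := by
  rw [tourCost_eq, sum_list_map_count, sum_subset (s₁ := (tourEdges l).toFinset) (s₂ := edges T)]
  · refine sum_congr rfl fun e _ => ?_
    rw [nsmul_eq_mul, mul_comm]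
  · intro e he
    exact tourEdges_subset h e (List.mem_toFinset.1 he)
  · intro e _ he
    rw [List.mem_toFinset] at he
    rw [List.count_eq_zero_of_not_mem he, zero_smul]

/-- A pair of tours becomes a feasible point by letting `z` be the indicator of the set of targets
of the second tour. -/
theorem exists_lpFeasible (I : Instance T) {l₁ l₂ : List T} (h : IsTourPair l₁ l₂) :
    ∃ x y z, LPFeasible (T := T) x y z ∧ I.lpCost x y = I.pairCost l₁ l₂ := by
  have hz : ∀ S : Finset T, ∑ U : Finset T with S ⊆ U, (if U = l₂.toFinset then (1 : ℝ) else 0) =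
      if S ⊆ l₂.toFinset then 1 else 0 := by
    intro S
    rw [sum_ite_eq']
    simp
  refine ⟨fun e => (tourEdges l₁).count e, fun e => (tourEdges l₂).count e,
    fun U => if U = l₂.toFinset then 1 else 0, ⟨?_, ?_, ?_, ?_, ?_⟩, ?_⟩
  · intro S hS
    rw [hz]
    split_ifs with hs
    · have : (0 : ℝ) ≤ ∑ e ∈ cut S, ((tourEdges l₁).count e : ℝ) :=
        sum_nonneg fun _ _ => Nat.cast_nonneg _
      linarith
    · obtain ⟨a, ha, hal⟩ := not_subset.1 hs
      have := two_le_sum_cut ha ((List.mem_append.1 (h.2 a)).resolve_right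
        fun hl => hal (List.mem_toFinset.2 hl))
      linarith
  · intro S hS
    rw [hz]
    split_ifs with hs
    · obtain ⟨a, ha⟩ := hS
      have := two_le_sum_cut ha (List.mem_toFinset.1 (hs ha))
      linarith
    · rw [mul_zero]
      exact sum_nonneg fun _ _ => Nat.cast_nonneg _
  · exact fun _ _ => Nat.cast_nonneg _
  · exact fun _ _ => Nat.cast_nonneg _
  · intro U
    split_ifs <;> simp
  · have hn := List.nodup_append.1 h.1
    rw [Instance.lpCost, Instance.pairCost, sum_edges_count _ hn.1, sum_edges_count _ hn.2.1]

theorem exists_isLeast_tourCosts (I : Instance T) : ∃ opt, IsLeast I.tourCosts opt := by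
  have hfin : I.tourCosts.Finite := by
    have hb := List.finite_length_le T (Fintype.card T)
    refine ((hb.prod hb).image fun p => I.pairCost p.1 p.2).subset ?_
    rintro r ⟨l₁, l₂, h, rfl⟩
    have hn := List.nodup_append.1 h.1
    exact ⟨(l₁, l₂), ⟨hn.1.length_le_card, hn.2.1.length_le_card⟩, rfl⟩
  have hne : I.tourCosts.Nonempty :=
    ⟨_, univ.toList, [], ⟨by simpa using nodup_toList _, by simp⟩, rfl⟩
  obtain ⟨r, hr, hmin⟩ := Set.exists_min_image _ id hfin hne
  exact ⟨r, hr, fun r' hr' => hmin r' hr'⟩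

end Relaxation

/-! ### Doubling and shortcutting -/

section Shortcut

variable {T : Type*} [Fintype T] [DecidableEq T]

/-- Length of a list of vertices, where staying at a vertex is free. -/
def pathCost (c : Edge T → ℝ) : List (Vertex T) → ℝ
  | [] => 0
  | [_] => 0
  | u :: v :: l => (if u = v then 0 else c s(u, v)) + pathCost c (v :: l)

theorem pathCost_nonneg {c : Edge T → ℝ} (h0 : ∀ u v, u ≠ v → 0 ≤ c s(u, v))
    (l : List (Vertex T)) : 0 ≤ pathCost c l := by
  induction l with
  | nil => exact le_rfl
  | cons u l ih =>
    cases l with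
    | nil => exact le_rfl
    | cons v l =>
      rw [pathCost]
      split_ifs with h
      · simpa using ih
      · exact add_nonneg (h0 u v h) ih

theorem pathCost_cons_le {c : Edge T → ℝ} (h0 : ∀ u v, u ≠ v → 0 ≤ c s(u, v))
    (h3 : ∀ u v w, u ≠ v → v ≠ w → u ≠ w → c s(u, w) ≤ c s(u, v) + c s(v, w))
    (u v : Vertex T) (l : List (Vertex T)) : pathCost c (u :: l) ≤ pathCost c (u :: v :: l) := by
  cases l with
  | nil => exact pathCost_nonneg h0 _
  | cons w l =>
    simp only [pathCost, ← add_assoc]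
    refine add_le_add_left ?_ _
    by_cases huv : u = v
    · subst huv; simp
    by_cases hvw : v = w
    · subst hvw; simp [huv]
    by_cases huw : u = w
    · subst huw
      simp only [if_true, if_neg huv, if_neg hvw]
      exact add_nonneg (h0 _ _ huv) (h0 _ _ hvw)
    · simp only [if_neg huv, if_neg hvw, if_neg huw]
      exact h3 u v w huv hvw huw

/-- Shortcutting does not increase the cost. -/
theorem pathCost_le_of_sublist {c : Edge T → ℝ} (h0 : ∀ u v, u ≠ v → 0 ≤ c s(u, v))
    (h3 : ∀ u v w, u ≠ v → v ≠ w → u ≠ w → c s(u, w) ≤ c s(u, v) + c s(v, w))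
    {l l' : List (Vertex T)} (h : l.Sublist l') (u : Vertex T) :
    pathCost c (u :: l) ≤ pathCost c (u :: l') := by
  induction h generalizing u with
  | slnil => exact le_rfl
  | cons a _ ih =>
    refine (pathCost_cons_le h0 h3 u a _).trans ?_
    simp only [pathCost]
    exact add_le_add_right (ih a) _
  | cons_cons a _ ih =>
    simp only [pathCost]
    exact add_le_add_right (ih a) _

theorem returnCost_eq_pathCost (c : Edge T → ℝ) {l : List T} {t : T} (h : (t :: l).Nodup) :
    returnCost c t l = pathCost c (some t :: (l.map some ++ [none])) := by
  induction l generalizing t with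
  | nil => simp [returnCost, pathCost]
  | cons t' l ih =>
    have hne : t ≠ t' := by
      simp only [List.nodup_cons, List.mem_cons, not_or] at h
      exact h.1.1
    rw [returnCost, ih (List.nodup_cons.1 h).2]
    simp [pathCost, hne]

theorem tourCost_eq_pathCost (c : Edge T → ℝ) {l : List T} (h : l.Nodup) :
    tourCost c l = pathCost c (none :: (l.map some ++ [none])) := by
  cases l with
  | nil => simp [tourCost, pathCost]
  | cons t l =>
    rw [tourCost, returnCost_eq_pathCost c h]
    simp [pathCost]

theorem pathCost_support (c : Edge T → ℝ) {F : Finset (Edge T)} {u v : Vertex T}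
    (W : (graph F).Walk u v) :
    pathCost c (u :: (W.support ++ [v])) = (W.edges.map c).sum := by
  induction W with
  | nil => simp [pathCost]
  | cons h W ih =>
    rw [SimpleGraph.Walk.support_cons, SimpleGraph.Walk.edges_cons, List.map_cons, List.sum_cons,
      ← ih]
    obtain ⟨S, hS⟩ : ∃ S, W.support = _ :: S := ⟨_, W.cons_tail_support.symm⟩
    rw [hS]
    simp [pathCost, (graph_adj.1 h).2]

theorem sum_edges_of_count_two (c : Edge T → ℝ) {F : Finset (Edge T)} {u v : Vertex T}
    (W : (graph F).Walk u v) (hW : ∀ e ∈ F, W.edges.count e = 2) :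
    (W.edges.map c).sum = 2 * ∑ e ∈ F, c e := by
  have hF : W.edges.toFinset = F := by
    ext e
    rw [List.mem_toFinset]
    refine ⟨fun he => ?_, fun he => List.count_pos_iff.1 (by rw [hW e he]; simp)⟩
    have := W.edges_subset_edgeSet he
    rw [SimpleGraph.edgeSet_fromEdgeSet] at this
    exact this.1
  rw [sum_list_map_count, hF, mul_sum]
  refine sum_congr rfl fun e he => ?_
  rw [hW e he, nsmul_eq_mul]
  norm_num

theorem IsShortcut.tourCost_le {c : Edge T → ℝ} (h0 : ∀ u v, u ≠ v → 0 ≤ c s(u, v))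
    (h3 : ∀ u v w, u ≠ v → v ≠ w → u ≠ w → c s(u, w) ≤ c s(u, v) + c s(v, w))
    {F : Finset (Edge T)} {l : List T} (h : IsShortcut F l) :
    tourCost c l ≤ 2 * ∑ e ∈ F, c e := by
  obtain ⟨W, hW, hn, hs, _⟩ := h
  rw [tourCost_eq_pathCost c hn, ← sum_edges_of_count_two c W hW, ← pathCost_support c W]
  exact pathCost_le_of_sublist h0 h3 (hs.append (List.Sublist.refl [none])) none

/-- A shortcut of a doubled tree visits exactly the targets of the tree. -/
theorem IsShortcut.mem_iff {F : Finset (Edge T)} {A : Finset T} {l : List T}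
    (h : IsShortcut F l) (hF : IsTreeOn F A) (t : T) : t ∈ l ↔ t ∈ A := by
  obtain ⟨W, hW, _, hs, hl⟩ := h
  constructor
  · intro ht
    have h1 : some t ∈ W.support := hs.subset (List.mem_map_of_mem ht)
    have h2 : some t ∈ insertNone A := of_reachable (P := fun v => v ∈ insertNone A)
      (fun a b hab _ => (hF.1 _ hab).2 a (by simp)) (W.dropUntil _ h1).reachable (by simp)
    simpa using h2
  · intro ht
    refine hl t ?_
    obtain ⟨w⟩ := hF.2.connected.preconnected ⟨some t, by simpa using ht⟩ ⟨none, by simp⟩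
    cases w with
    | @cons _ v _ hadj _ =>
      have h1 : s(some t, v.1) ∈ F := (graph_adj.1 (SimpleGraph.comap_adj.1 hadj)).1
      exact W.fst_mem_support_of_mem_edges (List.count_pos_iff.1 (by rw [hW _ h1]; simp))

theorem isTourPair_of_isShortcut {F₁ F₂ : Finset (Edge T)} {l₁ l₂ : List T} (h : IsHSF F₁ F₂)
    (h₁ : IsShortcut F₁ l₁) (h₂ : IsShortcut F₂ l₂) : IsTourPair l₁ l₂ := by
  obtain ⟨A, hA₁, hA₂⟩ := h
  have e₁ := h₁.mem_iff hA₁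
  have e₂ := h₂.mem_iff hA₂
  obtain ⟨_, _, n₁, _⟩ := h₁
  obtain ⟨_, _, n₂, _⟩ := h₂
  refine ⟨List.nodup_append.2 ⟨n₁, n₂, ?_⟩, fun t => ?_⟩
  · rintro a ha b hb rfl
    exact mem_compl.1 ((e₂ a).1 hb) ((e₁ a).1 ha)
  · rw [List.mem_append, e₁, e₂, mem_compl]
    exact em _

/-- Inserting a detour `u, v, u` into a walk. -/
theorem exists_detour {F : Finset (Edge T)} {a b u v : Vertex T} (W : (graph F).Walk a b)
    (huv : (graph F).Adj u v) {S₁ S₂ : List (Vertex T)} (hs : W.support = S₁ ++ u :: S₂) :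
    ∃ W' : (graph F).Walk a b, W'.support = S₁ ++ u :: v :: u :: S₂ ∧
      ∀ e, W'.edges.count e = W.edges.count e + if e = s(u, v) then 2 else 0 := by
  have hc : ∀ (E : List (Edge T)) (e : Edge T), (s(u, v) :: s(v, u) :: E).count e =
      E.count e + if e = s(u, v) then 2 else 0 := by
    intro E e
    rw [Sym2.eq_swap (a := v), List.count_cons, List.count_cons]
    by_cases h : s(u, v) = e
    · simp [h]
    · simp [h, Ne.symm h]
  induction W generalizing S₁ with
  | nil =>
    cases S₁ with
    | nil =>
      simp only [SimpleGraph.Walk.support_nil, List.nil_append, List.cons.injEq] at hs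
      obtain ⟨rfl, rfl⟩ := hs
      refine ⟨.cons huv (.cons huv.symm .nil), by simp, fun e => ?_⟩
      simpa using hc [] e
    | cons x S₁ => simp at hs
  | cons h W ih =>
    cases S₁ with
    | nil =>
      simp only [SimpleGraph.Walk.support_cons, List.nil_append, List.cons.injEq] at hs
      obtain ⟨rfl, rfl⟩ := hs
      refine ⟨.cons huv (.cons huv.symm (.cons h W)), by simp, fun e => ?_⟩
      simpa using hc (SimpleGraph.Walk.cons h W).edges e
    | cons x S₁ =>
      simp only [SimpleGraph.Walk.support_cons, List.cons_append, List.cons.injEq] at hs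
      obtain ⟨rfl, hs⟩ := hs
      obtain ⟨W', h1, h2⟩ := ih hs
      refine ⟨.cons h W', by simp [h1], fun e => ?_⟩
      rw [SimpleGraph.Walk.edges_cons, SimpleGraph.Walk.edges_cons, List.count_cons,
        List.count_cons, h2]
      omega

/-- A tour through part of a tree: `L` lists the vertices of a closed walk from the depot, each
once and in an order in which the walk visits them, and the walk uses each edge twice or never. -/
def PartialTour (F : Finset (Edge T)) (L : List (Vertex T)) : Prop :=
  ∃ W : (graph F).Walk none none, (∀ e, W.edges.count e = 0 ∨ W.edges.count e = 2) ∧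
    L.Nodup ∧ L.Sublist W.support ∧ (∀ v, v ∈ W.support ↔ v ∈ L) ∧ ∃ L', L = none :: L'

theorem PartialTour.start (F : Finset (Edge T)) : PartialTour F [none] :=
  ⟨.nil, by simp, by simp, by simp, by simp, [], rfl⟩

/-- A partial tour is extended by a detour along an edge to a new vertex. -/
theorem PartialTour.extend {F : Finset (Edge T)} {p q : List (Vertex T)} {u v : Vertex T}
    (h : PartialTour F (p ++ u :: q)) (huv : (graph F).Adj u v) (hv : v ∉ p ++ u :: q) :
    PartialTour F (p ++ u :: v :: q) := by
  obtain ⟨W, hW, hn, hs, hm, L', hL'⟩ := h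
  obtain ⟨r₁, r₂, hr, hp, hq'⟩ := List.append_sublist_iff.1 hs
  obtain ⟨r₃, r₄, rfl, hu, hq⟩ := List.cons_sublist_iff.1 hq'
  obtain ⟨s₁, s₂, rfl⟩ := List.append_of_mem hu
  obtain ⟨W', h1, h2⟩ := exists_detour W huv (S₁ := r₁ ++ s₁) (S₂ := s₂ ++ r₄) (by simp [hr])
  have hmem : ∀ w, w ∈ p ++ u :: v :: q ↔ w = v ∨ w ∈ p ++ u :: q := by
    intro w; simp only [List.mem_append, List.mem_cons]; tauto
  refine ⟨W', fun e => ?_, ?_, ?_, fun w => ?_, ?_⟩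
  · rw [h2]
    split_ifs with he
    · have : W.edges.count e = 0 := by
        rw [List.count_eq_zero, he]
        exact fun hmem => hv ((hm v).1 (W.snd_mem_support_of_mem_edges hmem))
      omega
    · exact hW e
  · have : (p ++ u :: v :: q).Perm (v :: (p ++ u :: q)) := by
      have := List.perm_middle (a := v) (l₁ := p ++ [u]) (l₂ := q)
      simpa using this
    rw [this.nodup_iff]
    exact List.nodup_cons.2 ⟨hv, hn⟩
  · rw [h1]
    exact (hp.trans (List.sublist_append_left _ _)).append
      (((hq.trans (List.sublist_append_right _ _)).cons u).cons_cons v |>.cons_cons u)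
  · rw [h1, hmem, ← hm w, hr]
    simp only [List.mem_append, List.mem_cons]
    tauto
  · cases p with
    | nil =>
      simp only [List.nil_append, List.cons.injEq] at hL'
      exact ⟨v :: q, by simp [hL'.1]⟩
    | cons x p =>
      simp only [List.cons_append, List.cons.injEq] at hL'
      exact ⟨p ++ u :: v :: q, by simp [hL'.1]⟩

theorem reachable_of_mem_support {F G : Finset (Edge T)} {a b : Vertex T}
    (W : (graph F).Walk a b) (hW : ∀ e ∈ W.edges, e ∈ G) {v : Vertex T} (hv : v ∈ W.support) :
    (graph G).Reachable v b := by
  induction W generalizing v with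
  | nil =>
    rw [SimpleGraph.Walk.support_nil, List.mem_singleton] at hv
    exact hv ▸ SimpleGraph.Reachable.refl _
  | cons h W ih =>
    rw [SimpleGraph.Walk.edges_cons] at hW
    have hW' : ∀ e ∈ W.edges, e ∈ G := fun e he => hW e (List.mem_cons_of_mem _ he)
    rw [SimpleGraph.Walk.support_cons, List.mem_cons] at hv
    rcases hv with rfl | hv
    · exact (reachable_of_mem (hW _ List.mem_cons_self)).trans (ih hW' W.start_mem_support)
    · exact ih hW' hv

/-- A partial tour that cannot be extended is a shortcut of the doubled tree: an edge of a forest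
that the walk avoids cannot join two vertices of the walk. -/
theorem PartialTour.isShortcut {F : Finset (Edge T)} {l : List T}
    (h : PartialTour F (none :: l.map some)) (hac : (graph F).IsAcyclic)
    (hnd : ∀ e ∈ F, ¬ e.IsDiag) (hF : ∀ e ∈ F, ∀ v ∈ e, (graph F).Reachable v none)
    (hcl : ∀ u ∈ none :: l.map some, ∀ v, s(u, v) ∈ F → v ∈ none :: l.map some) :
    IsShortcut F l := by
  obtain ⟨W, hW, hn, hs, hm, _⟩ := h
  have hall : ∀ v, (graph F).Reachable v none → v ∈ none :: l.map some := fun v hv =>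
    of_reachable (P := fun v => v ∈ none :: l.map some)
      (fun a b hab hb => hcl b hb a (Sym2.eq_swap ▸ hab)) hv List.mem_cons_self
  refine ⟨W, fun e he => (hW e).resolve_left fun h0 => ?_,
    (List.nodup_map_iff (Option.some_injective T)).1 (List.nodup_cons.1 hn).2,
    (List.sublist_cons_self _ _).trans hs, fun t ht => ?_⟩
  · induction e using Sym2.ind with | _ a b =>
    have hr : ∀ v ∈ s(a, b), (graph (F.erase s(a, b))).Reachable v none := by
      intro v hv
      refine reachable_of_mem_support W (fun e' he' => mem_erase.2 ⟨?_, ?_⟩)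
        ((hm v).2 (hall v (hF _ he v hv)))
      · rintro rfl
        exact (List.count_eq_zero.1 h0) he'
      · have := W.edges_subset_edgeSet he'
        rw [SimpleGraph.edgeSet_fromEdgeSet] at this
        exact this.1
    have := mem_of_reachable hac (erase_subset s(a, b) F) he (by simpa using hnd _ he)
      ((hr a (by simp)).trans (hr b (by simp)).symm)
    simp at this
  · have := (hm _).1 ht
    simpa using this

theorem exists_eq_map_some {L : List (Vertex T)} (h : none ∉ L) :
    ∃ l : List T, L = l.map some := by
  induction L with
  | nil => exact ⟨[], rfl⟩
  | cons v L ih =>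
    simp only [List.mem_cons, not_or] at h
    obtain ⟨l, rfl⟩ := ih h.2
    cases v with
    | none => exact absurd rfl h.1
    | some t => exact ⟨t :: l, rfl⟩

theorem PartialTour.exists_list {F : Finset (Edge T)} {L : List (Vertex T)}
    (h : PartialTour F L) : ∃ l : List T, L = none :: l.map some := by
  obtain ⟨_, _, hn, _, _, L', rfl⟩ := h
  obtain ⟨l, rfl⟩ := exists_eq_map_some (List.nodup_cons.1 hn).1
  exact ⟨l, rfl⟩

/-- A partial tour can be extended until no edge leaves it. -/
theorem PartialTour.exists_isShortcut {F : Finset (Edge T)} {L : List (Vertex T)}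
    (h : PartialTour F L) (hac : (graph F).IsAcyclic)
    (hnd : ∀ e ∈ F, ¬ e.IsDiag) (hF : ∀ e ∈ F, ∀ v ∈ e, (graph F).Reachable v none) :
    ∃ l, IsShortcut F l := by
  induction hk : Fintype.card (Vertex T) - L.length using Nat.strong_induction_on generalizing L
      with
  | _ k ih =>
  by_cases hcl : ∀ u ∈ L, ∀ v, s(u, v) ∈ F → v ∈ L
  · obtain ⟨l, rfl⟩ := h.exists_list
    exact ⟨l, h.isShortcut hac hnd hF hcl⟩
  · push Not at hcl
    obtain ⟨u, hu, v, huv, hv⟩ := hcl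
    obtain ⟨p, q, rfl⟩ := List.append_of_mem hu
    have h' := h.extend (graph_adj.2 ⟨huv, by simpa using hnd _ huv⟩) hv
    refine ih _ ?_ h' rfl
    have h1 : (p ++ u :: v :: q).length ≤ Fintype.card (Vertex T) := by
      obtain ⟨_, _, hn, _⟩ := h'
      exact hn.length_le_card
    simp only [List.length_append, List.length_cons] at h1 hk ⊢
    omega

theorem IsTreeOn.reachable {F : Finset (Edge T)} {A : Finset T} (h : IsTreeOn F A) :
    ∀ e ∈ F, ∀ v ∈ e, (graph F).Reachable v none := by
  intro e he v hv
  have := (h.2.connected.preconnected ⟨v, by simpa using (h.1 e he).2 v hv⟩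
    ⟨none, by simp⟩).map (SimpleGraph.Embedding.induce _).toHom
  exact this

theorem Inv.exists_shortcuts {I : Instance T} {s : State T} {F₁ F₂ : Finset (Edge T)}
    (h : Inv I s) (hp : Pruned s F₁ F₂) : ∃ l₁ l₂, IsShortcut F₁ l₁ ∧ IsShortcut F₂ l₂ := by
  obtain ⟨A, h₁, h₂⟩ := h.isHSF hp
  obtain ⟨l₁, hl₁⟩ := (PartialTour.start F₁).exists_isShortcut
    (h.d₁.acyclic.anti (graph_mono hp.keeps₁.sub)) (fun e he => (h₁.1 e he).1) h₁.reachable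
  obtain ⟨l₂, hl₂⟩ := (PartialTour.start F₂).exists_isShortcut
    (h.d₂.acyclic.anti (graph_mono hp.keeps₂.sub)) (fun e he => (h₂.1 e he).1) h₂.reachable
  exact ⟨l₁, l₂, hl₁, hl₂⟩

theorem pairCost_le {I : Instance T} {F₁ F₂ : Finset (Edge T)} {l₁ l₂ : List T}
    (h₁ : IsShortcut F₁ l₁) (h₂ : IsShortcut F₂ l₂) :
    I.pairCost l₁ l₂ ≤ 2 * I.forestCost F₁ F₂ := by
  have e₁ := h₁.tourCost_le I.nonneg₁ I.triangle₁
  have e₂ := h₂.tourCost_le I.nonneg₂ I.triangle₂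
  rw [Instance.pairCost, Instance.forestCost]
  linarith

/-- The guarantees for the tours that the algorithm returns. -/
theorem Instance.Terminal.guarantee {I : Instance T} {s : State T} {F₁ F₂ : Finset (Edge T)}
    (hs : I.Terminal s) (hp : Pruned s F₁ F₂) {opt : ℝ} (hopt : IsLeast I.tourCosts opt) :
    dualValue s.Y₁ ≤ opt ∧ I.forestCost F₁ F₂ ≤ opt ∧
      ∀ l₁ l₂, IsShortcut F₁ l₁ → IsShortcut F₂ l₂ →
        IsTourPair l₁ l₂ ∧ I.pairCost l₁ l₂ ≤ 2 * opt := by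
  obtain ⟨⟨k, hr⟩, hrun⟩ := hs
  have h := Inv.of_reached hr
  have h1 : dualValue s.Y₁ ≤ opt := by
    obtain ⟨m₁, m₂, hm, rfl⟩ := hopt.1
    obtain ⟨x, y, z, hf, he⟩ := exists_lpFeasible I hm
    exact he ▸ h.dualFeasible.le_lpCost hf
  have h2 := (forestCost_le_dualValue hr hp).trans h1
  refine ⟨h1, h2, fun l₁ l₂ hl₁ hl₂ => ⟨isTourPair_of_isShortcut (h.isHSF hp) hl₁ hl₂, ?_⟩⟩
  have := pairCost_le (I := I) hl₁ hl₂
  linarith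

end Shortcut

/-! ### Functions computed in polynomial time -/

section PolyTime

/-- If `f` simulates `g` in at most `t` steps, `Prog.each f` simulates folding `g` over a list. -/
theorem Prog.each_run {a b : Ty} (f : Prog (.prod a b) a) {A B : Type*} (r : A → a.Val)
    (e : B → b.Val) (g : A → B → A) (t : ℕ)
    (h : ∀ x v, (f.run (r x, e v)).1 = r (g x v) ∧ (f.run (r x, e v)).2 ≤ t) (L : List B) (x : A) :
    ((Prog.each f).run (r x, L.map e)).1 = r (L.foldl g x) ∧
      ((Prog.each f).run (r x, L.map e)).2 ≤ L.length * (t + 1) + 1 := by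
  have key : ∀ (L : List B) (x : A) (k : ℕ),
      ((L.map e).foldl (fun (s : a.Val × ℕ) h =>
        ((f.run (s.1, h)).1, s.2 + (f.run (s.1, h)).2 + 1)) (r x, k)).1 = r (L.foldl g x) ∧
      ((L.map e).foldl (fun (s : a.Val × ℕ) h =>
        ((f.run (s.1, h)).1, s.2 + (f.run (s.1, h)).2 + 1)) (r x, k)).2 ≤
        k + L.length * (t + 1) := by
    intro L
    induction L with
    | nil => intro x k; simp
    | cons v L ih =>
      intro x k
      obtain ⟨h1, h2⟩ := h x v
      simp only [List.map_cons, List.foldl_cons, h1]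
      obtain ⟨h3, h4⟩ := ih (g x v) (k + (f.run (r x, e v)).2 + 1)
      refine ⟨h3, h4.trans ?_⟩
      rw [List.length_cons, Nat.succ_mul]
      omega
  obtain ⟨h1, h2⟩ := key L x 1
  exact ⟨h1, h2.trans (by omega)⟩

/-- If `f` simulates `g` in at most `t` steps, `Prog.loop f` simulates iterating `g`. -/
theorem Prog.loop_run {a : Ty} (f : Prog a a) {A : Type*} (r : A → a.Val) (g : A → A) (t : ℕ)
    (h : ∀ x, (f.run (r x)).1 = r (g x) ∧ (f.run (r x)).2 ≤ t) (k : ℕ) (x : A) :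
    ((Prog.loop f).run (r x, k)).1 = r (g^[k] x) ∧
      ((Prog.loop f).run (r x, k)).2 ≤ k * (t + 1) + 1 := by
  have key : ∀ k : ℕ,
      ((fun s : a.Val × ℕ => ((f.run s.1).1, s.2 + (f.run s.1).2 + 1))^[k] (r x, 1)).1 =
        r (g^[k] x) ∧
      ((fun s : a.Val × ℕ => ((f.run s.1).1, s.2 + (f.run s.1).2 + 1))^[k] (r x, 1)).2 ≤
        k * (t + 1) + 1 := by
    intro k
    induction k with
    | zero => simp
    | succ k ih =>
      obtain ⟨h1, h2⟩ := ih
      rw [Function.iterate_succ_apply', Function.iterate_succ_apply', h1]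
      obtain ⟨h3, h4⟩ := h (g^[k] x)
      refine ⟨h3, ?_⟩
      simp only
      rw [Nat.succ_mul]
      omega
  exact key k

/-- Some value of each data type, as a program. -/
def Prog.default {a : Ty} : (b : Ty) → Prog a b
  | .nat => .zero
  | .real => .realZero
  | .prod b c => .pair (Prog.default b) (Prog.default c)
  | .list _ => .nil

theorem Prog.exists_default_le (a b : Ty) :
    ∃ t, ∀ x : a.Val, ((Prog.default b : Prog a b).run x).2 ≤ t := by
  induction b with
  | nat => exact ⟨1, fun x => le_rfl⟩
  | real => exact ⟨1, fun x => le_rfl⟩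
  | list b _ => exact ⟨1, fun x => le_rfl⟩
  | prod b c hb hc =>
    obtain ⟨t, ht⟩ := hb
    obtain ⟨u, hu⟩ := hc
    refine ⟨t + u + 1, fun x => ?_⟩
    have h1 := ht x
    have h2 := hu x
    change _ + _ + 1 ≤ _
    omega

/-- The number that represents a vertex: targets keep their numbers, the depot comes last. -/
def code {n : ℕ} : Vertex (Fin n) → ℕ
  | none => n
  | some i => i

theorem code_injective {n : ℕ} : Function.Injective (code : Vertex (Fin n) → ℕ) := by
  rintro (_ | i) (_ | j) h
  · rfl
  · exact absurd (show n = j from h) (by omega)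
  · exact absurd (show (i : ℕ) = n from h) (by omega)
  · exact congrArg some (Fin.ext h)

/-- The representations of all vertices. -/
def codes (n : ℕ) : List ℕ := (vertexList n).map code

theorem mem_vertexList {n : ℕ} (v : Vertex (Fin n)) : v ∈ vertexList n := by
  cases v <;> simp [vertexList]

theorem length_vertexList (n : ℕ) : (vertexList n).length = n + 1 := by simp [vertexList]

/-- A vertex satisfying `p`, if there is one, and otherwise the last vertex of the list. -/
def pick {n : ℕ} (p : Vertex (Fin n) → Bool) : Vertex (Fin n) :=
  (vertexList n).foldl (fun a v => bif p a then a else v) none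

theorem pick_spec {n : ℕ} {p : Vertex (Fin n) → Bool} (h : ∃ v, p v = true) :
    p (pick p) = true := by
  have key : ∀ (L : List (Vertex (Fin n))) (a : Vertex (Fin n)),
      (p a = true ∨ ∃ v ∈ L, p v = true) →
        p (L.foldl (fun a v => bif p a then a else v) a) = true := by
    intro L
    induction L with
    | nil => intro a ha; simpa using ha
    | cons v L ih =>
      intro a ha
      rw [List.foldl_cons]
      apply ih
      by_cases hp : p a = true
      · exact Or.inl (by simp [hp])
      · rcases ha with ha | ⟨u, hu, hpu⟩
        · exact absurd ha hp
        · rcases List.mem_cons.1 hu with rfl | hu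
          · exact Or.inl (by simp [hp, hpu])
          · exact Or.inr ⟨u, hu, hpu⟩
  obtain ⟨v, hv⟩ := h
  exact key _ _ (Or.inr ⟨v, mem_vertexList v, hv⟩)

theorem foldl_cons_eq {α : Type*} (L : List α) : L.foldl (fun l v => v :: l) [] = L.reverse := by
  rw [List.foldl_flip_cons_eq_append, List.map_id', List.append_nil]

/-- A family of types whose elements are represented by values of the language. All families used
below have values that are bounded in size by a polynomial in `n`, except for lists of vertices,
which programs only build up but never read. -/
class Coded (X : ℕ → Type) where
  /-- the data type of the representations -/
  ty : Ty
  /-- the representation of an element -/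
  enc : ∀ {n}, X n → ty.Val

open Coded

/-- Vertices are represented by their numbers. -/
instance : Coded fun n => Vertex (Fin n) := ⟨.nat, code⟩

/-- Truth values are represented by `1` and `0`, as the tests of the language return them. -/
instance : Coded fun _ => Bool := ⟨.nat, fun b => cond b 1 0⟩

instance : Coded fun _ => ℝ := ⟨.real, fun x => x⟩

instance (X Y : ℕ → Type) [Coded X] [Coded Y] : Coded fun n => X n × Y n :=
  ⟨.prod (ty X) (ty Y), fun x => (enc x.1, enc x.2)⟩

/-- Functions of vertices are represented by the lists of their values, in the order of
`vertexList`. -/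
instance (X : ℕ → Type) [Coded X] : Coded fun n => Vertex (Fin n) → X n :=
  ⟨.list (ty X), fun {n} f => (vertexList n).map fun v => enc (f v)⟩

/-- A list of vertices is represented by the list of their numbers. -/
instance : Coded fun n => List (Vertex (Fin n)) := ⟨.list .nat, fun l => l.map code⟩

variable {X Y Z : ℕ → Type} [Coded X] [Coded Y] [Coded Z]

/-- One program computes `f n` for all `n`, in a number of steps that is polynomial in `n`. It is
given the list of all vertices besides the argument. Instance search derives this property from the
syntax of `f`. -/
class PolyTime (f : ∀ n, X n → Y n) : Prop where
  exists_prog : ∃ (P : Prog (.prod (.list .nat) (ty X)) (ty Y)) (q : Polynomial ℕ),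
    ∀ n (x : X n),
      (P.run (codes n, enc x)).1 = enc (f n x) ∧ (P.run (codes n, enc x)).2 ≤ q.eval n

namespace PolyTime

-- The priorities guide the search through higher-order unification: the rules for the argument and
-- its components apply to few functions and come first, those for reading and forming tables apply
-- to almost all functions and come last.
instance (priority := 3000) id : PolyTime fun n (x : X n) => x :=
  ⟨.snd, 1, fun n x => ⟨rfl, by simp [Prog.run]⟩⟩

theorem comp (g : ∀ n, Y n → Z n) (f : ∀ n, X n → Y n) [hg : PolyTime g] [hf : PolyTime f] :
    PolyTime fun n x => g n (f n x) := by
  obtain ⟨P, p, hP⟩ := hf.exists_prog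
  obtain ⟨Q, q, hQ⟩ := hg.exists_prog
  refine ⟨.comp Q (.pair .fst P), p + q + 3, fun n x => ?_⟩
  obtain ⟨h1, h2⟩ := hP n x
  obtain ⟨h3, h4⟩ := hQ n (f n x)
  simp only [Prog.run, h1, h3, Polynomial.eval_add, Polynomial.eval_ofNat, true_and]
  omega

/-- Applying a single operation of the language. -/
theorem op {g : ∀ n, Y n → Z n} (P : Prog (ty Y) (ty Z))
    (hP : ∀ n (y : Y n), (P.run (enc y)).1 = enc (g n y) ∧ (P.run (enc y)).2 ≤ 1)
    (f : ∀ n, X n → Y n) [hf : PolyTime f] : PolyTime fun n x => g n (f n x) := by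
  obtain ⟨Q, q, hQ⟩ := hf.exists_prog
  refine ⟨.comp P Q, q + 2, fun n x => ?_⟩
  obtain ⟨h1, h2⟩ := hQ n x
  obtain ⟨h3, h4⟩ := hP n (f n x)
  simp only [Prog.run, h1, h3, Polynomial.eval_add, Polynomial.eval_ofNat, true_and]
  omega

instance (priority := 500) pair {f : ∀ n, X n → Y n} {g : ∀ n, X n → Z n} [hf : PolyTime f]
    [hg : PolyTime g] :
    PolyTime fun n x => (f n x, g n x) := by
  obtain ⟨P, p, hP⟩ := hf.exists_prog
  obtain ⟨Q, q, hQ⟩ := hg.exists_prog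
  refine ⟨.pair P Q, p + q + 1, fun n x => ?_⟩
  obtain ⟨h1, h2⟩ := hP n x
  obtain ⟨h3, h4⟩ := hQ n x
  simp only [Prog.run, h1, h3, Polynomial.eval_add, Polynomial.eval_one]
  exact ⟨rfl, by omega⟩

instance (priority := 2000) fst {f : ∀ n, X n → Y n × Z n} [hf : PolyTime f] : PolyTime fun n x =>
    (f n x).1 :=
  op (g := fun _ y => y.1) .fst (fun _ _ => ⟨rfl, le_rfl⟩) f

instance (priority := 2000) snd {f : ∀ n, X n → Y n × Z n} [hf : PolyTime f] : PolyTime fun n x =>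
    (f n x).2 :=
  op (g := fun _ y => y.2) .snd (fun _ _ => ⟨rfl, le_rfl⟩) f

instance const_zero : PolyTime fun n (_ : X n) => (0 : ℝ) :=
  ⟨.realZero, 1, fun n x => ⟨rfl, by simp [Prog.run]⟩⟩

instance const_false : PolyTime fun n (_ : X n) => false :=
  ⟨.zero, 1, fun n x => ⟨rfl, by simp [Prog.run]⟩⟩

instance const_true : PolyTime fun n (_ : X n) => true :=
  ⟨.comp .succ .zero, 3, fun n x => ⟨rfl, by simp [Prog.run]⟩⟩

instance const_depot : PolyTime fun n (_ : X n) => (none : Vertex (Fin n)) := by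
  refine ⟨.comp (.uncons .zero (.comp .fst .snd)) (.pair .fst .fst), 10, fun n x => ⟨rfl, ?_⟩⟩
  rw [Polynomial.eval_ofNat]
  exact Nat.le_of_ble_eq_true rfl

instance const_nil : PolyTime fun n (_ : X n) => ([] : List (Vertex (Fin n))) :=
  ⟨.nil, 1, fun n x => ⟨rfl, by simp [Prog.run]⟩⟩

instance cons {f : ∀ n, X n → Vertex (Fin n)} {g : ∀ n, X n → List (Vertex (Fin n))}
    [hf : PolyTime f] [hg : PolyTime g] : PolyTime fun n x => f n x :: g n x :=
  op (g := fun _ y => y.1 :: y.2) .cons (fun _ _ => ⟨rfl, le_rfl⟩) fun n x => (f n x, g n x)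

instance add {f g : ∀ n, X n → ℝ} [hf : PolyTime f] [hg : PolyTime g] :
    PolyTime fun n x => f n x + g n x :=
  op (g := fun _ y => y.1 + y.2) .add (fun _ _ => ⟨rfl, le_rfl⟩) fun n x => (f n x, g n x)

instance sub {f g : ∀ n, X n → ℝ} [hf : PolyTime f] [hg : PolyTime g] :
    PolyTime fun n x => f n x - g n x :=
  op (g := fun _ y => y.1 - y.2) .sub (fun _ _ => ⟨rfl, le_rfl⟩) fun n x => (f n x, g n x)

instance half {f : ∀ n, X n → ℝ} [hf : PolyTime f] : PolyTime fun n x => f n x / 2 :=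
  op (g := fun _ y => y / 2) .half (fun _ _ => ⟨rfl, le_rfl⟩) f

instance le {f g : ∀ n, X n → ℝ} [hf : PolyTime f] [hg : PolyTime g] :
    PolyTime fun n x => decide (f n x ≤ g n x) := by
  refine op (g := fun _ y => decide (y.1 ≤ y.2)) .realLe (fun n y => ⟨?_, le_rfl⟩)
    fun n x => (f n x, g n x)
  by_cases h : y.1 ≤ y.2
  · rw [decide_eq_true h]; exact if_pos h
  · rw [decide_eq_false h]; exact if_neg h

instance eq {f g : ∀ n, X n → Vertex (Fin n)} [hf : PolyTime f] [hg : PolyTime g] :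
    PolyTime fun n x => decide (f n x = g n x) := by
  refine op (g := fun _ y => decide (y.1 = y.2)) .natEq (fun n y => ⟨?_, le_rfl⟩)
    fun n x => (f n x, g n x)
  by_cases h : y.1 = y.2
  · rw [decide_eq_true h]; exact if_pos (congrArg code h)
  · rw [decide_eq_false h]; exact if_neg fun h' => h (code_injective h')

instance cond (c : ∀ n, X n → Bool) (f g : ∀ n, X n → Y n) [hc : PolyTime c] [hf : PolyTime f]
    [hg : PolyTime g] : PolyTime fun n x => bif c n x then f n x else g n x := by
  obtain ⟨P, p, hP⟩ := hc.exists_prog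
  obtain ⟨Q, q, hQ⟩ := hf.exists_prog
  obtain ⟨R, r, hR⟩ := hg.exists_prog
  refine ⟨.cond P Q R, p + q + r + 1, fun n x => ?_⟩
  obtain ⟨h1, h2⟩ := hP n x
  obtain ⟨h3, h4⟩ := hQ n x
  obtain ⟨h5, h6⟩ := hR n x
  simp only [Prog.run, Polynomial.eval_add, Polynomial.eval_one, h1]
  cases c n x
  · have h7 : @Eq ℕ (enc (X := fun _ => Bool) (n := n) false) 0 := rfl
    rw [if_pos h7]
    exact ⟨h5, by simp only; omega⟩
  · have h7 : ¬ @Eq ℕ (enc (X := fun _ => Bool) (n := n) true) 0 := Nat.one_ne_zero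
    rw [if_neg h7]
    exact ⟨h3, by simp only; omega⟩

instance and {f g : ∀ n, X n → Bool} [hf : PolyTime f] [hg : PolyTime g] :
    PolyTime fun n x => f n x && g n x := by
  have := cond f g fun n (_ : X n) => false
  convert this using 3 with n x
  cases f n x <;> rfl

instance or {f g : ∀ n, X n → Bool} [hf : PolyTime f] [hg : PolyTime g] :
    PolyTime fun n x => f n x || g n x := by
  have := cond f (fun n (_ : X n) => true) g
  convert this using 3 with n x
  cases f n x <;> rfl

instance not {f : ∀ n, X n → Bool} [hf : PolyTime f] : PolyTime fun n x => !f n x := by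
  have := cond f (fun n (_ : X n) => false) fun n (_ : X n) => true
  convert this using 3 with n x
  cases f n x <;> rfl

/-- Running over all vertices, with access to the environment. -/
instance foldl {f : ∀ n, X n → Y n} {g : ∀ n, X n → Y n → Vertex (Fin n) → Y n}
    [hf : PolyTime f]
    [hg : PolyTime fun n (z : X n × (Y n × Vertex (Fin n))) => g n z.1 z.2.1 z.2.2] :
    PolyTime fun n x => (vertexList n).foldl (g n x) (f n x) := by
  obtain ⟨P, p, hP⟩ := hf.exists_prog
  obtain ⟨Q, q, hQ⟩ := hg.exists_prog
  let E : Ty := .prod (.list .nat) (ty X)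
  let body : Prog (.prod (.prod E (ty Y)) .nat) (.prod E (ty Y)) :=
    .pair (.comp .fst .fst) (.comp Q (.pair (.comp .fst (.comp .fst .fst))
      (.pair (.comp .snd (.comp .fst .fst)) (.pair (.comp .snd .fst) .snd))))
  refine ⟨.comp .snd (.comp (.each body) (.pair (.pair .skip P) .fst)),
    (Polynomial.X + 1) * (q + 30) + p + 10, fun n x => ?_⟩
  obtain ⟨h1, h2⟩ := hP n x
  have hb := Prog.each_run body (fun y : Y n => ((codes n, enc x), enc y))
    (code : Vertex (Fin n) → ℕ) (g n x) (q.eval n + 25) (fun y v => by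
      obtain ⟨h3, h4⟩ := hQ n (x, (y, v))
      constructor
      · exact Prod.ext rfl h3
      · change 3 + (17 + (Prog.run Q (codes n, enc (x, (y, v)))).2 + 1) + 1 ≤ _
        omega) (vertexList n) (f n x)
  rw [length_vertexList] at hb
  obtain ⟨h5, h6⟩ := hb
  have hrun : ((Prog.pair (.pair .skip P) .fst).run (codes n, enc x)).1 =
      (((codes n, enc x), enc (f n x)), codes n) := by
    simp only [Prog.run, h1]
  have ht : ((Prog.pair (.pair .skip P) .fst).run (codes n, enc x)).2 ≤ p.eval n + 4 := by
    simp only [Prog.run]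
    omega
  constructor
  · change ((Prog.each body).run ((Prog.pair (.pair .skip P) .fst).run (codes n, enc x)).1).1.2 = _
    rw [hrun]
    exact congrArg Prod.snd h5
  · change _ + ((Prog.each body).run
      ((Prog.pair (.pair .skip P) .fst).run (codes n, enc x)).1).2 + 1 + 1 + 1 ≤ _
    rw [hrun]
    have h7 : ((Prog.each body).run (((codes n, enc x), enc (f n x)), codes n)).2 ≤
      (n + 1) * (q.eval n + 25 + 1) + 1 := h6
    simp only [Polynomial.eval_add, Polynomial.eval_mul, Polynomial.eval_X, Polynomial.eval_one,
      Polynomial.eval_ofNat]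
    nlinarith [ht, h7]

/-- Forming the table of a function of vertices. -/
instance (priority := 200) table {f : ∀ n, X n → Vertex (Fin n) → Y n}
    [hf : PolyTime fun n (z : X n × Vertex (Fin n)) => f n z.1 z.2] :
    PolyTime fun n x => fun v => f n x v := by
  obtain ⟨Q, q, hQ⟩ := hf.exists_prog
  let E : Ty := .prod (.list .nat) (ty X)
  let rev : Prog (.list .nat) (.list .nat) := .comp (.each (.comp .cons (.pair .snd .fst)))
    (.pair .nil .skip)
  let body : Prog (.prod (.prod E (.list (ty Y))) .nat) (.prod E (.list (ty Y))) :=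
    .pair (.comp .fst .fst) (.comp .cons (.pair (.comp Q (.pair (.comp .fst (.comp .fst .fst))
      (.pair (.comp .snd (.comp .fst .fst)) .snd))) (.comp .snd .fst)))
  refine ⟨.comp .snd (.comp (.each body) (.pair (.pair .skip .nil) (.comp rev .fst))),
    (Polynomial.X + 1) * (q + 60) + 60, fun n x => ?_⟩
  have hr := Prog.each_run (.comp .cons (.pair .snd .fst) : Prog (.prod (.list .nat) .nat) _)
    (fun l : List (Vertex (Fin n)) => l.map code) (code : Vertex (Fin n) → ℕ)
    (fun l v => v :: l) 5 (fun l v => ⟨rfl, le_rfl⟩) (vertexList n) []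
  rw [length_vertexList, foldl_cons_eq] at hr
  have hb := Prog.each_run body
    (fun l : List
      (Vertex (Fin n)) => ((codes n, enc x), l.map fun v => (enc (f n x v) : (ty Y).Val)))
    (code : Vertex (Fin n) → ℕ) (fun l v => v :: l) (q.eval n + 30) (fun l v => by
      obtain ⟨h3, h4⟩ := hQ n (x, v)
      constructor
      · exact Prod.ext rfl (congrArg₂ List.cons h3 rfl)
      · change 3 + (13 + (Prog.run Q (codes n, enc (x, v))).2 + 1 + 3 + 1 + 1 + 1) + 1 ≤ _
        omega) (vertexList n).reverse []
  rw [foldl_cons_eq, List.reverse_reverse, List.length_reverse,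
    length_vertexList] at hb
  obtain ⟨h5, h6⟩ := hb
  have hrev : (rev.run (codes n)).1 = (vertexList n).reverse.map code := hr.1
  have hrt : (rev.run (codes n)).2 ≤ (n + 1) * 6 + 5 := by
    change 3 + _ + 1 ≤ _
    have := hr.2
    change ((Prog.each (.comp .cons (.pair .snd .fst) : Prog (.prod (.list .nat) .nat) _)).run
      ([], codes n)).2 ≤ _ at this
    change _ + ((Prog.each (.comp .cons (.pair .snd .fst) : Prog (.prod (.list .nat) .nat) _)).run
      ([], codes n)).2 + 1 ≤ _
    omega
  constructor
  · change ((Prog.each body).run (((codes n, enc x), []), (rev.run (codes n)).1)).1.2 = _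
    rw [hrev]
    exact congrArg Prod.snd h5
  · change (3 + (1 + (rev.run (codes n)).2 + 1) + 1) + ((Prog.each body).run
      (((codes n, enc x), []), (rev.run (codes n)).1)).2 + 1 + 1 + 1 ≤ _
    rw [hrev]
    have h7 : ((Prog.each body).run (((codes n, enc x), []),
      (vertexList n).reverse.map code)).2 ≤ (n + 1) * (q.eval n + 30 + 1) + 1 := h6
    simp only [Polynomial.eval_add, Polynomial.eval_mul, Polynomial.eval_X, Polynomial.eval_one,
      Polynomial.eval_ofNat]
    nlinarith [hrt, h7]

/-- Reading an entry of a table. -/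
instance (priority := 300) app {f : ∀ n, X n → Vertex (Fin n) → Y n} {g : ∀ n, X n → Vertex (Fin n)}
    [hf : PolyTime f] [hg : PolyTime g] : PolyTime fun n x => f n x (g n x) := by
  obtain ⟨P, p, hP⟩ := hf.exists_prog
  obtain ⟨Q, q, hQ⟩ := hg.exists_prog
  -- the result is initialized by an arbitrary value and replaced when the entry is met
  obtain ⟨t, ht⟩ := Prog.exists_default_le (.prod (.list .nat) (ty X)) (ty Y)
  let A : Ty := .prod (.prod .nat (.list .nat)) (ty Y)
  let body : Prog (.prod A (ty Y)) A :=
    .comp (.uncons .fst (.cond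
        (.comp .natEq (.pair (.comp .fst .snd) (.comp .fst (.comp .fst (.comp .fst .fst)))))
        (.pair (.pair (.comp .fst (.comp .fst (.comp .fst .fst))) (.comp .snd .snd))
          (.comp .snd .fst))
        (.pair (.pair (.comp .fst (.comp .fst (.comp .fst .fst))) (.comp .snd .snd))
          (.comp .snd (.comp .fst .fst)))))
      (.pair .skip (.comp .snd (.comp .fst .fst)))
  -- the part of the list of vertices that belongs to the remaining entries is kept in step
  let G : A.Val → (ty Y).Val → A.Val := fun x h =>
    match x.1.2 with
    | [] => x
    | c :: cs => ((x.1.1, cs), if c = x.1.1 then h else x.2)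
  have hbody : ∀ (x : A.Val) (h : (ty Y).Val), (body.run (x, h)).1 = G x h ∧
      (body.run (x, h)).2 ≤ 50 := by
    rintro ⟨⟨v, cs⟩, y⟩ h
    cases cs with
    | nil => exact ⟨rfl, Nat.le_of_ble_eq_true rfl⟩
    | cons c cs =>
      by_cases hc : c = v
      · subst hc
        simp [body, G, Prog.run]
      · simp [body, G, Prog.run, hc]
  refine ⟨.comp .snd (.comp (.each body) (.pair (.pair (.pair Q .fst) (Prog.default _)) P)),
    (Polynomial.X + 1) * 51 + p + q + Polynomial.C t + 20, fun n x => ?_⟩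
  obtain ⟨h1, h2⟩ := hP n x
  obtain ⟨h3, h4⟩ := hQ n x
  have hfold : ∀ (L : List (Vertex (Fin n))) (y : (ty Y).Val),
      ((L.map fun v => (enc (f n x v) : (ty Y).Val)).foldl G ((code (g n x), L.map code), y)).2 =
        if g n x ∈ L then enc (f n x (g n x)) else y := by
    intro L
    induction L with
    | nil => intro y; simp
    | cons u L ih =>
      intro y
      simp only [List.map_cons, List.foldl_cons]
      have hG : G ((code (g n x), code u :: L.map code), y) (enc (f n x u)) =
          ((code (g n x), L.map code), if u = g n x then enc (f n x u) else y) := by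
        simp only [G, code_injective.eq_iff]
      rw [hG, ih]
      by_cases hL : g n x ∈ L
      · simp [hL]
      · by_cases hu : u = g n x
        · subst hu; simp
        · simp [hL, hu, Ne.symm hu]
  have hb := Prog.each_run body (fun y => y) (fun y => y) G 50 hbody
    ((vertexList n).map fun v => (enc (f n x v) : (ty Y).Val))
    ((code (g n x), codes n), ((Prog.default (ty Y) : Prog (.prod (.list .nat) (ty X)) _).run
      (codes n, enc x)).1)
  rw [List.map_id', List.length_map, length_vertexList] at hb
  obtain ⟨h5, h6⟩ := hb
  have hrun : ((Prog.pair (.pair (.pair Q .fst) (Prog.default (ty Y))) P).run (codes n, enc x)).1 =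
      (((code (g n x), codes n), ((Prog.default (ty Y) : Prog (.prod (.list .nat) (ty X)) _).run
        (codes n, enc x)).1),
        (vertexList n).map fun v => (enc (f n x v) : (ty Y).Val)) :=
    congrArg₂ Prod.mk (congrArg₂ Prod.mk (congrArg₂ Prod.mk h3 rfl) rfl) h1
  have hd := ht (codes n, enc x)
  have htime : ((Prog.pair (.pair (.pair Q .fst) (Prog.default (ty Y))) P).run
      (codes n, enc x)).2 ≤ p.eval n + q.eval n + t + 5 := by
    simp only [Prog.run]
    omega
  constructor
  · change ((Prog.each body).run ((Prog.pair (.pair (.pair Q .fst) (Prog.default (ty Y))) P).run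
      (codes n, enc x)).1).1.2 = _
    rw [hrun, h5]
    refine (hfold (vertexList n) _).trans ?_
    rw [if_pos (mem_vertexList _)]
  · change _ + ((Prog.each body).run ((Prog.pair (.pair (.pair Q .fst) (Prog.default (ty Y))) P).run
      (codes n, enc x)).1).2 + 1 + 1 + 1 ≤ _
    rw [hrun]
    simp only [Polynomial.eval_add, Polynomial.eval_mul, Polynomial.eval_X, Polynomial.eval_one,
      Polynomial.eval_ofNat, Polynomial.eval_C]
    omega

/-- Searching for a vertex with a given property. -/
instance pick (p : ∀ n, X n → Vertex (Fin n) → Bool)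
    [PolyTime fun n (z : X n × Vertex (Fin n)) => p n z.1 z.2] :
    PolyTime fun n x => TwoDepot.pick (p n x) := by
  have := comp (fun n x => fun v => p n x v)
    fun n (z : X n × (Vertex (Fin n) × Vertex (Fin n))) => z.1
  unfold TwoDepot.pick
  infer_instance

instance any (p : ∀ n, X n → Vertex (Fin n) → Bool)
    [PolyTime fun n (z : X n × Vertex (Fin n)) => p n z.1 z.2] :
    PolyTime fun n x => decide (∃ v, p n x v = true) := by
  have h : PolyTime fun n x => p n x (TwoDepot.pick fun v => p n x v) := inferInstance
  convert h using 3 with n x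
  by_cases hp : ∃ v, p n x v = true
  · rw [decide_eq_true hp, pick_spec hp]
  · rw [decide_eq_false hp]
    push Not at hp
    exact (Bool.eq_false_iff.2 (hp _)).symm

instance all (p : ∀ n, X n → Vertex (Fin n) → Bool)
    [PolyTime fun n (z : X n × Vertex (Fin n)) => p n z.1 z.2] :
    PolyTime fun n x => decide (∀ v, p n x v = true) := by
  have h : PolyTime fun n x => !decide (∃ v, (!p n x v) = true) := inferInstance
  convert h using 3 with n x
  by_cases hp : ∀ v, p n x v = true
  · simp [hp]
  · rw [decide_eq_false hp]
    push Not at hp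
    simpa using hp

instance sum (f : ∀ n, X n → Vertex (Fin n) → ℝ)
    [PolyTime fun n (z : X n × Vertex (Fin n)) => f n z.1 z.2] :
    PolyTime fun n x => ∑ v, f n x v := by
  have := comp (fun n x => fun v => f n x v) fun n (z : X n × (ℝ × Vertex (Fin n))) => z.1
  have h : PolyTime fun n x => (vertexList n).foldl (fun a v => a + f n x v) 0 := inferInstance
  convert h using 3 with n x
  have key : ∀ (L : List (Vertex (Fin n))) (a : ℝ),
      L.foldl (fun a v => a + f n x v) a = a + (L.map (f n x)).sum := by
    intro L
    induction L with
    | nil => intro a; simp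
    | cons v L ih => intro a; rw [List.foldl_cons, ih, List.map_cons, List.sum_cons, add_assoc]
  rw [key, zero_add, Fintype.sum_option, vertexList, List.map_cons, List.sum_cons, List.map_map,
    Fin.sum_univ_def]
  rfl

/-- Repeating a computation once for each vertex. -/
instance iterate (f : ∀ n, X n → Y n → Y n) (y : ∀ n, X n → Y n) [PolyTime y]
    [PolyTime fun n (z : X n × Y n) => f n z.1 z.2] :
    PolyTime fun n x => (f n x)^[n + 1] (y n x) := by
  have h1 : PolyTime fun n (z : X n × (Y n × Vertex (Fin n))) => f n z.1 z.2.1 :=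
    comp (fun n (z : X n × Y n) => f n z.1 z.2)
      fun n (z : X n × (Y n × Vertex (Fin n))) => (z.1, z.2.1)
  have h : PolyTime fun n x => (vertexList n).foldl (fun y _ => f n x y) (y n x) := foldl
  convert h using 3 with n x
  have key : ∀ (L : List (Vertex (Fin n))) (y : Y n),
      L.foldl (fun y _ => f n x y) y = (f n x)^[L.length] y := by
    intro L
    induction L with
    | nil => intro y; rfl
    | cons v L ih => intro y; rw [List.foldl_cons, ih]; rfl
  rw [key, length_vertexList]

end PolyTime

end PolyTime

/-! ### The procedure on tables -/

section Tables

variable {n : ℕ}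

/-- The state of the main loop as the program stores it: sets of edges and components are relations
between vertices, and labels are given by the membership of vertices in the labels of vertices. -/
structure Tables (n : ℕ) where
  comp₁ : Vertex (Fin n) → Vertex (Fin n) → Bool
  comp₂ : Vertex (Fin n) → Vertex (Fin n) → Bool
  F₁ : Vertex (Fin n) → Vertex (Fin n) → Bool
  F₂ : Vertex (Fin n) → Vertex (Fin n) → Bool
  /-- whether a vertex lies in an active component of the first vehicle -/
  act₁ : Vertex (Fin n) → Bool
  p₁ : Vertex (Fin n) → ℝ
  p₂ : Vertex (Fin n) → ℝ
  /-- The sum over a component of the first vehicle is its bound minus its `w`. -/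
  margin : Vertex (Fin n) → ℝ
  /-- `label u v` means that `u` is marked and `v` belongs to its label. -/
  label : Vertex (Fin n) → Vertex (Fin n) → Bool

/-- The relation that joins the classes of `i` and `j` of the equivalence relation `r`. -/
def joined (r : Vertex (Fin n) → Vertex (Fin n) → Bool) (i j u v : Vertex (Fin n)) : Bool :=
  r u v || ((r u i || r u j) && (r v i || r v j))

/-- The symmetric relation `r` with the pair of `i` and `j` added. -/
def withEdge (r : Vertex (Fin n) → Vertex (Fin n) → Bool) (i j u v : Vertex (Fin n)) : Bool :=
  r u v || ((decide (u = i) && decide (v = j)) || (decide (u = j) && decide (v = i)))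

/-- Whether an edge competes to become tight. -/
def competes (r : Vertex (Fin n) → Vertex (Fin n) → Bool) (a : Vertex (Fin n) → Bool)
    (i j : Vertex (Fin n)) : Bool :=
  !r i j && (a i || a j)

/-- The increase of the dual variables at which a competing edge becomes tight. -/
def tightAt (c : Vertex (Fin n) → Vertex (Fin n) → ℝ) (p : Vertex (Fin n) → ℝ)
    (a : Vertex (Fin n) → Bool) (i j : Vertex (Fin n)) : ℝ :=
  bif a i && a j then (c i j - p i - p j) / 2 else c i j - p i - p j

namespace Tables

/-- The initial tables: every vertex is a component of its own. -/
def start (n : ℕ) : Tables n where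
  comp₁ u v := decide (u = v)
  comp₂ u v := decide (u = v)
  F₁ _ _ := false
  F₂ _ _ := false
  act₁ v := !decide (v = none)
  p₁ _ := 0
  p₂ _ := 0
  margin _ := 0
  label _ _ := false

variable (c : (Vertex (Fin n) → Vertex (Fin n) → ℝ) × (Vertex (Fin n) → Vertex (Fin n) → ℝ))
  (t : Tables n)

/-- Whether a vertex lies in an active component of the second vehicle. -/
def act₂ (v : Vertex (Fin n)) : Bool := !t.comp₂ v none && !t.comp₁ v none

/-- Whether a vertex lies in an active component of the first vehicle without children. -/
def childless (i : Vertex (Fin n)) : Bool :=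
  t.act₁ i && decide (∀ u, (!t.comp₁ i u || t.comp₂ u none) = true)

/-- The margin of the component of `i`. -/
def slack (i : Vertex (Fin n)) : ℝ := ∑ v, bif t.comp₁ i v then t.margin v else 0

/-- Whether no event takes place before the dual variables are increased by `ε`. -/
def earliest (ε : ℝ) : Bool :=
  decide (∀ i, decide (∀ j, (!competes t.comp₁ t.act₁ i j ||
    decide (ε ≤ tightAt c.1 t.p₁ t.act₁ i j)) = true) = true) &&
  (decide (∀ i, decide (∀ j, (!competes t.comp₂ t.act₂ i j ||
    decide (ε ≤ tightAt c.2 t.p₂ t.act₂ i j)) = true) = true) &&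
  decide (∀ i, (!t.childless i || decide (ε ≤ t.slack i)) = true))

/-- Whether an edge of the first vehicle can be chosen in case (1). -/
def eligible₁ (i j : Vertex (Fin n)) : Bool :=
  competes t.comp₁ t.act₁ i j && t.earliest c (tightAt c.1 t.p₁ t.act₁ i j)

/-- Whether an edge of the second vehicle can be chosen in case (2). -/
def eligible₂ (i j : Vertex (Fin n)) : Bool :=
  competes t.comp₂ t.act₂ i j && t.earliest c (tightAt c.2 t.p₂ t.act₂ i j)

/-- Whether the component of a vertex can be chosen in case (3). -/
def eligible₃ (i : Vertex (Fin n)) : Bool := t.childless i && t.earliest c (t.slack i)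

/-- Increase of the dual variables by `ε`. One representative of each component accounts for the
change of the margin that is due to the component. -/
def grow (ε : ℝ) : Tables n :=
  { t with
    p₁ := fun v => bif t.act₁ v then t.p₁ v + ε else t.p₁ v
    p₂ := fun v => bif t.act₂ v then t.p₂ v + ε else t.p₂ v
    margin := fun v => t.margin v +
      (bif t.act₁ v && (t.act₂ v && decide (v = pick (t.comp₂ v))) then ε else 0) -
      (bif t.act₁ v && decide (v = pick (t.comp₁ v)) then ε else 0) }

/-- Adding the edge between `i` and `j` to the first forest. -/
def merge₁ (i j : Vertex (Fin n)) : Tables n :=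
  { t with
    F₁ := withEdge t.F₁ i j
    comp₁ := joined t.comp₁ i j
    act₁ := fun v => bif t.comp₁ v i || t.comp₁ v j then !(t.comp₁ none i || t.comp₁ none j)
      else t.act₁ v }

/-- Adding the edge between `i` and `j` to the second forest. -/
def merge₂ (i j : Vertex (Fin n)) : Tables n :=
  { t with
    F₂ := withEdge t.F₂ i j
    comp₂ := joined t.comp₂ i j }

/-- Deactivating the component of `i` and marking its unmarked vertices. -/
def deactivate (i : Vertex (Fin n)) : Tables n :=
  { t with
    act₁ := fun v => t.act₁ v && !t.comp₁ i v
    label := fun u v => t.label u v || (!t.label u u && (t.comp₁ i u && t.comp₁ i v)) }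

/-- The iteration in case (1), if the component of `i` is one of those to be merged. -/
def iteration₁ (i : Vertex (Fin n)) : Tables n :=
  (t.grow (tightAt c.1 t.p₁ t.act₁ i (pick (t.eligible₁ c i)))).merge₁ i (pick (t.eligible₁ c i))

/-- The iteration in case (2), if the component of `i` is one of those to be merged. -/
def iteration₂ (i : Vertex (Fin n)) : Tables n :=
  (t.grow (tightAt c.2 t.p₂ t.act₂ i (pick (t.eligible₂ c i)))).merge₂ i (pick (t.eligible₂ c i))

/-- The iteration in case (3) for the component of `i`. -/
def iteration₃ (i : Vertex (Fin n)) : Tables n := (t.grow (t.slack i)).deactivate i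

/-- One iteration of the main loop, or nothing after its end. -/
def step : Tables n :=
  bif decide (∃ v, t.act₁ v = true) then
    bif decide (∃ i, decide (∃ j, t.eligible₁ c i j = true) = true) then
      t.iteration₁ c (pick fun i => decide (∃ j, t.eligible₁ c i j = true))
    else bif decide (∃ i, decide (∃ j, t.eligible₂ c i j = true) = true) then
      t.iteration₂ c (pick fun i => decide (∃ j, t.eligible₂ c i j = true))
    else t.iteration₃ (pick (t.eligible₃ c))
  else t

/-- The main loop. Each of the `n + 1` rounds consists of three iterations, so that there are more
than the `3 * n + 2` iterations that the main loop can take. -/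
def final : Tables n := (fun t => (step c (step c (step c t))))^[n + 1] (start n)

end Tables

/-- The vertices that can be reached from a vertex in `A` along `r`. -/
def spread (r : Vertex (Fin n) → Vertex (Fin n) → Bool) (A : Vertex (Fin n) → Bool) :
    Vertex (Fin n) → Bool :=
  (fun A v => A v || decide (∃ u, (A u && r u v) = true))^[n + 1] A

/-- Whether all paths from `u` to the depot pass through `v`. -/
def separates (r : Vertex (Fin n) → Vertex (Fin n) → Bool) (u v : Vertex (Fin n)) : Bool :=
  !spread (fun a b => r a b && (!decide (a = v) && !decide (b = v))) (fun a => decide (a = u)) none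

namespace Tables

variable (t : Tables n)

/-- Whether a pruned forest that connects `u` to the depot has to connect `v` to it as well. -/
def forces (u v : Vertex (Fin n)) : Bool :=
  separates t.F₁ u v || (t.label u u && (t.label v v &&
    decide (∀ a, (!t.label u a || t.label v a) = true)))

/-- The vertices that the pruned forest connects to the depot of the first vehicle. -/
def kept : Vertex (Fin n) → Bool := spread t.forces fun v => !t.label v v

/-- The edges of the pruned first forest. -/
def pruned₁ (u v : Vertex (Fin n)) : Bool := t.F₁ u v && (t.kept u && t.kept v)

/-- The edges of the pruned second forest: those among the remaining targets and the depot. -/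
def pruned₂ (u v : Vertex (Fin n)) : Bool :=
  t.F₂ u v && ((!t.kept u || decide (u = none)) && (!t.kept v || decide (v = none)))

end Tables

/-- Whether `u` is on the tour and has a neighbour that is not. -/
def extensible (r : Vertex (Fin n) → Vertex (Fin n) → Bool)
    (s : (Vertex (Fin n) → Vertex (Fin n)) × (Vertex (Fin n) → Bool)) (u : Vertex (Fin n)) : Bool :=
  s.2 u && decide (∃ v, (r u v && !s.2 v) = true)

/-- Inserting `v` after `u` into a cyclic tour, which is given by the successors of its vertices and
by the set of its vertices. -/
def insertAfter (s : (Vertex (Fin n) → Vertex (Fin n)) × (Vertex (Fin n) → Bool))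
    (u v : Vertex (Fin n)) : (Vertex (Fin n) → Vertex (Fin n)) × (Vertex (Fin n) → Bool) :=
  (fun a => bif decide (a = u) then v else bif decide (a = v) then s.1 u else s.1 a,
    fun a => s.2 a || decide (a = v))

/-- Inserting a neighbour of `u` after `u`. -/
def detour (r : Vertex (Fin n) → Vertex (Fin n) → Bool)
    (s : (Vertex (Fin n) → Vertex (Fin n)) × (Vertex (Fin n) → Bool)) (u : Vertex (Fin n)) :
    (Vertex (Fin n) → Vertex (Fin n)) × (Vertex (Fin n) → Bool) :=
  insertAfter s u (pick fun v => r u v && !s.2 v)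

/-- Extending a tour by one vertex, as long as this is possible. -/
def enlarge (r : Vertex (Fin n) → Vertex (Fin n) → Bool)
    (s : (Vertex (Fin n) → Vertex (Fin n)) × (Vertex (Fin n) → Bool)) :
    (Vertex (Fin n) → Vertex (Fin n)) × (Vertex (Fin n) → Bool) :=
  bif decide (∃ u, extensible r s u = true) then detour r s (pick (extensible r s)) else s

/-- The successor of each vertex on a tour of a tree. -/
def successor (r : Vertex (Fin n) → Vertex (Fin n) → Bool) : Vertex (Fin n) → Vertex (Fin n) :=
  ((enlarge r)^[n + 1] (fun _ => none, fun v => decide (v = none))).1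

/-- One step of listing a cyclic tour: the current vertex is put in front of the list. -/
def advance (f : Vertex (Fin n) → Vertex (Fin n)) (x : Vertex (Fin n) × List (Vertex (Fin n))) :
    Vertex (Fin n) × List (Vertex (Fin n)) :=
  bif decide (x.1 = none) then x else (f x.1, x.1 :: x.2)

/-- The targets on a cyclic tour, in the reverse order. -/
def listing (f : Vertex (Fin n) → Vertex (Fin n)) : List (Vertex (Fin n)) :=
  ((advance f)^[n + 1] (f none, [])).2

/-- The complete procedure, as a function of the costs. -/
def procedure (c : (Vertex (Fin n) → Vertex (Fin n) → ℝ) × (Vertex (Fin n) → Vertex (Fin n) → ℝ)) :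
    List (Vertex (Fin n)) × List (Vertex (Fin n)) :=
  (listing (successor (Tables.final c).pruned₁), listing (successor (Tables.final c).pruned₂))

end Tables

/-! ### The procedure takes polynomial time -/

namespace PolyTime

open Coded

/-- The type of the fields of a state, combined into a nested tuple. -/
abbrev Tuple (n : ℕ) : Type :=
  ((Vertex (Fin n) → Vertex (Fin n) → Bool) × (Vertex (Fin n) → Vertex (Fin n) → Bool)) ×
  ((Vertex (Fin n) → Vertex (Fin n) → Bool) × (Vertex (Fin n) → Vertex (Fin n) → Bool)) ×
  (Vertex (Fin n) → Bool) × (Vertex (Fin n) → ℝ) × (Vertex (Fin n) → ℝ) ×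
  (Vertex (Fin n) → ℝ) × (Vertex (Fin n) → Vertex (Fin n) → Bool)

/-- The fields of a state, as a nested tuple. -/
def _root_.TwoDepot.Tables.tuple {n : ℕ} (t : Tables n) : Tuple n :=
  ((t.comp₁, t.comp₂), (t.F₁, t.F₂), t.act₁, t.p₁, t.p₂, t.margin, t.label)

/-- Tables are represented like the tuple of their fields. -/
instance : Coded Tables := ⟨ty Tuple, fun t => enc (X := Tuple) t.tuple⟩

variable {X : ℕ → Type} [Coded X]

section Fields

variable (t : ∀ n, X n → Tables n) [h : PolyTime t]

instance tuple : PolyTime (Y := Tuple) fun n x => (t n x).tuple := ⟨h.exists_prog⟩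

instance comp₁ : PolyTime fun n x => (t n x).comp₁ :=
  inferInstanceAs (PolyTime fun n x => (t n x).tuple.1.1)

instance comp₂ : PolyTime fun n x => (t n x).comp₂ :=
  inferInstanceAs (PolyTime fun n x => (t n x).tuple.1.2)

instance F₁ : PolyTime fun n x => (t n x).F₁ :=
  inferInstanceAs (PolyTime fun n x => (t n x).tuple.2.1.1)

instance F₂ : PolyTime fun n x => (t n x).F₂ :=
  inferInstanceAs (PolyTime fun n x => (t n x).tuple.2.1.2)

instance act₁ : PolyTime fun n x => (t n x).act₁ :=
  inferInstanceAs (PolyTime fun n x => (t n x).tuple.2.2.1)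

instance p₁ : PolyTime fun n x => (t n x).p₁ :=
  inferInstanceAs (PolyTime fun n x => (t n x).tuple.2.2.2.1)

instance p₂ : PolyTime fun n x => (t n x).p₂ :=
  inferInstanceAs (PolyTime fun n x => (t n x).tuple.2.2.2.2.1)

instance margin : PolyTime fun n x => (t n x).margin :=
  inferInstanceAs (PolyTime fun n x => (t n x).tuple.2.2.2.2.2.1)

instance label : PolyTime fun n x => (t n x).label :=
  inferInstanceAs (PolyTime fun n x => (t n x).tuple.2.2.2.2.2.2)

instance mk_tables (comp₁ comp₂ F₁ F₂ label : ∀ n, X n → Vertex (Fin n) → Vertex (Fin n) → Bool)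
    (act₁ : ∀ n, X n → Vertex (Fin n) → Bool) (p₁ p₂ margin : ∀ n, X n → Vertex (Fin n) → ℝ)
    [PolyTime comp₁] [PolyTime comp₂] [PolyTime F₁] [PolyTime F₂] [PolyTime label]
    [PolyTime act₁] [PolyTime p₁] [PolyTime p₂] [PolyTime margin] :
    PolyTime fun n x => Tables.mk (comp₁ n x) (comp₂ n x) (F₁ n x) (F₂ n x) (act₁ n x) (p₁ n x)
      (p₂ n x) (margin n x) (label n x) :=
  ⟨(inferInstance : PolyTime (Y := Tuple) fun n x => ((comp₁ n x, comp₂ n x), (F₁ n x, F₂ n x),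
    act₁ n x, p₁ n x, p₂ n x, margin n x, label n x)).exists_prog⟩

end Fields

section Operations

-- the instances found for the bodies of definitions are large terms
set_option synthInstance.maxSize 100000

-- For each operation, the search first treats its body as a function of the tuple of all arguments;
-- composition then allows for arbitrary arguments.

instance joined (r : ∀ n, X n → Vertex (Fin n) → Vertex (Fin n) → Bool)
    (i : ∀ n, X n → Vertex (Fin n)) (j : ∀ n, X n → Vertex (Fin n))
    [PolyTime r] [PolyTime i] [PolyTime j] : PolyTime fun n x => TwoDepot.joined (r n x) (i n x)
      (j n x) := by
  have : PolyTime
      fun n (z : (Vertex (Fin n) → Vertex (Fin n) → Bool) × Vertex (Fin n) × Vertex (Fin n)) =>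
        TwoDepot.joined z.1 z.2.1 z.2.2 := by
    unfold TwoDepot.joined
    infer_instance
  exact this.comp _ fun n x => (r n x, i n x, j n x)

instance withEdge (r : ∀ n, X n → Vertex (Fin n) → Vertex (Fin n) → Bool)
    (i : ∀ n, X n → Vertex (Fin n)) (j : ∀ n, X n → Vertex (Fin n))
    [PolyTime r] [PolyTime i] [PolyTime j] : PolyTime fun n x => TwoDepot.withEdge (r n x) (i n x)
      (j n x) := by
  have : PolyTime
      fun n (z : (Vertex (Fin n) → Vertex (Fin n) → Bool) × Vertex (Fin n) × Vertex (Fin n)) =>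
        TwoDepot.withEdge z.1 z.2.1 z.2.2 := by
    unfold TwoDepot.withEdge
    infer_instance
  exact this.comp _ fun n x => (r n x, i n x, j n x)

instance competes (r : ∀ n, X n → Vertex (Fin n) → Vertex (Fin n) → Bool)
    (a : ∀ n, X n → Vertex (Fin n) → Bool) (i : ∀ n, X n → Vertex (Fin n))
      (j : ∀ n, X n → Vertex (Fin n))
    [PolyTime r] [PolyTime a] [PolyTime i] [PolyTime j] : PolyTime fun n x => TwoDepot.competes
      (r n x) (a n x) (i n x) (j n x) := by
  have : PolyTime
      fun n (z : (Vertex (Fin n) → Vertex (Fin n) → Bool) × (Vertex (Fin n) → Bool) × Vertex (Fin n)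
        × Vertex (Fin n)) => TwoDepot.competes z.1 z.2.1 z.2.2.1 z.2.2.2 := by
    unfold TwoDepot.competes
    infer_instance
  exact this.comp _ fun n x => (r n x, a n x, i n x, j n x)

instance tightAt (k : ∀ n, X n → Vertex (Fin n) → Vertex (Fin n) → ℝ)
    (p : ∀ n, X n → Vertex (Fin n) → ℝ) (a : ∀ n, X n → Vertex (Fin n) → Bool)
      (i : ∀ n, X n → Vertex (Fin n)) (j : ∀ n, X n → Vertex (Fin n))
    [PolyTime k] [PolyTime p] [PolyTime a] [PolyTime i] [PolyTime j] : PolyTime fun n x =>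
      TwoDepot.tightAt (k n x) (p n x) (a n x) (i n x) (j n x) := by
  have : PolyTime
      fun n (z : (Vertex (Fin n) → Vertex (Fin n) → ℝ) × (Vertex (Fin n) → ℝ) ×
        (Vertex (Fin n) → Bool) × Vertex (Fin n) × Vertex (Fin n)) => TwoDepot.tightAt z.1 z.2.1
          z.2.2.1 z.2.2.2.1 z.2.2.2.2 := by
    unfold TwoDepot.tightAt
    infer_instance
  exact this.comp _ fun n x => (k n x, p n x, a n x, i n x, j n x)

instance act₂ (t : ∀ n, X n → Tables n)
    [PolyTime t] : PolyTime fun n x => TwoDepot.Tables.act₂ (t n x) := by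
  have : PolyTime fun n (z : Tables n) => TwoDepot.Tables.act₂ z := by
    unfold TwoDepot.Tables.act₂
    infer_instance
  exact this.comp _ fun n x => (t n x)

instance childless (t : ∀ n, X n → Tables n) (i : ∀ n, X n → Vertex (Fin n))
    [PolyTime t] [PolyTime i] : PolyTime fun n x => TwoDepot.Tables.childless (t n x) (i n x) := by
  have : PolyTime fun n (z : Tables n × Vertex (Fin n)) => TwoDepot.Tables.childless z.1 z.2 := by
    unfold TwoDepot.Tables.childless
    infer_instance
  exact this.comp _ fun n x => (t n x, i n x)

instance slack (t : ∀ n, X n → Tables n) (i : ∀ n, X n → Vertex (Fin n))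
    [PolyTime t] [PolyTime i] : PolyTime fun n x => TwoDepot.Tables.slack (t n x) (i n x) := by
  have : PolyTime fun n (z : Tables n × Vertex (Fin n)) => TwoDepot.Tables.slack z.1 z.2 := by
    unfold TwoDepot.Tables.slack
    infer_instance
  exact this.comp _ fun n x => (t n x, i n x)

instance earliest
    (c : ∀ n, X n → (Vertex (Fin n) → Vertex (Fin n) → ℝ) × (Vertex (Fin n) → Vertex (Fin n) → ℝ))
      (t : ∀ n, X n → Tables n) (ε : ∀ n, X n → ℝ)
    [PolyTime c] [PolyTime t] [PolyTime ε] : PolyTime fun n x => TwoDepot.Tables.earliest (c n x)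
      (t n x) (ε n x) := by
  have : PolyTime
      fun n (z : ((Vertex (Fin n) → Vertex (Fin n) → ℝ) × (Vertex (Fin n) → Vertex (Fin n) → ℝ)) ×
        Tables n × ℝ) => TwoDepot.Tables.earliest z.1 z.2.1 z.2.2 := by
    unfold TwoDepot.Tables.earliest
    infer_instance
  exact this.comp _ fun n x => (c n x, t n x, ε n x)

instance eligible₁
    (c : ∀ n, X n → (Vertex (Fin n) → Vertex (Fin n) → ℝ) × (Vertex (Fin n) → Vertex (Fin n) → ℝ))
      (t : ∀ n, X n → Tables n) (i : ∀ n, X n → Vertex (Fin n)) (j : ∀ n, X n → Vertex (Fin n))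
    [PolyTime c] [PolyTime t] [PolyTime i] [PolyTime j] : PolyTime fun n x =>
      TwoDepot.Tables.eligible₁ (c n x) (t n x) (i n x) (j n x) := by
  have : PolyTime
      fun n (z : ((Vertex (Fin n) → Vertex (Fin n) → ℝ) × (Vertex (Fin n) → Vertex (Fin n) → ℝ)) ×
        Tables n × Vertex (Fin n) × Vertex (Fin n)) => TwoDepot.Tables.eligible₁ z.1 z.2.1 z.2.2.1
          z.2.2.2 := by
    unfold TwoDepot.Tables.eligible₁
    infer_instance
  exact this.comp _ fun n x => (c n x, t n x, i n x, j n x)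

instance eligible₂
    (c : ∀ n, X n → (Vertex (Fin n) → Vertex (Fin n) → ℝ) × (Vertex (Fin n) → Vertex (Fin n) → ℝ))
      (t : ∀ n, X n → Tables n) (i : ∀ n, X n → Vertex (Fin n)) (j : ∀ n, X n → Vertex (Fin n))
    [PolyTime c] [PolyTime t] [PolyTime i] [PolyTime j] : PolyTime fun n x =>
      TwoDepot.Tables.eligible₂ (c n x) (t n x) (i n x) (j n x) := by
  have : PolyTime
      fun n (z : ((Vertex (Fin n) → Vertex (Fin n) → ℝ) × (Vertex (Fin n) → Vertex (Fin n) → ℝ)) ×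
        Tables n × Vertex (Fin n) × Vertex (Fin n)) => TwoDepot.Tables.eligible₂ z.1 z.2.1 z.2.2.1
          z.2.2.2 := by
    unfold TwoDepot.Tables.eligible₂
    infer_instance
  exact this.comp _ fun n x => (c n x, t n x, i n x, j n x)

instance eligible₃
    (c : ∀ n, X n → (Vertex (Fin n) → Vertex (Fin n) → ℝ) × (Vertex (Fin n) → Vertex (Fin n) → ℝ))
      (t : ∀ n, X n → Tables n) (i : ∀ n, X n → Vertex (Fin n))
    [PolyTime c] [PolyTime t] [PolyTime i] : PolyTime fun n x => TwoDepot.Tables.eligible₃ (c n x)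
      (t n x) (i n x) := by
  have : PolyTime
      fun n (z : ((Vertex (Fin n) → Vertex (Fin n) → ℝ) × (Vertex (Fin n) → Vertex (Fin n) → ℝ)) ×
        Tables n × Vertex (Fin n)) => TwoDepot.Tables.eligible₃ z.1 z.2.1 z.2.2 := by
    unfold TwoDepot.Tables.eligible₃
    infer_instance
  exact this.comp _ fun n x => (c n x, t n x, i n x)

instance grow (t : ∀ n, X n → Tables n) (ε : ∀ n, X n → ℝ)
    [PolyTime t] [PolyTime ε] : PolyTime fun n x => TwoDepot.Tables.grow (t n x) (ε n x) := by
  have : PolyTime fun n (z : Tables n × ℝ) => TwoDepot.Tables.grow z.1 z.2 := by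
    unfold TwoDepot.Tables.grow
    infer_instance
  exact this.comp _ fun n x => (t n x, ε n x)

instance merge₁ (t : ∀ n, X n → Tables n) (i : ∀ n, X n → Vertex (Fin n))
    (j : ∀ n, X n → Vertex (Fin n))
    [PolyTime t] [PolyTime i] [PolyTime j] : PolyTime fun n x => TwoDepot.Tables.merge₁ (t n x)
      (i n x) (j n x) := by
  have : PolyTime fun n (z : Tables n × Vertex (Fin n) × Vertex (Fin n)) => TwoDepot.Tables.merge₁
      z.1 z.2.1 z.2.2 := by
    unfold TwoDepot.Tables.merge₁
    infer_instance
  exact this.comp _ fun n x => (t n x, i n x, j n x)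

instance merge₂ (t : ∀ n, X n → Tables n) (i : ∀ n, X n → Vertex (Fin n))
    (j : ∀ n, X n → Vertex (Fin n))
    [PolyTime t] [PolyTime i] [PolyTime j] : PolyTime fun n x => TwoDepot.Tables.merge₂ (t n x)
      (i n x) (j n x) := by
  have : PolyTime fun n (z : Tables n × Vertex (Fin n) × Vertex (Fin n)) => TwoDepot.Tables.merge₂
      z.1 z.2.1 z.2.2 := by
    unfold TwoDepot.Tables.merge₂
    infer_instance
  exact this.comp _ fun n x => (t n x, i n x, j n x)

instance deactivate (t : ∀ n, X n → Tables n) (i : ∀ n, X n → Vertex (Fin n))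
    [PolyTime t] [PolyTime i] : PolyTime fun n x => TwoDepot.Tables.deactivate (t n x) (i n x) := by
  have : PolyTime fun n (z : Tables n × Vertex (Fin n)) => TwoDepot.Tables.deactivate z.1 z.2 := by
    unfold TwoDepot.Tables.deactivate
    infer_instance
  exact this.comp _ fun n x => (t n x, i n x)

instance iteration₁
    (c : ∀ n, X n → (Vertex (Fin n) → Vertex (Fin n) → ℝ) × (Vertex (Fin n) → Vertex (Fin n) → ℝ))
      (t : ∀ n, X n → Tables n) (i : ∀ n, X n → Vertex (Fin n))
    [PolyTime c] [PolyTime t] [PolyTime i] : PolyTime fun n x => TwoDepot.Tables.iteration₁ (c n x)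
      (t n x) (i n x) := by
  have : PolyTime
      fun n (z : ((Vertex (Fin n) → Vertex (Fin n) → ℝ) × (Vertex (Fin n) → Vertex (Fin n) → ℝ)) ×
        Tables n × Vertex (Fin n)) => TwoDepot.Tables.iteration₁ z.1 z.2.1 z.2.2 := by
    unfold TwoDepot.Tables.iteration₁
    infer_instance
  exact this.comp _ fun n x => (c n x, t n x, i n x)

instance iteration₂
    (c : ∀ n, X n → (Vertex (Fin n) → Vertex (Fin n) → ℝ) × (Vertex (Fin n) → Vertex (Fin n) → ℝ))
      (t : ∀ n, X n → Tables n) (i : ∀ n, X n → Vertex (Fin n))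
    [PolyTime c] [PolyTime t] [PolyTime i] : PolyTime fun n x => TwoDepot.Tables.iteration₂ (c n x)
      (t n x) (i n x) := by
  have : PolyTime
      fun n (z : ((Vertex (Fin n) → Vertex (Fin n) → ℝ) × (Vertex (Fin n) → Vertex (Fin n) → ℝ)) ×
        Tables n × Vertex (Fin n)) => TwoDepot.Tables.iteration₂ z.1 z.2.1 z.2.2 := by
    unfold TwoDepot.Tables.iteration₂
    infer_instance
  exact this.comp _ fun n x => (c n x, t n x, i n x)

instance iteration₃ (t : ∀ n, X n → Tables n) (i : ∀ n, X n → Vertex (Fin n))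
    [PolyTime t] [PolyTime i] : PolyTime fun n x => TwoDepot.Tables.iteration₃ (t n x) (i n x) := by
  have : PolyTime fun n (z : Tables n × Vertex (Fin n)) => TwoDepot.Tables.iteration₃ z.1 z.2 := by
    unfold TwoDepot.Tables.iteration₃
    infer_instance
  exact this.comp _ fun n x => (t n x, i n x)

instance step
    (c : ∀ n, X n → (Vertex (Fin n) → Vertex (Fin n) → ℝ) × (Vertex (Fin n) → Vertex (Fin n) → ℝ))
      (t : ∀ n, X n → Tables n)
    [PolyTime c] [PolyTime t] : PolyTime fun n x => TwoDepot.Tables.step (c n x) (t n x) := by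
  have : PolyTime
      fun n (z : ((Vertex (Fin n) → Vertex (Fin n) → ℝ) × (Vertex (Fin n) → Vertex (Fin n) → ℝ)) ×
        Tables n) => TwoDepot.Tables.step z.1 z.2 := by
    unfold TwoDepot.Tables.step
    infer_instance
  exact this.comp _ fun n x => (c n x, t n x)

instance start : PolyTime fun n (_ : X n) => Tables.start n := by
  unfold TwoDepot.Tables.start
  infer_instance

instance final
    (c : ∀ n, X n → (Vertex (Fin n) → Vertex (Fin n) → ℝ) × (Vertex (Fin n) → Vertex (Fin n) → ℝ))
    [PolyTime c] : PolyTime fun n x => TwoDepot.Tables.final (c n x) := by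
  have : PolyTime
      fun n (z : ((Vertex (Fin n) → Vertex (Fin n) → ℝ) × (Vertex (Fin n) → Vertex (Fin n) → ℝ))) =>
        TwoDepot.Tables.final z := by
    unfold TwoDepot.Tables.final
    infer_instance
  exact this.comp _ fun n x => (c n x)

instance spread (r : ∀ n, X n → Vertex (Fin n) → Vertex (Fin n) → Bool)
    (a : ∀ n, X n → Vertex (Fin n) → Bool)
    [PolyTime r] [PolyTime a] : PolyTime fun n x => TwoDepot.spread (r n x) (a n x) := by
  have : PolyTime fun n (z : (Vertex (Fin n) → Vertex (Fin n) → Bool) × (Vertex (Fin n) → Bool)) =>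
      TwoDepot.spread z.1 z.2 := by
    unfold TwoDepot.spread
    infer_instance
  exact this.comp _ fun n x => (r n x, a n x)

instance separates (r : ∀ n, X n → Vertex (Fin n) → Vertex (Fin n) → Bool)
    (i : ∀ n, X n → Vertex (Fin n)) (j : ∀ n, X n → Vertex (Fin n))
    [PolyTime r] [PolyTime i] [PolyTime j] : PolyTime fun n x => TwoDepot.separates (r n x) (i n x)
      (j n x) := by
  have : PolyTime
      fun n (z : (Vertex (Fin n) → Vertex (Fin n) → Bool) × Vertex (Fin n) × Vertex (Fin n)) =>
        TwoDepot.separates z.1 z.2.1 z.2.2 := by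
    unfold TwoDepot.separates
    infer_instance
  exact this.comp _ fun n x => (r n x, i n x, j n x)

instance forces (t : ∀ n, X n → Tables n) [PolyTime t] : PolyTime fun n x => (t n x).forces := by
  have : PolyTime fun n (z : Tables n) => fun u v => z.forces u v := by
    unfold TwoDepot.Tables.forces
    infer_instance
  exact this.comp _ t

instance kept (t : ∀ n, X n → Tables n)
    [PolyTime t] : PolyTime fun n x => TwoDepot.Tables.kept (t n x) := by
  have : PolyTime fun n (z : Tables n) => TwoDepot.Tables.kept z := by
    unfold TwoDepot.Tables.kept
    infer_instance
  exact this.comp _ fun n x => (t n x)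

instance pruned₁ (t : ∀ n, X n → Tables n) [PolyTime t] : PolyTime fun n x => (t n x).pruned₁ := by
  have : PolyTime fun n (z : Tables n) => fun u v => z.pruned₁ u v := by
    unfold TwoDepot.Tables.pruned₁
    infer_instance
  exact this.comp _ t

instance pruned₂ (t : ∀ n, X n → Tables n) [PolyTime t] : PolyTime fun n x => (t n x).pruned₂ := by
  have : PolyTime fun n (z : Tables n) => fun u v => z.pruned₂ u v := by
    unfold TwoDepot.Tables.pruned₂
    infer_instance
  exact this.comp _ t

instance extensible (r : ∀ n, X n → Vertex (Fin n) → Vertex (Fin n) → Bool)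
    (s : ∀ n, X n → (Vertex (Fin n) → Vertex (Fin n)) × (Vertex (Fin n) → Bool))
      (i : ∀ n, X n → Vertex (Fin n))
    [PolyTime r] [PolyTime s] [PolyTime i] : PolyTime fun n x => TwoDepot.extensible (r n x) (s n x)
      (i n x) := by
  have : PolyTime
      fun n (z : (Vertex (Fin n) → Vertex (Fin n) → Bool) ×
        ((Vertex (Fin n) → Vertex (Fin n)) × (Vertex (Fin n) → Bool)) × Vertex (Fin n)) =>
          TwoDepot.extensible z.1 z.2.1 z.2.2 := by
    unfold TwoDepot.extensible
    infer_instance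
  exact this.comp _ fun n x => (r n x, s n x, i n x)

instance insertAfter (s : ∀ n, X n → (Vertex (Fin n) → Vertex (Fin n)) × (Vertex (Fin n) → Bool))
    (i : ∀ n, X n → Vertex (Fin n)) (j : ∀ n, X n → Vertex (Fin n))
    [PolyTime s] [PolyTime i] [PolyTime j] : PolyTime fun n x => TwoDepot.insertAfter (s n x)
      (i n x) (j n x) := by
  have : PolyTime
      fun n (z : ((Vertex (Fin n) → Vertex (Fin n)) × (Vertex (Fin n) → Bool)) × Vertex (Fin n) ×
        Vertex (Fin n)) => TwoDepot.insertAfter z.1 z.2.1 z.2.2 := by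
    unfold TwoDepot.insertAfter
    infer_instance
  exact this.comp _ fun n x => (s n x, i n x, j n x)

instance detour (r : ∀ n, X n → Vertex (Fin n) → Vertex (Fin n) → Bool)
    (s : ∀ n, X n → (Vertex (Fin n) → Vertex (Fin n)) × (Vertex (Fin n) → Bool))
      (i : ∀ n, X n → Vertex (Fin n))
    [PolyTime r] [PolyTime s] [PolyTime i] : PolyTime fun n x => TwoDepot.detour (r n x) (s n x)
      (i n x) := by
  have : PolyTime
      fun n (z : (Vertex (Fin n) → Vertex (Fin n) → Bool) ×
        ((Vertex (Fin n) → Vertex (Fin n)) × (Vertex (Fin n) → Bool)) × Vertex (Fin n)) =>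
          TwoDepot.detour z.1 z.2.1 z.2.2 := by
    unfold TwoDepot.detour
    infer_instance
  exact this.comp _ fun n x => (r n x, s n x, i n x)

instance enlarge (r : ∀ n, X n → Vertex (Fin n) → Vertex (Fin n) → Bool)
    (s : ∀ n, X n → (Vertex (Fin n) → Vertex (Fin n)) × (Vertex (Fin n) → Bool))
    [PolyTime r] [PolyTime s] : PolyTime fun n x => TwoDepot.enlarge (r n x) (s n x) := by
  have : PolyTime
      fun n (z : (Vertex (Fin n) → Vertex (Fin n) → Bool) ×
        ((Vertex (Fin n) → Vertex (Fin n)) × (Vertex (Fin n) → Bool))) => TwoDepot.enlarge z.1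
          z.2 := by
    unfold TwoDepot.enlarge
    infer_instance
  exact this.comp _ fun n x => (r n x, s n x)

instance successor (r : ∀ n, X n → Vertex (Fin n) → Vertex (Fin n) → Bool)
    [PolyTime r] : PolyTime fun n x => TwoDepot.successor (r n x) := by
  have : PolyTime fun n (z : Vertex (Fin n) → Vertex (Fin n) → Bool) => TwoDepot.successor z := by
    unfold TwoDepot.successor
    infer_instance
  exact this.comp _ fun n x => (r n x)

instance advance (g : ∀ n, X n → Vertex (Fin n) → Vertex (Fin n))
    (y : ∀ n, X n → Vertex (Fin n) × List (Vertex (Fin n)))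
    [PolyTime g] [PolyTime y] : PolyTime fun n x => TwoDepot.advance (g n x) (y n x) := by
  have : PolyTime
      fun n (z : (Vertex (Fin n) → Vertex (Fin n)) × (Vertex (Fin n) × List (Vertex (Fin n)))) =>
        TwoDepot.advance z.1 z.2 := by
    unfold TwoDepot.advance
    infer_instance
  exact this.comp _ fun n x => (g n x, y n x)

instance listing (g : ∀ n, X n → Vertex (Fin n) → Vertex (Fin n))
    [PolyTime g] : PolyTime fun n x => TwoDepot.listing (g n x) := by
  have : PolyTime fun n (z : Vertex (Fin n) → Vertex (Fin n)) => TwoDepot.listing z := by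
    unfold TwoDepot.listing
    infer_instance
  exact this.comp _ fun n x => (g n x)

instance procedure
    (c : ∀ n, X n → (Vertex (Fin n) → Vertex (Fin n) → ℝ) × (Vertex (Fin n) → Vertex (Fin n) → ℝ))
    [PolyTime c] : PolyTime fun n x => TwoDepot.procedure (c n x) := by
  have : PolyTime
      fun n (z : ((Vertex (Fin n) → Vertex (Fin n) → ℝ) × (Vertex (Fin n) → Vertex (Fin n) → ℝ))) =>
        TwoDepot.procedure z := by
    unfold TwoDepot.procedure
    infer_instance
  exact this.comp _ fun n x => (c n x)

end Operations

/-- The list of all vertices can be set up in linear time, given their number. The numbers are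
counted up while the list grows at its front, so the list has to be reversed afterwards. -/
theorem exists_prog_codes : ∃ P : Prog .nat (.list .nat), ∀ n,
    (P.run n).1 = codes n ∧ (P.run n).2 ≤ 12 * n + 30 := by
  let count : Prog (.prod .nat (.list .nat)) (.prod .nat (.list .nat)) :=
    .pair (.comp .succ .fst) .cons
  let rev : Prog (.list .nat) (.list .nat) := .comp (.each (.comp .cons (.pair .snd .fst)))
    (.pair .nil .skip)
  let init : Prog .nat (.list .nat) := .comp .cons (.pair .skip (.comp rev (.comp .snd
    (.comp (.loop count) (.pair (.pair .zero .nil) .skip)))))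
  refine ⟨init, fun n => ?_⟩
  have h1 := Prog.loop_run count (fun k : ℕ => (k, (List.range k).reverse)) (fun k => k + 1) 5
    (fun k => ⟨by rw [List.range_succ, List.reverse_append]; rfl, le_rfl⟩) n 0
  have h3 : (fun k : ℕ => k + 1)^[n] 0 = n := by
    exact (Nat.succ_iterate 0 n).trans (zero_add n)
  rw [h3] at h1
  have h2 := Prog.each_run (.comp .cons (.pair .snd .fst) : Prog (.prod (.list .nat) .nat) _)
    (fun l : List ℕ => l) (fun k : ℕ => k) (fun l v => v :: l) 5 (fun l v => ⟨rfl, le_rfl⟩)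
    (List.range n).reverse []
  rw [foldl_cons_eq, List.reverse_reverse, List.map_id', List.length_reverse,
    List.length_range] at h2
  have hcodes : codes n = n :: List.range n := by
    rw [codes, vertexList, List.map_cons, List.map_map, ← List.map_coe_finRange_eq_range]
    rfl
  constructor
  · rw [hcodes]
    change n :: (rev.run ((Prog.loop count).run ((0, []), n)).1.2).1 = _
    refine congrArg (List.cons n) ?_
    rw [show ((Prog.loop count).run ((0, []), n)).1 = (n, (List.range n).reverse) from h1.1]
    exact h2.1
  · change (1 + (((5 + ((Prog.loop count).run ((0, []), n)).2 + 1) + 1 + 1) +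
      (3 + ((Prog.each (.comp .cons (.pair .snd .fst) : Prog (.prod (.list .nat) .nat) _)).run
        ([], ((Prog.loop count).run ((0, []), n)).1.2)).2 + 1) + 1) + 1) + 1 + 1 ≤ _
    rw [show ((Prog.loop count).run ((0, []), n)).1 = (n, (List.range n).reverse) from h1.1]
    have h4 : ((Prog.loop count).run ((0, []), n)).2 ≤ n * 6 + 1 := h1.2
    have h5 := h2.2
    simp only at h5 ⊢
    omega

/-- A function of the two cost tables that takes polynomial time is computed by a program from the
description of an instance: the list of all vertices can be set up at the beginning. -/
theorem exists_prog_input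
    (f : ∀ n, ((Vertex (Fin n) → Vertex (Fin n) → ℝ) × (Vertex (Fin n) → Vertex (Fin n) → ℝ)) →
      List (Vertex (Fin n)) × List (Vertex (Fin n))) [hf : PolyTime f] :
    ∃ (P : Prog inputTy outputTy) (q : Polynomial ℕ), ∀ (n : ℕ) (I : Instance (Fin n)),
      (P.run I.input).1
        = ((f n (fun u v => I.cost₁ s(u, v), fun u v => I.cost₂ s(u, v))).1.map code,
        (f n (fun u v => I.cost₁ s(u, v), fun u v => I.cost₂ s(u, v))).2.map code) ∧
      (P.run I.input).2 ≤ q.eval n := by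
  obtain ⟨Q, q, hQ⟩ := hf.exists_prog
  obtain ⟨init, hinit⟩ := exists_prog_codes
  refine ⟨.comp Q (.pair (.comp init .fst) .snd), q + 12 * Polynomial.X + 40, fun n I => ?_⟩
  obtain ⟨hrev, htime⟩ := hinit n
  obtain ⟨h4, h5⟩ := hQ n (fun u v => I.cost₁ s(u, v), fun u v => I.cost₂ s(u, v))
  have hrun : (Prog.run (.pair (.comp init .fst) .snd : Prog inputTy _) I.input).1 = (codes n, enc
      (X := fun n => (Vertex (Fin n) → Vertex (Fin n) → ℝ) × (Vertex (Fin n) → Vertex (Fin n) → ℝ))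
      (fun u v => I.cost₁ s(u, v), fun u v => I.cost₂ s(u, v))) :=
    Prod.ext hrev rfl
  constructor
  · change (Q.run (Prog.run (.pair (.comp init .fst) .snd : Prog inputTy _) I.input).1).1 = _
    rw [hrun, h4]
    rfl
  · change ((1 + (init.run n).2 + 1) + 1 + 1) +
      (Q.run (Prog.run (.pair (.comp init .fst) .snd : Prog inputTy _) I.input).1).2 + 1 ≤ _
    rw [hrun]
    simp only [Polynomial.eval_add, Polynomial.eval_mul, Polynomial.eval_X, Polynomial.eval_ofNat]
    omega

end PolyTime

/-! ### Closures and tours on tables -/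

section TableSpec

/-- Iterating a map that increases a bounded quantity whenever it changes its argument leads to a
fixed point. -/
theorem iterate_fixed {σ : Type*} {f : σ → σ} {Q : σ → Prop} {μ : σ → ℕ} {N : ℕ}
    (hQ : ∀ x, Q x → Q (f x)) (hN : ∀ x, Q x → μ x ≤ N) (hμ : ∀ x, Q x → f x = x ∨ μ x < μ (f x))
    {x : σ} (hx : Q x) {k : ℕ} (hk : N ≤ k) : Q (f^[k] x) ∧ f (f^[k] x) = f^[k] x := by
  have hQk : ∀ k, Q (f^[k] x) := by
    intro k
    induction k with
    | zero => exact hx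
    | succ k ih => rw [Function.iterate_succ_apply']; exact hQ _ ih
  have key : ∀ k, f (f^[k] x) = f^[k] x ∨ k < μ (f^[k + 1] x) := by
    intro k
    induction k with
    | zero =>
      rcases hμ x hx with h | h
      · exact Or.inl h
      · exact Or.inr (by simpa using Nat.zero_lt_of_lt h)
    | succ k ih =>
      rcases ih with h | h
      · refine Or.inl ?_
        rw [Function.iterate_succ_apply', h, h]
      · rcases hμ _ (hQk (k + 1)) with h' | h'
        · exact Or.inl h'
        · refine Or.inr ?_
          rw [Function.iterate_succ_apply' f (k + 1)]
          omega
  refine ⟨hQk k, (key k).resolve_right fun h => ?_⟩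
  have := hN _ (hQk (k + 1))
  omega

variable {n : ℕ}

theorem card_filter_vertex_le (A : Vertex (Fin n) → Bool) :
    (univ.filter fun v => A v = true).card ≤ n + 1 :=
  (card_le_univ _).trans (by simp)

theorem card_filter_lt {A B : Vertex (Fin n) → Bool} (hAB : ∀ v, A v = true → B v = true)
    (h : ∃ v, B v = true ∧ A v = false) :
    (univ.filter fun v => A v = true).card < (univ.filter fun v => B v = true).card := by
  obtain ⟨v, hB, hA⟩ := h
  refine card_lt_card ⟨fun u hu => ?_, fun hs => ?_⟩
  · simp only [mem_filter, mem_univ, true_and] at hu ⊢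
    exact hAB u hu
  · have := hs (mem_filter.2 ⟨mem_univ v, hB⟩)
    simp [hA] at this

open Relation in
/-- As many rounds as there are vertices suffice to find everything that can be reached. -/
theorem spread_eq_true {r : Vertex (Fin n) → Vertex (Fin n) → Bool} {A : Vertex (Fin n) → Bool}
    {v : Vertex (Fin n)} : spread r A v = true ↔
      ∃ u, A u = true ∧ ReflTransGen (fun a b => r a b = true) u v := by
  obtain ⟨g, hspread, hg⟩ : ∃ g : (Vertex (Fin n) → Bool) → Vertex (Fin n) → Bool,
      spread r A = g^[n + 1] A ∧
        ∀ B v, g B v = true ↔ B v = true ∨ ∃ u, B u = true ∧ r u v = true :=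
    ⟨_, rfl, by simp⟩
  have hmono : ∀ (B : Vertex (Fin n) → Bool) v, B v = true → g B v = true :=
    fun B v hv => (hg B v).2 (Or.inl hv)
  rw [hspread]
  constructor
  · have : ∀ k v, g^[k] A v = true → ∃ u, A u = true ∧ ReflTransGen (fun a b => r a b = true) u
      v := by
      intro k
      induction k with
      | zero => exact fun v hv => ⟨v, hv, .refl⟩
      | succ k ih =>
        intro v hv
        rw [Function.iterate_succ_apply'] at hv
        rw [hg] at hv
        rcases hv with hv | ⟨w, hw, hwv⟩
        · exact ih v hv
        · obtain ⟨u, hu, huw⟩ := ih w hw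
          exact ⟨u, hu, huw.tail hwv⟩
    exact this _ v
  · rintro ⟨u, hu, huv⟩
    obtain ⟨hu', hfix⟩ := iterate_fixed (f := g) (Q := fun B => B u = true)
      (μ := fun B => (univ.filter fun v => B v = true).card) (N := n + 1)
      (fun B hB => hmono B u hB) (fun B _ => card_filter_vertex_le B) (fun B _ => by
        by_cases h : ∃ v, g B v = true ∧ B v = false
        · exact Or.inr (card_filter_lt (hmono B) h)
        · push Not at h
          exact Or.inl (funext fun v => Bool.eq_iff_iff.2
            ⟨fun hv => by simpa using h v hv, hmono B v⟩)) hu (le_refl (n + 1))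
    induction huv with
    | refl => exact hu'
    | tail _ hab ih =>
      rw [← hfix, hg]
      exact Or.inr ⟨_, ih, hab⟩

/-! ### Tours as tables of successors -/

theorem isChain_append_congr {α : Type*} {f g : α → α} {x : α} {q : List α}
    (h : ∀ a ∈ q, f a = g a) (hq : (q ++ [x]).IsChain fun a b => f a = b) :
    (q ++ [x]).IsChain fun a b => g a = b := by
  induction q with
  | nil => simp
  | cons a q ih =>
    rw [List.cons_append, List.isChain_cons] at hq ⊢
    exact ⟨fun b hb => (h a List.mem_cons_self).symm.trans (hq.1 b hb),
      ih (fun b hb => h b (List.mem_cons_of_mem _ hb)) hq.2⟩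

/-- Inserting `v` after `u` in the table of successors inserts it after `u` in the tour. -/
theorem isChain_insertAfter {s : (Vertex (Fin n) → Vertex (Fin n)) × (Vertex (Fin n) → Bool)}
    {u v x : Vertex (Fin n)} {p q : List (Vertex (Fin n))} (hn : (p ++ u :: q).Nodup)
    (hv : v ∉ p ++ u :: q) (h : (p ++ u :: (q ++ [x])).IsChain fun a b => s.1 a = b) :
    (p ++ u :: v :: (q ++ [x])).IsChain fun a b => (insertAfter s u v).1 a = b := by
  have hne : ∀ a, a ≠ u → a ≠ v → (insertAfter s u v).1 a = s.1 a := by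
    intro a hu hv; simp [insertAfter, hu, hv]
  have huv : u ≠ v := by rintro rfl; simp at hv
  induction p with
  | nil =>
    simp only [List.nil_append] at h hn hv ⊢
    rw [List.isChain_cons] at h
    rw [List.isChain_cons_cons, List.isChain_cons]
    refine ⟨by simp [insertAfter], fun b hb => ?_, ?_⟩
    · rw [← h.1 b hb]; simp [insertAfter, huv.symm]
    · refine isChain_append_congr (f := s.1) (fun a ha => (hne a ?_ ?_).symm) h.2
      · rintro rfl; exact (List.nodup_cons.1 hn).1 ha
      · rintro rfl; exact hv (List.mem_cons_of_mem _ ha)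
  | cons a p ih =>
    simp only [List.cons_append, List.nodup_cons, List.mem_cons, not_or] at h hn hv ⊢
    rw [List.isChain_cons] at h ⊢
    refine ⟨fun b hb => ?_, ih hn.2 hv.2 h.2⟩
    rw [hne a (by rintro rfl; exact hn.1 (by simp)) (Ne.symm hv.1)]
    exact h.1 b (by cases p <;> exact hb)

/-- Listing a cyclic tour from the depot yields its targets in the reverse order. -/
theorem listing_eq {f : Vertex (Fin n) → Vertex (Fin n)} {M : List (Vertex (Fin n))}
    (hM : none ∉ M) (hn : M.Nodup) (h : (none :: (M ++ [none])).IsChain fun a b => f a = b) :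
    listing f = M.reverse := by
  have key : ∀ (M : List (Vertex (Fin n))) (y : Vertex (Fin n)) (acc : List (Vertex (Fin n)))
      (k : ℕ),
      none ∉ M → (y :: (M ++ [none])).IsChain (fun a b => f a = b) → M.length ≤ k →
        ((advance f)^[k] (f y, acc)).2 = M.reverse ++ acc := by
    intro M
    induction M with
    | nil =>
      intro y acc k _ h _
      have hy : f y = none := by simpa using h
      rw [hy, Function.iterate_fixed (by simp [advance])]
      rfl
    | cons m M ih =>
      intro y acc k hM h hk
      rw [List.cons_append, List.isChain_cons_cons] at h
      obtain ⟨k, rfl⟩ := Nat.exists_eq_succ_of_ne_zero (n := k) (by rintro rfl; simp at hk)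
      have hm : m ≠ none := by rintro rfl; simp at hM
      rw [Function.iterate_succ_apply, h.1, advance, decide_eq_false hm, cond_false,
        ih m (m :: acc) k (fun h => hM (List.mem_cons_of_mem _ h)) h.2 (by simpa using hk)]
      simp
  rw [listing, key M none [] (n + 1) hM h, List.append_nil]
  have := hn.length_le_card
  simpa using this

/-- The reverse of a shortcut is a shortcut: the closed walk can be traversed backwards. -/
theorem IsShortcut.reverse {T : Type*} [Fintype T] [DecidableEq T] {F : Finset (Edge T)}
    {l : List T}
    (h : IsShortcut F l) : IsShortcut F l.reverse := by
  obtain ⟨W, hW, hn, hs, hm⟩ := h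
  refine ⟨W.reverse, fun e he => ?_, List.nodup_reverse.2 hn, ?_, fun t ht => ?_⟩
  · rw [SimpleGraph.Walk.edges_reverse, List.count_reverse, hW e he]
  · rw [SimpleGraph.Walk.support_reverse, List.map_reverse]
    exact hs.reverse
  · rw [SimpleGraph.Walk.support_reverse, List.mem_reverse] at ht
    exact List.mem_reverse.2 (hm t ht)

/-- The tour computed from the adjacency table of a tree is a shortcut of the doubled tree. -/
theorem exists_isShortcut_listing {r : Vertex (Fin n) → Vertex (Fin n) → Bool}
    {F : Finset (Edge (Fin n))} (hr : ∀ u v, r u v = true ↔ s(u, v) ∈ F)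
    (hac : (graph F).IsAcyclic) (hnd : ∀ e ∈ F, ¬ e.IsDiag)
    (hF : ∀ e ∈ F, ∀ v ∈ e, (graph F).Reachable v none) :
    ∃ l : List (Fin n), IsShortcut F l ∧ listing (successor r) = l.map some := by
  -- the tables describe a partial tour, which is enlarged until no edge leaves it
  let Q : (Vertex (Fin n) → Vertex (Fin n)) × (Vertex (Fin n) → Bool) → Prop := fun s =>
    ∃ L, PartialTour F L ∧ (L ++ [none]).IsChain (fun a b => s.1 a = b) ∧ ∀ v, s.2 v = true ↔ v ∈ L
  have hext : ∀ s, (∃ u, extensible r s u = true) → ∃ u v, s.2 u = true ∧ s.2 v = false ∧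
      r u v = true ∧ enlarge r s = insertAfter s u v := by
    intro s hs
    have h1 := pick_spec hs
    rw [enlarge, decide_eq_true hs, cond_true, detour]
    set u := pick (extensible r s)
    simp only [extensible, Bool.and_eq_true, decide_eq_true_eq] at h1
    have h2 := pick_spec (p := fun v => r u v && !s.2 v) (by simpa using h1.2)
    simp only [Bool.and_eq_true, Bool.not_eq_true'] at h2
    exact ⟨u, _, h1.1, h2.2, h2.1, rfl⟩
  have hstuck : ∀ s, (¬ ∃ u, extensible r s u = true) → enlarge r s = s := by
    intro s hs
    rw [enlarge, decide_eq_false hs, cond_false]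
  obtain ⟨⟨L, hL, hc, hm⟩, hfix⟩ := iterate_fixed (f := enlarge r) (Q := Q)
    (μ := fun s => (univ.filter fun v => s.2 v = true).card) (N := n + 1)
    (x := (fun _ => none, fun v => decide (v = none))) (k := n + 1) (by
      rintro s ⟨L, hL, hc, hm⟩
      by_cases hs : ∃ u, extensible r s u = true
      · obtain ⟨u, v, hu, hv, huv, he⟩ := hext s hs
        rw [hm] at hu
        have hv' : v ∉ L := by rw [← hm, hv]; simp
        obtain ⟨p, q, rfl⟩ := List.append_of_mem hu
        have hne : u ≠ v := by rintro rfl; exact hv' hu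
        have hnodup : (p ++ u :: q).Nodup := by obtain ⟨_, _, hn, _⟩ := hL; exact hn
        rw [he]
        refine ⟨p ++ u :: v :: q, hL.extend (graph_adj.2 ⟨(hr u v).1 huv, hne⟩) hv', ?_, fun w =>
          ?_⟩
        · have := isChain_insertAfter (x := none) (q := q) hnodup hv' (by simpa using hc)
          simpa using this
        · simp only [insertAfter, Bool.or_eq_true, hm, decide_eq_true_eq, List.mem_append,
            List.mem_cons]
          tauto
      · rw [hstuck s hs]; exact ⟨L, hL, hc, hm⟩)
    (fun s _ => card_filter_vertex_le s.2) (by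
      intro s _
      by_cases hs : ∃ u, extensible r s u = true
      · obtain ⟨u, v, hu, hv, huv, he⟩ := hext s hs
        rw [he]
        exact Or.inr (card_filter_lt (fun w hw => by simp [insertAfter, hw])
          ⟨v, by simp [insertAfter], hv⟩)
      · exact Or.inl (hstuck s hs))
    ⟨[none], PartialTour.start F, by simp, by simp⟩ le_rfl
  obtain ⟨l, rfl⟩ := hL.exists_list
  have hnodup : (none :: l.map some).Nodup := by obtain ⟨_, _, hn, _⟩ := hL; exact hn
  refine ⟨l.reverse, IsShortcut.reverse (hL.isShortcut hac hnd hF fun u hu v huv => ?_), ?_⟩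
  · by_contra hv
    have hs : ∃ u, extensible r ((enlarge r)^[n + 1] (fun _ => none, fun v => decide (v = none))) u
      =
        true := by
      refine ⟨u, ?_⟩
      simp only [extensible, Bool.and_eq_true, decide_eq_true_eq, Bool.not_eq_true']
      refine ⟨(hm u).2 hu, v, (hr u v).2 huv, ?_⟩
      rw [Bool.eq_false_iff]
      exact fun h => hv ((hm v).1 h)
    obtain ⟨u', v', hu', hv', _, he⟩ := hext _ hs
    rw [hfix] at he
    rw [he] at hv'
    simp [insertAfter] at hv'
  · rw [List.map_reverse]
    exact listing_eq (List.nodup_cons.1 hnodup).1 (List.nodup_cons.1 hnodup).2 hc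

end TableSpec

/-! ### Correctness of pruning on tables -/

section PruneSpec

variable {n : ℕ}

/-- The tables `t` describe the state `s`. -/
structure Sim (t : Tables n) (s : State (Fin n)) : Prop where
  comp₁ : ∀ u v, t.comp₁ u v = true ↔ ∃ X ∈ s.C₁, u ∈ X ∧ v ∈ X
  comp₂ : ∀ u v, t.comp₂ u v = true ↔ ∃ X ∈ s.C₂, u ∈ X ∧ v ∈ X
  F₁ : ∀ u v, t.F₁ u v = true ↔ s(u, v) ∈ s.F₁
  F₂ : ∀ u v, t.F₂ u v = true ↔ s(u, v) ∈ s.F₂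
  act₁ : ∀ v, t.act₁ v = true ↔ ∃ X ∈ s.C₁, s.active₁ X = 1 ∧ v ∈ X
  p₁ : t.p₁ = s.p₁
  p₂ : t.p₂ = s.p₂
  margin : ∀ X ∈ s.C₁, ∑ v ∈ X, t.margin v = s.bound X - s.w X
  label : ∀ u v, t.label u v = true ↔ ∃ L, s.label u = some L ∧ v ∈ L

/-- The vertices that pruning keeps connected to the depot of the first vehicle. -/
def Tables.keptSet (t : Tables n) : Finset (Vertex (Fin n)) := univ.filter fun v => t.kept v = true

theorem Tables.mem_keptSet {t : Tables n} {v : Vertex (Fin n)} :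
    v ∈ t.keptSet ↔ t.kept v = true := by simp [keptSet]

theorem reachable_inside_of_walk {T : Type*} [Fintype T] [DecidableEq T] {F : Finset (Edge T)}
    {B : Finset (Vertex T)} {a b : Vertex T} (W : (graph F).Walk a b) (h : ∀ v ∈ W.support, v ∈ B) :
    (graph (inside F B)).Reachable a b := by
  induction W with
  | nil => exact SimpleGraph.Reachable.refl _
  | cons hab W ih =>
    refine (reachable_of_mem
      (mem_inside.2 ⟨(graph_adj.1 hab).1, h _ (by simp), h _ (by simp)⟩)).trans
      (ih fun v hv => h v (by simp [hv]))

variable {I : Instance (Fin n)} {s : State (Fin n)} {t : Tables n}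

theorem Sim.label_self (hs : Sim t s) (h : Inv I s) (v : Vertex (Fin n)) :
    t.label v v = true ↔ ∃ L, s.label v = some L :=
  (hs.label v v).trans ⟨fun ⟨L, hL, _⟩ => ⟨L, hL⟩, fun ⟨L, hL⟩ => ⟨L, hL, h.label_mem hL⟩⟩

theorem Sim.forces_label (hs : Sim t s) (h : Inv I s) {u v : Vertex (Fin n)}
    {L L' : Finset (Vertex (Fin n))} (hu : s.label u = some L) (hv : s.label v = some L') :
    (t.label u u && (t.label v v && decide (∀ a, (!t.label u a || t.label v a) = true))) = true ↔
      L ⊆ L' := by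
  simp only [Bool.and_eq_true, hs.label_self h, decide_eq_true_eq, Bool.or_eq_true,
    Bool.not_eq_true', ← Bool.not_eq_true, hs.label, hu, hv, Option.some.injEq, exists_eq_left',
    exists_eq', true_and]
  exact forall_congr' fun a => by tauto

theorem Sim.kept_none (hs : Sim t s) (h : Inv I s) : t.kept none = true := by
  refine spread_eq_true.2 ⟨none, ?_, .refl⟩
  rw [Bool.not_eq_true', ← Bool.not_eq_true, hs.label_self h]
  rintro ⟨L, hL⟩
  exact h.label_none hL (h.label_mem hL)

theorem Sim.kept_of_forces {u v : Vertex (Fin n)} (hu : t.kept u = true)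
    (huv : t.forces u v = true) : t.kept v = true := by
  obtain ⟨w, hw, hwu⟩ := spread_eq_true.1 hu
  exact spread_eq_true.2 ⟨w, hw, hwu.tail huv⟩

open Relation in
/-- A vertex does not separate another one from the depot if some path avoids it. -/
theorem Sim.separates_eq_false (hs : Sim t s) {u v : Vertex (Fin n)} :
    separates t.F₁ u v = false ↔ ReflTransGen (fun a b => s(a, b) ∈ s.F₁ ∧ a ≠ v ∧ b ≠ v) u
      none := by
  rw [separates, Bool.not_eq_false', spread_eq_true]
  simp only [decide_eq_true_eq, exists_eq_left, Bool.and_eq_true, hs.F₁, Bool.not_eq_true',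
    decide_eq_false_iff_not]

/-- Every admissible subforest connects the kept vertices to the depot: it contains the unmarked
vertices, is closed under the condition on labels, and its paths are paths of the forest. -/
theorem Sim.kept_subset (hs : Sim t s) (h : Inv I s) {G : Finset (Edge (Fin n))} (hG : Keeps₁ s G) :
    t.keptSet ⊆ attached G := by
  intro v hv
  obtain ⟨u, hu, huv⟩ := spread_eq_true.1 (Tables.mem_keptSet.1 hv)
  induction huv with
  | refl =>
    rw [Bool.not_eq_true', ← Bool.not_eq_true, hs.label_self h] at hu
    exact mem_attached.2 (hG.unmarked _ (by
      cases hl : s.label u with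
      | none => rfl
      | some L => exact absurd ⟨L, hl⟩ hu))
  | @tail a b _ hab ih =>
    have ha := ih (Tables.mem_keptSet.2 (spread_eq_true.2 ⟨u, hu, by assumption⟩))
    by_contra hb
    rw [Tables.forces, Bool.or_eq_true] at hab
    rcases hab with hab | hab
    · have key := of_reachable (F := G) (P := fun w => w ∈ attached G ∧
        Relation.ReflTransGen (fun x y => s(x, y) ∈ s.F₁ ∧ x ≠ b ∧ y ≠ b) w none)
        (fun x y hxy hy => by
          have hx : x ∈ attached G :=
            mem_attached.2 ((reachable_of_mem hxy).trans (mem_attached.1 hy.1))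
          exact ⟨hx, .head ⟨hG.sub hxy, fun e => hb (e ▸ hx), fun e => hb (e ▸ hy.1)⟩ hy.2⟩)
        (mem_attached.1 ha) ⟨none_mem_attached G, .refl⟩
      rw [hs.separates_eq_false.2 key.2] at hab
      exact Bool.false_ne_true hab
    · have hab' := hab
      simp only [Bool.and_eq_true, hs.label_self h] at hab'
      obtain ⟨⟨L, hL⟩, ⟨L', hL'⟩, _⟩ := hab'
      exact hb (mem_attached.2 (hG.marked a b L L' hL hL' ((hs.forces_label h hL hL').1 hab)
        (mem_attached.1 ha)))

/-- The kept vertices are connected to the depot among themselves: the next vertex on the path from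
a kept vertex to the depot separates it from the depot, and therefore is kept too. -/
theorem Sim.reachable_of_kept (hs : Sim t s) (h : Inv I s) (hrun : ¬ s.Running) {v : Vertex (Fin n)}
    (hv : v ∈ t.keptSet) : (graph (inside s.F₁ t.keptSet)).Reachable v none := by
  have hr : (graph s.F₁).Reachable v none := mem_attached.1 (hs.kept_subset h (h.keeps₁ hrun) hv)
  obtain ⟨p, hp⟩ := hr.exists_isPath
  have key : ∀ {v w} (p : (graph s.F₁).Walk v w), w = none → p.IsPath → v ∈ t.keptSet →
      (graph (inside s.F₁ t.keptSet)).Reachable v none := by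
    intro v w p
    induction p with
    | nil => rintro rfl _ _; exact SimpleGraph.Reachable.refl _
    | @cons x y w hxy p ih =>
      intro hw hp hx
      subst hw
      rw [SimpleGraph.Walk.cons_isPath_iff] at hp
      have hmem := (graph_adj.1 hxy).1
      by_cases hy : y ∈ t.keptSet
      · exact (reachable_of_mem (mem_inside.2 ⟨hmem, hx, hy⟩)).trans (ih rfl hp.1 hy)
      · -- the edge `s(x, y)` would lie on a cycle
        exfalso
        have hsep : separates t.F₁ x y = false := by
          rw [Bool.eq_false_iff]
          exact fun hsep => hy (Tables.mem_keptSet.2 (Sim.kept_of_forces (Tables.mem_keptSet.1 hx)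
            (by rw [Tables.forces, hsep, Bool.true_or])))
        have h1 : (graph (s.F₁.erase s(x, y))).Reachable x none := by
          have key : ∀ z, Relation.ReflTransGen (fun a b => s(a, b) ∈ s.F₁ ∧ a ≠ y ∧ b ≠ y) z none →
              (graph (s.F₁.erase s(x, y))).Reachable z none := by
            intro z hz
            induction hz using Relation.ReflTransGen.head_induction_on with
            | refl => exact SimpleGraph.Reachable.refl _
            | head hab _ ih' =>
              refine (reachable_of_mem (mem_erase.2 ⟨?_, hab.1⟩)).trans ih'
              intro he
              rw [Sym2.eq_iff] at he
              rcases he with ⟨_, he⟩ | ⟨he, _⟩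
              · exact hab.2.2 he
              · exact hab.2.1 he
          exact key x (hs.separates_eq_false.1 hsep)
        have h2 : (graph (s.F₁.erase s(x, y))).Reachable y none := by
          refine (reachable_inside_of_walk (B := {x}ᶜ) p fun v hv => ?_).mono
            (graph_mono fun e he => ?_)
          · rw [mem_compl, mem_singleton]
            rintro rfl
            exact hp.2 hv
          · refine mem_erase.2 ⟨?_, inside_subset _ _ he⟩
            rintro rfl
            exact absurd (mem_inside.1 he).2.1 (by simp)
        have := mem_of_reachable h.d₁.acyclic (erase_subset s(x, y) s.F₁) hmem (graph_adj.1 hxy).2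
          (h1.trans h2.symm)
        exact (notMem_erase _ _) this
  exact key p rfl hp hv

theorem Sim.attached_inside (hs : Sim t s) (h : Inv I s) (hrun : ¬ s.Running) :
    attached (inside s.F₁ t.keptSet) = t.keptSet := by
  refine Subset.antisymm (fun v hv => ?_)
    fun v hv => mem_attached.2 (hs.reachable_of_kept h hrun hv)
  exact of_reachable (P := fun v => v ∈ t.keptSet) (fun a b hab _ => (mem_inside.1 hab).2.1)
    (mem_attached.1 hv) (Tables.mem_keptSet.2 (hs.kept_none h))

theorem Sim.keeps₁ (hs : Sim t s) (h : Inv I s) (hrun : ¬ s.Running) :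
    Keeps₁ s (inside s.F₁ t.keptSet) where
  sub := inside_subset _ _
  unmarked v hv := by
    refine hs.reachable_of_kept h hrun (Tables.mem_keptSet.2 (spread_eq_true.2 ⟨v, ?_, .refl⟩))
    rw [Bool.not_eq_true', ← Bool.not_eq_true, hs.label_self h, hv]
    simp
  marked u v L L' hu hv hL hr := by
    rw [← mem_attached, hs.attached_inside h hrun] at hr ⊢
    refine Tables.mem_keptSet.2 (Sim.kept_of_forces (Tables.mem_keptSet.1 hr) ?_)
    rw [Tables.forces, Bool.or_eq_true]
    exact Or.inr ((hs.forces_label h hu hv).2 hL)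

/-- The kept vertices induce a least admissible subforest, because in a forest the edge between two
vertices connected to the depot is needed. -/
theorem Sim.pruned (hs : Sim t s) (h : Inv I s) (hrun : ¬ s.Running) :
    Pruned s (inside s.F₁ t.keptSet) (inside s.F₂ (insert none t.keptSetᶜ)) := by
  have hk := h.keeps₂_inside (hs.keeps₁ h hrun)
  have hsub := fun G (hG : Keeps₂ s (inside s.F₁ t.keptSet) G) => h.inside_subset_of_keeps₂ hG
  rw [hs.attached_inside h hrun] at hk hsub
  refine ⟨hs.keeps₁ h hrun, fun G hG => card_le_card fun e he => ?_, hk,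
    fun G hG => card_le_card (hsub G hG)⟩
  induction e using Sym2.ind with | _ a b =>
  obtain ⟨hab, ha, hb⟩ := mem_inside.1 he
  have ha' := mem_attached.1 (hs.kept_subset h hG ha)
  have hb' := mem_attached.1 (hs.kept_subset h hG hb)
  exact mem_of_reachable h.d₁.acyclic hG.sub hab
    (fun hne => h.d₁.not_diag hab (by rw [hne]; exact Sym2.diag_isDiag b)) (ha'.trans hb'.symm)

theorem Sim.pruned₁_iff (hs : Sim t s) (u v : Vertex (Fin n)) :
    t.pruned₁ u v = true ↔ s(u, v) ∈ inside s.F₁ t.keptSet := by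
  rw [mem_inside, Tables.pruned₁, Bool.and_eq_true, Bool.and_eq_true, hs.F₁, Tables.mem_keptSet,
    Tables.mem_keptSet]

theorem Sim.pruned₂_iff (hs : Sim t s) (u v : Vertex (Fin n)) :
    t.pruned₂ u v = true ↔ s(u, v) ∈ inside s.F₂ (insert none t.keptSetᶜ) := by
  simp only [mem_inside, Tables.pruned₂, Bool.and_eq_true, hs.F₂, Bool.or_eq_true, mem_insert,
    mem_compl, Tables.mem_keptSet, Bool.not_eq_true', ← Bool.not_eq_true, decide_eq_true_eq,
      or_comm]

theorem Sim.exists_returns (hs : Sim t s) (ht : I.Terminal s) :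
    ∃ l₁ l₂ : List (Fin n), listing (successor t.pruned₁) = l₁.map some ∧
      listing (successor t.pruned₂) = l₂.map some ∧ I.Returns l₁ l₂ := by
  obtain ⟨⟨k, hr⟩, hrun⟩ := id ht
  have h := Inv.of_reached hr
  have hp := hs.pruned h hrun
  obtain ⟨A, h₁, h₂⟩ := h.isHSF hp
  obtain ⟨l₁, hl₁, he₁⟩ := exists_isShortcut_listing hs.pruned₁_iff
    (h.d₁.acyclic.anti (graph_mono hp.keeps₁.sub)) (fun e he => (h₁.1 e he).1) h₁.reachable
  obtain ⟨l₂, hl₂, he₂⟩ := exists_isShortcut_listing hs.pruned₂_iff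
    (h.d₂.acyclic.anti (graph_mono hp.keeps₂.sub)) (fun e he => (h₂.1 e he).1) h₂.reachable
  exact ⟨l₁, l₂, he₁, he₂, s, _, _, ht, hp, hl₁, hl₂⟩

end PruneSpec

/-! ### Correctness of the main loop on tables -/

section LoopSpec

variable {n : ℕ} {F : Finset (Edge (Fin n))} {C : Finset (Finset (Vertex (Fin n)))}
  {r : Vertex (Fin n) → Vertex (Fin n) → Bool} {a : Vertex (Fin n) → Bool}
  {active : Finset (Vertex (Fin n)) → ℕ}

/-- A table of components tells whether a vertex lies in the component of a given vertex. -/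
theorem eq_true_iff_mem (hC : Comps F C) (hr : ∀ u v, r u v = true ↔ ∃ X ∈ C, u ∈ X ∧ v ∈ X)
    {X : Finset (Vertex (Fin n))} {u v : Vertex (Fin n)} (hX : X ∈ C) (hu : u ∈ X) :
    r u v = true ↔ v ∈ X :=
  (hr u v).trans
      ⟨fun ⟨_, hY, huY, hvY⟩ => hC.eq_of_mem hY hX huY hu ▸ hvY, fun hv => ⟨X, hX, hu, hv⟩⟩

theorem eq_true_iff_mem' (hC : Comps F C) (hr : ∀ u v, r u v = true ↔ ∃ X ∈ C, u ∈ X ∧ v ∈ X)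
    {X : Finset (Vertex (Fin n))} {u v : Vertex (Fin n)} (hX : X ∈ C) (hu : u ∈ X) :
    r v u = true ↔ v ∈ X := by
  rw [← eq_true_iff_mem hC hr hX hu, hr, hr]
  simp only [and_comm]

theorem eq_true_iff_active (hC : Comps F C)
    (ha : ∀ v, a v = true ↔ ∃ X ∈ C, active X = 1 ∧ v ∈ X) {X : Finset (Vertex (Fin n))}
    {v : Vertex (Fin n)} (hX : X ∈ C) (hv : v ∈ X) : a v = true ↔ active X = 1 :=
  (ha v).trans ⟨fun ⟨_, hY, h, hvY⟩ => hC.eq_of_mem hY hX hvY hv ▸ h, fun h => ⟨X, hX, h, hv⟩⟩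

/-- The edges that compete for the increment, and their values, as computed from the tables. -/
theorem exists_isLink_iff (hC : Comps F C)
    (hr : ∀ u v, r u v = true ↔ ∃ X ∈ C, u ∈ X ∧ v ∈ X)
    (ha : ∀ v, a v = true ↔ ∃ X ∈ C, active X = 1 ∧ v ∈ X) (hle : ∀ X ∈ C, active X ≤ 1)
    {cost : Edge (Fin n) → ℝ} {p : Vertex (Fin n) → ℝ} {ε : ℝ} {i j : Vertex (Fin n)} :
    (∃ X Y, IsLink cost C active p ε X Y i j) ↔
      competes r a i j = true ∧ ε = tightAt (fun u v => cost s(u, v)) p a i j := by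
  obtain ⟨X, hX, hi⟩ := hC.exists_mem i
  obtain ⟨Y, hY, hj⟩ := hC.exists_mem j
  have hXY : X ≠ Y ↔ r i j = false := by
    rw [← Bool.not_eq_true, eq_true_iff_mem hC hr hX hi]
    exact not_congr ⟨fun h => h ▸ hj, fun h => hC.eq_of_mem hX hY h hj⟩
  have hlink : (∃ X Y, IsLink cost C active p ε X Y i j) ↔ IsLink cost C active p ε X Y i j := by
    refine ⟨?_, fun h => ⟨X, Y, h⟩⟩
    rintro ⟨X', Y', h⟩
    rwa [hC.eq_of_mem h.memx hX h.hi hi, hC.eq_of_mem h.memy hY h.hj hj] at h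
  have hval : IsLink cost C active p ε X Y i j ↔ X ≠ Y ∧ 0 < active X + active Y ∧
      ε = (cost s(i, j) - p i - p j) / ((active X + active Y : ℕ) : ℝ) :=
    ⟨fun h => ⟨h.ne, h.pos, h.eq⟩, fun h => ⟨hX, hY, h.1, hi, hj, h.2.1, h.2.2⟩⟩
  have h1 := eq_true_iff_active hC ha hX hi
  have h2 := eq_true_iff_active hC ha hY hj
  have h3 := hle X hX
  have h4 := hle Y hY
  rw [hlink, hval, competes, tightAt, hXY]
  have e1 : active X = if a i then 1 else 0 := by
    split_ifs with h
    · exact h1.1 h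
    · have := mt h1.2 h
      omega
  have e2 : active Y = if a j then 1 else 0 := by
    split_ifs with h
    · exact h2.1 h
    · have := mt h2.2 h
      omega
  rw [e1, e2]
  cases a i <;> cases a j <;> simp [one_add_one_eq_two]

theorem joined_iff (hC : Comps F C) (hr : ∀ u v, r u v = true ↔ ∃ X ∈ C, u ∈ X ∧ v ∈ X)
    {X Y : Finset (Vertex (Fin n))} {i j : Vertex (Fin n)} (hX : X ∈ C) (hY : Y ∈ C) (hi : i ∈ X)
    (hj : j ∈ Y) (u v : Vertex (Fin n)) : joined r i j u v = true ↔
      ∃ Z ∈ insert (X ∪ Y) ((C.erase X).erase Y), u ∈ Z ∧ v ∈ Z := by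
  simp only [joined, Bool.or_eq_true, Bool.and_eq_true, eq_true_iff_mem' hC hr hX hi,
    eq_true_iff_mem' hC hr hY hj, ← mem_union]
  constructor
  · rintro (h | h)
    · obtain ⟨Z, hZ, hu, hv⟩ := (hr u v).1 h
      obtain ⟨Z', hZ', hsub⟩ := subset_merge X Y hZ
      exact ⟨Z', hZ', hsub hu, hsub hv⟩
    · exact ⟨_, mem_insert_self _ _, h⟩
  · rintro ⟨Z, hZ, hu, hv⟩
    rcases mem_insert.1 hZ with rfl | hZ
    · exact Or.inr ⟨hu, hv⟩
    · exact Or.inl ((hr u v).2 ⟨Z, mem_of_mem_erase (mem_of_mem_erase hZ), hu, hv⟩)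

theorem withEdge_iff (hF : ∀ u v, r u v = true ↔ s(u, v) ∈ F) (i j u v : Vertex (Fin n)) :
    withEdge r i j u v = true ↔ s(u, v) ∈ insert s(i, j) F := by
  simp only [withEdge, Bool.or_eq_true, Bool.and_eq_true, hF, decide_eq_true_eq, mem_insert,
    Sym2.eq_iff]
  exact or_comm

/-- Picking a vertex of the component of `v` gives the same representative for all `v` in it. -/
theorem pick_mem_component (hC : Comps F C)
    (hr : ∀ u v, r u v = true ↔ ∃ X ∈ C, u ∈ X ∧ v ∈ X) {X : Finset (Vertex (Fin n))}
    (hX : X ∈ C) : ∃ w ∈ X, ∀ v ∈ X, pick (r v) = w := by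
  have hrX : ∀ v ∈ X, r v = fun u => decide (u ∈ X) := fun v hv => funext fun u =>
    Bool.eq_iff_iff.2 ((eq_true_iff_mem hC hr hX hv).trans (by simp))
  obtain ⟨x, hx⟩ := hC.nonempty hX
  refine ⟨pick fun u => decide (u ∈ X), ?_, fun v hv => by rw [hrX v hv]⟩
  exact of_decide_eq_true (pick_spec (p := fun u => decide (u ∈ X)) ⟨x, decide_eq_true hx⟩)

variable {I : Instance (Fin n)} {s : State (Fin n)} {t : Tables n}

theorem Sim.start : Sim (Tables.start n) (State.start (Fin n)) where
  comp₁ u v := by simp [Tables.start, State.start, eq_comm]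
  comp₂ u v := by simp [Tables.start, State.start, eq_comm]
  F₁ u v := by simp [Tables.start, State.start]
  F₂ u v := by simp [Tables.start, State.start]
  act₁ v := by cases v <;> simp [Tables.start, State.start]
  p₁ := rfl
  p₂ := rfl
  margin X _ := by simp [Tables.start, State.start]
  label u v := by simp [Tables.start, State.start]

theorem Sim.running_iff (hs : Sim t s) (h : Inv I s) : s.Running ↔ ∃ v, t.act₁ v = true := by
  constructor
  · rintro ⟨X, hX, ha⟩
    obtain ⟨v, hv⟩ := h.d₁.nonempty hX
    exact ⟨v, (hs.act₁ v).2 ⟨X, hX, ha, hv⟩⟩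
  · rintro ⟨v, hv⟩
    obtain ⟨X, hX, ha, _⟩ := (hs.act₁ v).1 hv
    exact ⟨X, hX, ha⟩

theorem Sim.act₂ (hs : Sim t s) (h : Inv I s) (v : Vertex (Fin n)) :
    t.act₂ v = true ↔ ∃ X ∈ s.C₂, s.active₂ X = 1 ∧ v ∈ X := by
  obtain ⟨X, hX, hv⟩ := h.d₂.exists_mem v
  have h1 : (∃ X ∈ s.C₂, s.active₂ X = 1 ∧ v ∈ X) ↔ s.active₂ X = 1 :=
    ⟨fun ⟨Y, hY, ha, hvY⟩ => h.d₂.eq_of_mem hY hX hvY hv ▸ ha, fun ha => ⟨X, hX, ha, hv⟩⟩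
  rw [h1, Tables.act₂, Bool.and_eq_true, Bool.not_eq_true', Bool.not_eq_true', ← Bool.not_eq_true,
    ← Bool.not_eq_true, eq_true_iff_mem h.d₂.toComps hs.comp₂ hX hv]
  by_cases hn : none ∈ X
  · simp [hn, h.root₂ hX hn]
  · obtain ⟨hp, hsub⟩ := h.parent hX hn
    rw [eq_true_iff_mem h.d₁.toComps hs.comp₁ hp (hsub hv), h.active₂_eq hX hn hp hsub]
    split_ifs with hnp <;> simp [hn, hnp]

theorem Sim.childless_iff (hs : Sim t s) (h : Inv I s) {D : Finset (Vertex (Fin n))}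
    {i : Vertex (Fin n)} (hD : D ∈ s.C₁) (hi : i ∈ D) :
    t.childless i = true ↔ s.active₁ D = 1 ∧ s.children D = ∅ := by
  rw [Tables.childless, Bool.and_eq_true, eq_true_iff_active h.d₁.toComps hs.act₁ hD hi,
    decide_eq_true_eq, eq_empty_iff_forall_notMem]
  refine and_congr_right fun ha => ?_
  simp only [Bool.or_eq_true, Bool.not_eq_true', ← Bool.not_eq_true,
    eq_true_iff_mem h.d₁.toComps hs.comp₁ hD hi, h.children hD]
  constructor
  · rintro hall X ⟨hX, hn, hsub⟩
    obtain ⟨u, hu⟩ := h.d₂.nonempty hX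
    have := (hall u).resolve_left (by simpa using hsub hu)
    exact hn ((eq_true_iff_mem h.d₂.toComps hs.comp₂ hX hu).1 this)
  · intro hall u
    by_cases hu : u ∈ D
    · right
      obtain ⟨X, hX, huX⟩ := h.d₂.exists_mem u
      rw [eq_true_iff_mem h.d₂.toComps hs.comp₂ hX huX]
      by_contra hn
      obtain ⟨hp, hsub⟩ := h.parent hX hn
      exact hall X ⟨hX, hn, h.d₁.eq_of_mem hp hD (hsub huX) hu ▸ hsub⟩
    · exact Or.inl hu

theorem Sim.slack_eq (hs : Sim t s) (h : Inv I s) {D : Finset (Vertex (Fin n))}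
    {i : Vertex (Fin n)} (hD : D ∈ s.C₁) (hi : i ∈ D) : t.slack i = s.bound D - s.w D := by
  have hv : ∀ v, (bif t.comp₁ i v then t.margin v else 0) = if v ∈ D then t.margin v else 0 := by
    intro v
    have := eq_true_iff_mem h.d₁.toComps hs.comp₁ (v := v) hD hi
    cases hc : t.comp₁ i v <;> simp_all
  rw [← hs.margin D hD, Tables.slack, sum_congr rfl fun v _ => hv v, sum_ite_mem, univ_inter]

/-- The test on tables decides whether `ε` is at most the value of each event. -/
theorem Sim.earliest_iff (hs : Sim t s) (h : Inv I s) (ε : ℝ) :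
    t.earliest (fun u v => I.cost₁ s(u, v), fun u v => I.cost₂ s(u, v)) ε = true ↔
      ∀ δ, I.Cand₁ s δ ∨ I.Cand₂ s δ ∨ (∃ X, Instance.IsTight s δ X) → ε ≤ δ := by
  have h₁ : ∀ δ i j, _ ↔ _ := fun δ i j => exists_isLink_iff (cost := I.cost₁) (p := s.p₁) (ε := δ)
    (i := i) (j := j) h.d₁.toComps hs.comp₁ hs.act₁ fun X hX => h.active₁_le hX
  have h₂ : ∀ δ i j, _ ↔ _ := fun δ i j => exists_isLink_iff (cost := I.cost₂) (p := s.p₂) (ε := δ)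
    (i := i) (j := j) h.d₂.toComps hs.comp₂ (hs.act₂ h) fun X hX => h.active₂_le_one hX
  simp only [Tables.earliest, Bool.and_eq_true, decide_eq_true_eq, Bool.or_eq_true,
    Bool.not_eq_true', ← Bool.not_eq_true, ← imp_iff_not_or, hs.p₁, hs.p₂]
  constructor
  · rintro ⟨e₁, e₂, e₃⟩ δ (⟨X, Y, i, j, hl⟩ | ⟨X, Y, i, j, hl⟩ | ⟨X, hX, ha, hc, rfl⟩)
    · obtain ⟨hc, rfl⟩ := (h₁ δ i j).1 ⟨X, Y, hl⟩
      exact e₁ i j hc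
    · obtain ⟨hc, rfl⟩ := (h₂ δ i j).1 ⟨X, Y, hl⟩
      exact e₂ i j hc
    · obtain ⟨i, hi⟩ := h.d₁.nonempty hX
      rw [← hs.slack_eq h hX hi]
      exact e₃ i ((hs.childless_iff h hX hi).2 ⟨ha, hc⟩)
  · refine fun e => ⟨fun i j hc => e _ (Or.inl ?_), fun i j hc => e _ (Or.inr (Or.inl ?_)),
      fun i hc => e _ (Or.inr (Or.inr ?_))⟩
    · obtain ⟨X, Y, hl⟩ := (h₁ _ i j).2 ⟨hc, rfl⟩
      exact ⟨X, Y, i, j, hl⟩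
    · obtain ⟨X, Y, hl⟩ := (h₂ _ i j).2 ⟨hc, rfl⟩
      exact ⟨X, Y, i, j, hl⟩
    · obtain ⟨X, hX, hi⟩ := h.d₁.exists_mem i
      obtain ⟨ha, hch⟩ := (hs.childless_iff h hX hi).1 hc
      exact ⟨X, hX, ha, hch, hs.slack_eq h hX hi⟩

theorem Sim.eligible₁_iff (hs : Sim t s) (h : Inv I s) (i j : Vertex (Fin n)) :
    t.eligible₁ (fun u v => I.cost₁ s(u, v), fun u v => I.cost₂ s(u, v)) i j = true ↔
      ∃ X Y, IsLink I.cost₁ s.C₁ s.active₁ s.p₁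
        (tightAt (fun u v => I.cost₁ s(u, v)) t.p₁ t.act₁ i j) X Y i j ∧
        I.IsIncrement s (tightAt (fun u v => I.cost₁ s(u, v)) t.p₁ t.act₁ i j) := by
  simp only [exists_and_right]
  rw [Tables.eligible₁, Bool.and_eq_true, hs.earliest_iff h, exists_isLink_iff h.d₁.toComps hs.comp₁
    hs.act₁ fun X hX => h.active₁_le hX, hs.p₁]
  simp only [and_true]
  refine and_congr_right fun hc => ⟨fun he => ⟨?_, he⟩, fun he => he.2⟩
  obtain ⟨X, Y, hl⟩ := (exists_isLink_iff (cost := I.cost₁) (p := s.p₁) h.d₁.toComps hs.comp₁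
    hs.act₁ fun X hX => h.active₁_le hX).2 ⟨hc, rfl⟩
  exact Or.inl ⟨X, Y, i, j, hl⟩

theorem Sim.eligible₂_iff (hs : Sim t s) (h : Inv I s) (i j : Vertex (Fin n)) :
    t.eligible₂ (fun u v => I.cost₁ s(u, v), fun u v => I.cost₂ s(u, v)) i j = true ↔
      ∃ X Y, IsLink I.cost₂ s.C₂ s.active₂ s.p₂
        (tightAt (fun u v => I.cost₂ s(u, v)) t.p₂ t.act₂ i j) X Y i j ∧
        I.IsIncrement s (tightAt (fun u v => I.cost₂ s(u, v)) t.p₂ t.act₂ i j) := by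
  simp only [exists_and_right]
  rw [Tables.eligible₂, Bool.and_eq_true, hs.earliest_iff h, exists_isLink_iff h.d₂.toComps hs.comp₂
    (hs.act₂ h) fun X hX => h.active₂_le_one hX, hs.p₂]
  simp only [and_true]
  refine and_congr_right fun hc => ⟨fun he => ⟨?_, he⟩, fun he => he.2⟩
  obtain ⟨X, Y, hl⟩ := (exists_isLink_iff (cost := I.cost₂) (p := s.p₂) h.d₂.toComps hs.comp₂
    (hs.act₂ h) fun X hX => h.active₂_le_one hX).2 ⟨hc, rfl⟩
  exact Or.inr (Or.inl ⟨X, Y, i, j, hl⟩)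

theorem Sim.eligible₃_iff (hs : Sim t s) (h : Inv I s) (i : Vertex (Fin n)) :
    t.eligible₃ (fun u v => I.cost₁ s(u, v), fun u v => I.cost₂ s(u, v)) i = true ↔
      ∃ X, i ∈ X ∧ Instance.IsTight s (t.slack i) X ∧ I.IsIncrement s (t.slack i) := by
  rw [Tables.eligible₃, Bool.and_eq_true, hs.earliest_iff h]
  constructor
  · rintro ⟨hc, he⟩
    obtain ⟨X, hX, hi⟩ := h.d₁.exists_mem i
    obtain ⟨ha, hch⟩ := (hs.childless_iff h hX hi).1 hc
    have ht : Instance.IsTight s (t.slack i) X := ⟨hX, ha, hch, hs.slack_eq h hX hi⟩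
    exact ⟨X, hi, ht, Or.inr (Or.inr ⟨X, ht⟩), he⟩
  · rintro ⟨X, hi, ⟨hX, ha, hch, _⟩, he⟩
    exact ⟨(hs.childless_iff h hX hi).2 ⟨ha, hch⟩, he.2⟩

theorem sum_bif_eq_card (X : Finset (Vertex (Fin n))) (p : Vertex (Fin n) → Bool) (ε : ℝ) :
    ∑ v ∈ X, (bif p v then ε else 0) = ε * ((X.filter fun v => p v = true).card : ℝ) := by
  rw [← nsmul_eq_mul', ← sum_const, sum_filter]
  exact sum_congr rfl fun v _ => by cases p v <;> simp

/-- Growing on tables. The margin of an active component `X` of the first vehicle increases by `ε`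
for each of its children and decreases by `ε` for `X` itself, which is done at representatives. -/
theorem Sim.grow (hs : Sim t s) (h : Inv I s) (ε : ℝ) : Sim (t.grow ε) (s.grow ε) where
  comp₁ := hs.comp₁
  comp₂ := hs.comp₂
  F₁ := hs.F₁
  F₂ := hs.F₂
  act₁ := hs.act₁
  p₁ := by
    funext v
    have := hs.act₁ v
    simp only [Tables.grow, State.grow, hs.p₁, ← this]
    cases t.act₁ v <;> rfl
  p₂ := by
    funext v
    have := hs.act₂ h v
    simp only [Tables.grow, State.grow, hs.p₂, ← this]
    cases t.act₂ v <;> rfl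
  label := hs.label
  margin X hX := by
    have hX' : X ∈ s.C₁ := hX
    have ha := fun v (hv : v ∈ X) => eq_true_iff_active h.d₁.toComps hs.act₁ hX' hv
    simp only [Tables.grow, State.grow, hX', true_and]
    rw [sum_sub_distrib, sum_add_distrib, hs.margin X hX', sum_bif_eq_card, sum_bif_eq_card]
    by_cases hact : s.active₁ X = 1
    · have h1 : (X.filter fun v => (t.act₁ v && decide (v = pick (t.comp₁ v))) = true).card =
      1 := by
        obtain ⟨w, hw, hpick⟩ := pick_mem_component h.d₁.toComps hs.comp₁ hX'
        rw [card_eq_one]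
        refine ⟨w, eq_singleton_iff_unique_mem.2 ⟨mem_filter.2 ⟨hw, ?_⟩, fun v hv => ?_⟩⟩
        · simp [(ha w hw).2 hact, hpick w hw]
        · simp only [mem_filter, Bool.and_eq_true, decide_eq_true_eq] at hv
          rw [hv.2.2, hpick v hv.1]
      have h2 : (X.filter fun v => (t.act₁ v && (t.act₂ v && decide (v = pick (t.comp₂ v)))) =
          true).card = (s.children X).card := by
        have hch := h.children hX'
        symm
        have hrep : ∀ D ∈ s.children X, ∃ w ∈ D, ∀ v ∈ D, pick (t.comp₂ v) = w := fun D hD =>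
          pick_mem_component h.d₂.toComps hs.comp₂ ((hch D).1 hD).1
        choose! w hw hpick using hrep
        have hnX : none ∉ X := fun hn => by simp [h.root₁ hX' hn] at hact
        refine card_nbij w (fun D hD => ?_) (fun D hD D' hD' he => ?_) fun v hv => ?_
        · obtain ⟨hD2, hn, hsub⟩ := (hch D).1 hD
          refine mem_filter.2 ⟨hsub (hw D hD), ?_⟩
          have hact₂ : s.active₂ D = 1 := by rw [h.active₂_eq hD2 hn hX' hsub, if_neg hnX]
          simp [(ha _ (hsub (hw D hD))).2 hact, (hs.act₂ h _).2 ⟨D, hD2, hact₂, hw D hD⟩,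
            hpick D hD _ (hw D hD)]
        · refine h.d₂.eq_of_mem ((hch D).1 hD).1 ((hch D').1 hD').1 (hw D hD) ?_
          rw [he]
          exact hw D' hD'
        · simp only [coe_filter, Set.mem_ofPred_eq, Bool.and_eq_true, decide_eq_true_eq] at hv
          obtain ⟨hvX, _, hv2, hv3⟩ := hv
          obtain ⟨D, hD, haD, hvD⟩ := (hs.act₂ h v).1 hv2
          have hn : none ∉ D := fun hn => by simp [h.root₂ hD hn] at haD
          have hmem : D ∈ s.children X := (hch D).2 ⟨hD, hn, h.subset_of_mem hD hn hX' hvD hvX⟩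
          exact ⟨D, hmem, by rw [← hpick D hmem v hvD, ← hv3]⟩
      rw [if_pos hact, if_pos hact, h1, h2]
      push_cast
      ring
    · have h0 : ∀ v ∈ X, t.act₁ v = false := fun v hv => by
        rw [Bool.eq_false_iff]
        exact fun h => hact ((ha v hv).1 h)
      rw [if_neg hact, if_neg hact, filter_false_of_mem, filter_false_of_mem]
      · simp
      · intro v hv; simp [h0 v hv]
      · intro v hv; simp [h0 v hv]

theorem Sim.merge₁ (hs : Sim t s) (hC : Comps s.F₁ s.C₁) {X Y : Finset (Vertex (Fin n))}
    {i j : Vertex (Fin n)} (hX : X ∈ s.C₁) (hY : Y ∈ s.C₁) (hne : X ≠ Y) (hi : i ∈ X) (hj : j ∈ Y) :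
    Sim (t.merge₁ i j) (s.merge₁ s(i, j) X Y) where
  comp₁ := joined_iff hC hs.comp₁ hX hY hi hj
  comp₂ := hs.comp₂
  F₁ := withEdge_iff hs.F₁ i j
  F₂ := hs.F₂
  p₁ := hs.p₁
  p₂ := hs.p₂
  label := hs.label
  act₁ v := by
    have hXY : X ∪ Y ∉ (s.C₁.erase X).erase Y := fun hm =>
      hne (hC.eq_of_mem (mem_of_mem_erase (mem_of_mem_erase hm)) hX (mem_union_left _ hi) hi ▸
        (hC.eq_of_mem (mem_of_mem_erase (mem_of_mem_erase hm)) hY (mem_union_right _ hj) hj))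
    have hv : ∀ v, (t.comp₁ v i || t.comp₁ v j) = true ↔ v ∈ X ∪ Y := fun v => by
      rw [Bool.or_eq_true, eq_true_iff_mem' hC hs.comp₁ hX hi, eq_true_iff_mem' hC hs.comp₁ hY hj,
        mem_union]
    simp only [Tables.merge₁, State.merge₁, exists_mem_insert, Function.update_self]
    by_cases hvm : v ∈ X ∪ Y
    · rw [(hv v).2 hvm, cond_true, Bool.not_eq_true', ← Bool.not_eq_true, hv]
      constructor
      · intro hn
        exact Or.inl ⟨by rw [if_neg hn], hvm⟩
      · rintro (⟨h1, _⟩ | ⟨Z, hZ, _, hvZ⟩)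
        · intro hn
          simp [hn] at h1
        · simp only [mem_erase] at hZ
          rcases mem_union.1 hvm with hvm | hvm
          · exact absurd (hC.eq_of_mem hZ.2.2 hX hvZ hvm) hZ.2.1
          · exact absurd (hC.eq_of_mem hZ.2.2 hY hvZ hvm) hZ.1
    · rw [Bool.eq_false_iff.2 (mt (hv v).1 hvm), cond_false, hs.act₁]
      constructor
      · rintro ⟨Z, hZ, ha, hvZ⟩
        refine Or.inr ⟨Z, mem_erase.2 ⟨?_, mem_erase.2 ⟨?_, hZ⟩⟩, ?_, hvZ⟩
        · rintro rfl; exact hvm (mem_union_right _ hvZ)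
        · rintro rfl; exact hvm (mem_union_left _ hvZ)
        · rw [Function.update_of_ne (by rintro rfl; exact hvm hvZ)]
          exact ha
      · rintro (⟨_, h1⟩ | ⟨Z, hZ, ha, hvZ⟩)
        · exact absurd h1 hvm
        · rw [Function.update_of_ne (by rintro rfl; exact hvm hvZ)] at ha
          exact ⟨Z, mem_of_mem_erase (mem_of_mem_erase hZ), ha, hvZ⟩
  margin Z hZ := by
    simp only [Tables.merge₁, State.merge₁]
    rcases eq_or_ne Z (X ∪ Y) with rfl | hne'
    · have hd : Disjoint X Y := disjoint_left.2 fun v hv hv' => hne (hC.eq_of_mem hX hY hv hv')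
      rw [Function.update_self, Function.update_self, sum_union hd, hs.margin X hX, hs.margin Y hY]
      ring
    · rw [Function.update_of_ne hne', Function.update_of_ne hne']
      exact hs.margin Z (mem_of_mem_erase (mem_of_mem_erase (mem_of_mem_insert_of_ne hZ hne')))

theorem Sim.merge₂ (hs : Sim t s) (hC : Comps s.F₂ s.C₂) {X Y : Finset (Vertex (Fin n))}
    {i j : Vertex (Fin n)} (hX : X ∈ s.C₂) (hY : Y ∈ s.C₂) (hi : i ∈ X) (hj : j ∈ Y) :
    Sim (t.merge₂ i j) (s.merge₂ s(i, j) X Y) := by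
  have h1 := joined_iff hC hs.comp₂ hX hY hi hj
  have h2 := withEdge_iff hs.F₂ i j
  rw [State.merge₂]
  split_ifs
  all_goals exact ⟨hs.comp₁, h1, hs.F₁, h2, hs.act₁, hs.p₁, hs.p₂, hs.margin, hs.label⟩

theorem Sim.deactivate (hs : Sim t s) (h : Inv I s) {X : Finset (Vertex (Fin n))}
    {i : Vertex (Fin n)} (hX : X ∈ s.C₁) (hi : i ∈ X) : Sim (t.deactivate i) (s.deactivate X) where
  comp₁ := hs.comp₁
  comp₂ := hs.comp₂
  F₁ := hs.F₁
  F₂ := hs.F₂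
  p₁ := hs.p₁
  p₂ := hs.p₂
  margin := hs.margin
  act₁ v := by
    simp only [Tables.deactivate, State.deactivate, Bool.and_eq_true, Bool.not_eq_true',
      ← Bool.not_eq_true, eq_true_iff_mem h.d₁.toComps hs.comp₁ hX hi, hs.act₁]
    constructor
    · rintro ⟨⟨Z, hZ, ha, hv⟩, hvX⟩
      exact ⟨Z, hZ, by rwa [Function.update_of_ne (by rintro rfl; exact hvX hv)], hv⟩
    · rintro ⟨Z, hZ, ha, hv⟩
      have hne : Z ≠ X := by rintro rfl; simp at ha
      rw [Function.update_of_ne hne] at ha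
      exact ⟨⟨Z, hZ, ha, hv⟩, fun hvX => hne (h.d₁.eq_of_mem hZ hX hv hvX)⟩
  label u v := by
    simp only [Tables.deactivate, State.deactivate, Bool.or_eq_true, Bool.and_eq_true,
      Bool.not_eq_true', ← Bool.not_eq_true, eq_true_iff_mem h.d₁.toComps hs.comp₁ hX hi,
      hs.label_self h, hs.label]
    cases hl : s.label u with
    | none => by_cases hu : u ∈ X <;> simp [hu]
    | some L => simp

/-- One iteration on tables simulates an iteration of the main loop, for some way to resolve ties.
-/
theorem Sim.exists_step (hs : Sim t s) (h : Inv I s) (hrun : s.Running) :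
    ∃ s', I.Step s s' ∧
      Sim (t.step (fun u v => I.cost₁ s(u, v), fun u v => I.cost₂ s(u, v))) s' := by
  obtain ⟨ε, hε⟩ := h.exists_increment hrun
  rw [Tables.step, decide_eq_true ((hs.running_iff h).1 hrun), cond_true]
  by_cases h1 : ∃ i, decide (∃ j, t.eligible₁ (fun u v => I.cost₁ s(u, v), fun u v =>
      I.cost₂ s(u, v)) i j = true) = true
  · have h1' := pick_spec h1
    rw [decide_eq_true h1, cond_true, Tables.iteration₁]
    set i := pick fun i => decide (∃ j, t.eligible₁ (fun u v => I.cost₁ s(u, v), fun u v =>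
      I.cost₂ s(u, v)) i j = true)
    obtain ⟨X, Y, hl, hinc⟩ := (hs.eligible₁_iff h _ _).1 (pick_spec (of_decide_eq_true h1'))
    exact ⟨_, .case₁ s _ X Y _ _ hrun hinc hl,
      (hs.grow h _).merge₁ (h.grow_increment hinc).d₁.toComps hl.memx hl.memy hl.ne hl.hi hl.hj⟩
  rw [decide_eq_false h1, cond_false]
  have hc1 : ¬ I.Cand₁ s ε := by
    rintro ⟨X, Y, i, j, hl⟩
    have := (exists_isLink_iff (cost := I.cost₁) (p := s.p₁) h.d₁.toComps hs.comp₁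
      hs.act₁ fun X hX => h.active₁_le hX).1 ⟨X, Y, hl⟩
    rw [← hs.p₁] at this
    refine h1 ⟨i, decide_eq_true ⟨j, (hs.eligible₁_iff h i j).2 ⟨X, Y, ?_⟩⟩⟩
    rw [← this.2]
    exact ⟨hl, hε⟩
  by_cases h2 : ∃ i, decide (∃ j, t.eligible₂ (fun u v => I.cost₁ s(u, v), fun u v =>
      I.cost₂ s(u, v)) i j = true) = true
  · have h2' := pick_spec h2
    rw [decide_eq_true h2, cond_true, Tables.iteration₂]
    set i := pick fun i => decide (∃ j, t.eligible₂ (fun u v => I.cost₁ s(u, v), fun u v =>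
      I.cost₂ s(u, v)) i j = true)
    obtain ⟨X, Y, hl, hinc⟩ := (hs.eligible₂_iff h _ _).1 (pick_spec (of_decide_eq_true h2'))
    exact ⟨_, .case₂ s _ X Y _ _ hrun hinc (hinc.unique hε ▸ hc1) hl,
      (hs.grow h _).merge₂ (h.grow_increment hinc).d₂.toComps hl.memx hl.memy hl.hi hl.hj⟩
  rw [decide_eq_false h2, cond_false, Tables.iteration₃]
  have hc2 : ¬ I.Cand₂ s ε := by
    rintro ⟨X, Y, i, j, hl⟩
    have := (exists_isLink_iff (cost := I.cost₂) (p := s.p₂) h.d₂.toComps hs.comp₂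
      (hs.act₂ h) fun X hX => h.active₂_le_one hX).1 ⟨X, Y, hl⟩
    rw [← hs.p₂] at this
    refine h2 ⟨i, decide_eq_true ⟨j, (hs.eligible₂_iff h i j).2 ⟨X, Y, ?_⟩⟩⟩
    rw [← this.2]
    exact ⟨hl, hε⟩
  have h3 : ∃ i, t.eligible₃ (fun u v => I.cost₁ s(u, v), fun u v => I.cost₂ s(u, v)) i = true := by
    obtain ⟨X, ht⟩ := (hε.1.resolve_left hc1).resolve_left hc2
    obtain ⟨i, hi⟩ := h.d₁.nonempty ht.1
    have he : t.slack i = ε := (hs.slack_eq h ht.1 hi).trans ht.2.2.2.symm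
    exact ⟨i, (hs.eligible₃_iff h i).2 ⟨X, hi, he.symm ▸ ht, he.symm ▸ hε⟩⟩
  obtain ⟨X, hi, ht, hinc⟩ := (hs.eligible₃_iff h _).1 (pick_spec h3)
  exact ⟨_, .case₃ s _ X hrun hinc (hinc.unique hε ▸ hc1) (hinc.unique hε ▸ hc2) ht,
    (hs.grow h _).deactivate (h.grow_increment hinc) ht.1 hi⟩

theorem Sim.step_eq (hs : Sim t s) (h : Inv I s) (hrun : ¬ s.Running)
    (c : (Vertex (Fin n) → Vertex (Fin n) → ℝ) × (Vertex (Fin n) → Vertex (Fin n) → ℝ)) :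
    t.step c = t := by
  rw [Tables.step, decide_eq_false (mt (hs.running_iff h).2 hrun), cond_false]

/-- The tables end up in a final state of the main loop, since `3 * (n + 1)` iterations exceed the
bound and nothing changes after the end. -/
theorem exists_sim_final (I : Instance (Fin n)) : ∃ s, I.Terminal s ∧
    Sim (Tables.final (fun u v => I.cost₁ s(u, v), fun u v => I.cost₂ s(u, v))) s := by
  set c : (Vertex (Fin n) → Vertex (Fin n) → ℝ) × (Vertex (Fin n) → Vertex (Fin n) → ℝ) :=
    (fun u v => I.cost₁ s(u, v), fun u v => I.cost₂ s(u, v))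
  have key : ∀ k, ∃ s, Sim ((Tables.step c)^[k] (Tables.start n)) s ∧
      (I.Reached k s ∨ I.Terminal s) := by
    intro k
    induction k with
    | zero => exact ⟨_, Sim.start, Or.inl .start⟩
    | succ k ih =>
      obtain ⟨s, hs, hr⟩ := ih
      rw [Function.iterate_succ_apply']
      have h : Inv I s := by
        rcases hr with hr | ⟨⟨_, hr⟩, _⟩ <;> exact Inv.of_reached hr
      by_cases hrun : s.Running
      · obtain ⟨s', hstep, hs'⟩ := hs.exists_step h hrun
        exact ⟨s', hs', Or.inl (.next k s s' (hr.resolve_right fun ht => ht.2 hrun) hstep)⟩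
      · rw [hs.step_eq h hrun]
        exact ⟨s, hs, Or.inr (hr.elim (fun hr => ⟨⟨k, hr⟩, hrun⟩) fun ht => ht)⟩
  obtain ⟨s, hs, hr⟩ := key (3 * (n + 1))
  rw [Function.iterate_mul] at hs
  refine ⟨s, hr.resolve_left fun hr => ?_, hs⟩
  have := hr.potential
  rw [Fintype.card_fin] at this
  omega

theorem exists_returns_procedure (I : Instance (Fin n)) : ∃ l₁ l₂ : List (Fin n),
    procedure (fun u v => I.cost₁ s(u, v), fun u v => I.cost₂ s(u, v)) =
      (l₁.map some, l₂.map some) ∧ I.Returns l₁ l₂ := by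
  obtain ⟨s, ht, hs⟩ := exists_sim_final I
  obtain ⟨l₁, l₂, h1, h2, h3⟩ := hs.exists_returns ht
  exact ⟨l₁, l₂, Prod.ext h1 h2, h3⟩

theorem exists_prog : ∃ (P : Prog inputTy outputTy) (q : Polynomial ℕ),
    ∀ (n : ℕ) (I : Instance (Fin n)), (P.run I.input).2 ≤ q.eval n ∧
      ∃ l₁ l₂ : List (Fin n), (P.run I.input).1 = output l₁ l₂ ∧ I.Returns l₁ l₂ := by
  obtain ⟨P, q, h⟩ := PolyTime.exists_prog_input (fun n c => procedure c)
    (hf := PolyTime.procedure fun _ c => c)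
  refine ⟨P, q, fun n I => ⟨(h n I).2, ?_⟩⟩
  obtain ⟨l₁, l₂, he, hr⟩ := exists_returns_procedure I
  refine ⟨l₁, l₂, ?_, hr⟩
  rw [(h n I).1, he, List.map_map, List.map_map]
  rfl

end LoopSpec

end TwoDepot

end

theorem theorem1 :
    -- every instance: the algorithm terminates, and all its results satisfy the bounds
    (∀ (T : Type*) [Fintype T] [DecidableEq T] (I : TwoDepot.Instance T),
      -- at most `3|T| + 2` iterations, and the main loop never gets stuck
      (∀ k s, I.Reached k s → k ≤ 3 * Fintype.card T + 2 ∧ (s.Running → ∃ s', I.Step s s')) ∧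
      -- pruning is possible
      (∀ s, I.Terminal s → ∃ F₁ F₂, TwoDepot.Pruned s F₁ F₂) ∧
      -- the linear program is a relaxation of the problem
      (∀ l₁ l₂ : List T, TwoDepot.IsTourPair l₁ l₂ →
        ∃ x y z, TwoDepot.LPFeasible (T := T) x y z ∧ I.lpCost x y = I.pairCost l₁ l₂) ∧
      ∃ opt : ℝ, IsLeast I.tourCosts opt ∧
        ∀ s F₁ F₂, I.Terminal s → TwoDepot.Pruned s F₁ F₂ →
          TwoDepot.IsHSF F₁ F₂ ∧
          I.forestCost F₁ F₂ ≤ TwoDepot.dualValue s.Y₁ ∧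
          I.DualFeasible s.Y₁ s.Y₂ ∧
          (∀ x y z, TwoDepot.LPFeasible x y z → TwoDepot.dualValue s.Y₁ ≤ I.lpCost x y) ∧
          TwoDepot.dualValue s.Y₁ ≤ opt ∧
          I.forestCost F₁ F₂ ≤ opt ∧
          -- doubling and shortcutting
          (∃ l₁ l₂, TwoDepot.IsShortcut F₁ l₁ ∧ TwoDepot.IsShortcut F₂ l₂) ∧
          ∀ l₁ l₂, TwoDepot.IsShortcut F₁ l₁ → TwoDepot.IsShortcut F₂ l₂ →
            TwoDepot.IsTourPair l₁ l₂ ∧ I.pairCost l₁ l₂ ≤ 2 * opt) ∧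
    -- the complete procedure is implemented by a program running in polynomial time
    (∃ (P : TwoDepot.Prog TwoDepot.inputTy TwoDepot.outputTy) (q : Polynomial ℕ),
      ∀ (n : ℕ) (I : TwoDepot.Instance (Fin n)),
        (P.run I.input).2 ≤ q.eval n ∧
        ∃ l₁ l₂ : List (Fin n), (P.run I.input).1 = TwoDepot.output l₁ l₂ ∧
          I.Returns l₁ l₂ ∧ TwoDepot.IsTourPair l₁ l₂ ∧
          ∀ opt : ℝ, IsLeast I.tourCosts opt → I.pairCost l₁ l₂ ≤ 2 * opt) := by
  refine ⟨fun T _ _ I => ⟨fun k s hr => ⟨?_, (TwoDepot.Inv.of_reached hr).exists_step⟩, ?_, ?_, ?_⟩, ?_⟩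
  · have := hr.potential
    omega
  · rintro s ⟨⟨k, hr⟩, hrun⟩
    exact (TwoDepot.Inv.of_reached hr).exists_pruned hrun
  · exact fun l₁ l₂ h => TwoDepot.exists_lpFeasible I h
  · obtain ⟨opt, hopt⟩ := TwoDepot.exists_isLeast_tourCosts I
    refine ⟨opt, hopt, fun s F₁ F₂ hs hp => ?_⟩
    obtain ⟨k, hr⟩ := hs.1
    have h := TwoDepot.Inv.of_reached hr
    obtain ⟨h1, h2, h3⟩ := hs.guarantee hp hopt
    exact ⟨h.isHSF hp, TwoDepot.forestCost_le_dualValue hr hp, h.dualFeasible,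
      fun x y z hf => h.dualFeasible.le_lpCost hf, h1, h2, h.exists_shortcuts hp, h3⟩
  · obtain ⟨P, q, h⟩ := TwoDepot.exists_prog
    refine ⟨P, q, fun n I => ⟨(h n I).1, ?_⟩⟩
    obtain ⟨l₁, l₂, he, hr⟩ := (h n I).2
    obtain ⟨s, F₁, F₂, hs, hp, hl₁, hl₂⟩ := id hr
    have hg := fun opt (hopt : IsLeast I.tourCosts opt) => (hs.guarantee hp hopt).2.2 l₁ l₂ hl₁ hl₂
    obtain ⟨opt, hopt⟩ := TwoDepot.exists_isLeast_tourCosts I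
    exact ⟨l₁, l₂, he, hr, (hg opt hopt).1, fun opt hopt => (hg opt hopt).2⟩
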